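/- **Theorem (safety of Interlude).** *Blocks and chains.* Fix an integer $k$ (the number of sub-chains). A chain is the genesis block or extends a chain $C$ by a $k$-set on top of $C$ (one parallel block on each of the $k$ sub-chains, all pointing to the last series block of $C$, with pairwise distinct proofs of work) and one series block pointing to that $k$-set. A proof of work for a parallel block commits to one transaction set for each sub-chain and may be published on any sub-chain, where it contributes the transaction set of that sub-chain; at most one copy of it can be in a $k$-set, and an honest miner makes it available on every sub-chain. $|C|$ is the number of series blocks of $C$. For a transaction $\mathcal T$ and the set of chains available to a party, $C_{\max}$ is the longest chain, $C^*$ the longest chain that contains $\mathcal T$ (with $|C^*|=0$ if there is none) and $C'$ the longest chain that does not contain $\mathcal T$. The party accepts $\mathcal T$ with security parameter $\kappa$ if $|C_{\max}|-|C'|>\kappa$. *Mining and network.* There are $n\ge 1$ honest and $m$ adversarial parties, and $\alpha=m/n$. Each party has a Poisson clock of rate $\lambda/n$ for parallel blocks and one of rate $\beta/n$ for series blocks, all independent; it mines one block of its choice at a time and obtains it when its clock for that kind of block rings. Hash values of proofs of work are independent and uniform. An honest party selects the available chain with the most series blocks, then with the most blocks in the (incomplete) $k$-set on top, then with the lowest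 hash of its last series block. If a complete $k$-set is available on top of it, the party mines a series block on such a $k$-set, one with the least parallel block hash; otherwise it mines a parallel block on top of the selected chain. The chain selected by an honest party (with the parallel blocks on top of it) and the blocks it mines reach every honest party within time $\delta$. The adversarial parties mine on arbitrary existing blocks, withhold or reveal their blocks to chosen honest parties at any time, and control all delays up to $\delta$; their decisions may depend in any way on the past (and on private randomness) but not on the future of the clocks. The run is observed at the ring times of the clocks. The round in progress at a given time is the number of series blocks mined by honest parties up to then. *Assumptions.* $\lambda,\beta>0$, $\delta\ge 0$, $\alpha<\frac12$, $\frac1\beta-\delta>\frac k\lambda$, $\frac1\beta>20\delta$, $k>100$. *Claim.* (1) There are universal constants $c>0$ and $\kappa_0$ such that for all parameters as above, every adversary, every transaction $\mathcal T$, every round $r_0$ and every $\kappa\ge\kappa_0$: the probability that some honest party accepts $\mathcal T$ with security parameter $\kappa$ in round $r_0$ and that $|C^*|-|C'|\le 0$ for some honest party at the same or a later time is at most $e^{-c\kappa}$. (2) Let $\epsilon=(1-e^{-\beta\delta})/e^{-\beta\delta}$ and $p=\frac{2(1-2\epsilon)}{1+4\epsilon}$. Then $p>1$, and a random walk on $\mathbb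 Z$ started at $0$ with independent steps $-1,0,+1$ of probabilities $\frac12-\epsilon,\frac14,\frac14+\epsilon$ ever reaches $[\kappa,\infty)$ with probability exactly $p^{-\kappa}$, for every integer $\kappa\ge 0$. -/

import Mathlib

open MeasureTheory ProbabilityTheory

namespace Interlude

/-- System parameters: `n` honest and `m` adversarial parties, `k` sub-chains, the total rates
`lam` (parallel blocks) and `β` (series blocks) of the Poisson processes of the honest parties,
and the network delay bound `δ`. -/
structure Params where
  n : ℕ
  m : ℕ
  k : ℕ
  lam : ℝ
  β : ℝ
  δ : ℝ

/-- The ratio of adversarial to honest computational power. -/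
noncomputable def Params.α (P : Params) : ℝ := (P.m : ℝ) / (P.n : ℝ)

/-- The quantity `(1 - e^{-βδ}) / e^{-βδ}`. -/
noncomputable def Params.ε (P : Params) : ℝ :=
  (1 - Real.exp (-(P.β * P.δ))) / Real.exp (-(P.β * P.δ))

/-- The assumptions on the system parameters. -/
structure Params.Admissible (P : Params) : Prop where
  n_pos : 0 < P.n
  lam_pos : 0 < P.lam
  β_pos : 0 < P.β
  δ_nonneg : 0 ≤ P.δ
  minority : P.α < 1 / 2
  series_slow : (P.k : ℝ) / P.lam < 1 / P.β - P.δ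
  delay_small : 20 * P.δ < 1 / P.β
  many_subchains : 100 < P.k

/-- Honest parties are on the left, adversarial parties on the right. -/
abbrev Party (n m : ℕ) := Fin n ⊕ Fin m

/-! ### Blocks and chains -/

/-- What an Umbrella proof of work commits to besides the preceding series block: one transaction
set for each of the `k` sub-chains (the branches of the Merkle tree). `id` identifies the proof of
work (nonce and Merkle root). -/
structure Umbrella (k : ℕ) (Tx : Type*) where
  id : ℕ
  txs : Fin k → Finset Tx

/-- A chain that ends in a series block. Since hash pointers commit to everything they point to, a
series block is identified with the chain that ends in it: it extends `prev` by a `k`-set of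
parallel blocks on top of `prev` (`kset a` is the proof of work used on sub-chain `a`) and the
series block with proof of work `id` and transactions `txs`. -/
inductive Chain (k : ℕ) (Tx : Type*) where
  | genesis : Chain k Tx
  | extend (prev : Chain k Tx) (kset : Fin k → Umbrella k Tx) (id : ℕ) (txs : Finset Tx) :
      Chain k Tx

variable {k n m : ℕ} {Tx : Type*}

/-- `|C|`: the number of series blocks (the genesis block is not counted). -/
def Chain.length : Chain k Tx → ℕ
  | .genesis => 0
  | .extend prev _ _ _ => prev.length + 1

/-- The transaction `T` is in the chain: in a series block, or in the transaction set that a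
parallel block contributes on its sub-chain. -/
def Chain.Contains (T : Tx) : Chain k Tx → Prop
  | .genesis => False
  | .extend prev kset _ txs => prev.Contains T ∨ (∃ a, T ∈ (kset a).txs a) ∨ T ∈ txs

/-- The hash value of the last series block, if `hash i` is that of the proof of work `i`. -/
noncomputable def Chain.lastHash (hash : ℕ → ℝ) : Chain k Tx → ℝ
  | .genesis => 0
  | .extend _ _ id _ => hash id

/-- Blocks as they circulate in the network: series blocks, and copies of a parallel block,
`par top u a` being the copy that publishes the proof of work `u` (mined on `top`) on
sub-chain `a`. -/
inductive Block (k : ℕ) (Tx : Type*) where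
  | ser (C : Chain k Tx) : Block k Tx
  | par (top : Chain k Tx) (u : Umbrella k Tx) (a : Fin k) : Block k Tx

/-- The blocks available to a party. -/
abbrev View (k : ℕ) (Tx : Type*) := Finset (Block k Tx)

/-- `kset` is a `k`-set on top of `C` available in `K`: one parallel block on every sub-chain, all
on top of `C`, with pairwise distinct proofs of work. -/
def IsKSet (K : View k Tx) (C : Chain k Tx) (kset : Fin k → Umbrella k Tx) : Prop :=
  (∀ a, Block.par C (kset a) a ∈ K) ∧ Function.Injective fun a => (kset a).id

/-- The largest number of blocks in a (possibly incomplete) `k`-set on top of `C`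
available in `K`. -/
noncomputable def ksetSize (K : View k Tx) (C : Chain k Tx) : ℕ :=
  sSup {s | ∃ (A : Finset (Fin k)) (φ : Fin k → Umbrella k Tx),
    (∀ a ∈ A, Block.par C (φ a) a ∈ K) ∧ Set.InjOn (fun a => (φ a).id) A ∧ A.card = s}

/-- The chain selection order: more series blocks, then more blocks in the incomplete `k`-set,
then the lower hash value of the last series block. -/
def AtLeastAsGood (hash : ℕ → ℝ) (K : View k Tx) (C D : Chain k Tx) : Prop :=
  D.length < C.length ∨ (D.length = C.length ∧
    (ksetSize K D < ksetSize K C ∨ (ksetSize K D = ksetSize K C ∧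
      C.lastHash hash ≤ D.lastHash hash)))

/-- A party with view `K` selects the chain `C`, i.e. `C = C_max`. -/
def Adopts (hash : ℕ → ℝ) (K : View k Tx) (C : Chain k Tx) : Prop :=
  Block.ser C ∈ K ∧ ∀ D, Block.ser D ∈ K → AtLeastAsGood hash K C D

/-- The largest length of an available chain with the property `p`. -/
noncomputable def maxLength (K : View k Tx) (p : Chain k Tx → Prop) : ℕ :=
  sSup {l | ∃ C, Block.ser C ∈ K ∧ p C ∧ C.length = l}

/-- `|C_max|`. -/
noncomputable def lenMax (K : View k Tx) : ℕ := maxLength K fun _ => True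

/-- `|C*|`: the longest available chain that contains `T` (`0` if there is none). -/
noncomputable def lenWith (K : View k Tx) (T : Tx) : ℕ := maxLength K fun C => C.Contains T

/-- `|C'|`: the longest available chain that does not contain `T`. -/
noncomputable def lenWithout (K : View k Tx) (T : Tx) : ℕ := maxLength K fun C => ¬ C.Contains T

/-- The transaction acceptance rule `R_κ`. -/
def Accepts (κ : ℕ) (K : View k Tx) (T : Tx) : Prop :=
  (κ : ℤ) < (lenMax K : ℤ) - (lenWithout K T : ℤ)

/-! ### Mining -/

/-- The block a party is trying to mine. -/
inductive Job (k : ℕ) (Tx : Type*) where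
  | parallel (top : Chain k Tx) (txs : Fin k → Finset Tx) : Job k Tx
  | series (top : Chain k Tx) (kset : Fin k → Umbrella k Tx) (txs : Finset Tx) : Job k Tx

/-- The outcome of a successful proof of work: an Umbrella proof of work on `top`, or a
series block. -/
inductive Mined (k : ℕ) (Tx : Type*) where
  | umbrella (top : Chain k Tx) (u : Umbrella k Tx) : Mined k Tx
  | series (C : Chain k Tx) : Mined k Tx

/-- The outcome of the `j`-th ring of the mining clocks for a party working on a job. The ring is
for series blocks if `kind = true` and for parallel blocks if `kind = false`; it is without effect
if the party is mining a block of the other kind. -/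
def Job.result (j : ℕ) : Job k Tx → Bool → Option (Mined k Tx)
  | .parallel top txs, false => some (.umbrella top ⟨j, txs⟩)
  | .series top kset txs, true => some (.series (.extend top kset j txs))
  | _, _ => none

/-- What an honest party with view `K` may be mining: it selects its chain `C` and, if there is a
complete `k`-set on top of `C`, mines a series block on such a `k`-set, namely one that has the
available parallel block with the least hash value; otherwise it mines a parallel block on `C`. -/
def HonestJob (hash : ℕ → ℝ) (K : View k Tx) : Job k Tx → Prop
  | .parallel top _ => Adopts hash K top ∧ ksetSize K top < k
  | .series top kset _ => Adopts hash K top ∧ IsKSet K top kset ∧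
      ∃ a, ∀ u b, Block.par top u b ∈ K → hash (kset a).id ≤ hash u.id

/-- One run of the system, observed at the rings `0, 1, 2, …` of the mining clocks of all parties.
`gap j` is the time between ring `j - 1` and ring `j`; `party j`, `kind j` and `hash j` are the
party whose clock rings, the kind of the ring and the hash value of the proof of work. `view j i`
is what the honest party `i` has received, and `job j p` what party `p` is mining, just before
ring `j`. -/
structure Trace (n m k : ℕ) (Tx : Type*) where
  gap : ℕ → ℝ
  party : ℕ → Party n m
  kind : ℕ → Bool
  hash : ℕ → ℝ
  view : ℕ → Fin n → View k Tx
  job : ℕ → Party n m → Job k Tx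

namespace Trace

/-- The time of ring `j`. -/
noncomputable def time (X : Trace n m k Tx) (j : ℕ) : ℝ := ∑ l ∈ Finset.range (j + 1), X.gap l

/-- The proof of work obtained at ring `j`, if any. -/
def mined (X : Trace n m k Tx) (j : ℕ) : Option (Mined k Tx) :=
  (X.job j (X.party j)).result j (X.kind j)

/-- The chain exists (published or not) just before ring `j`. -/
def ChainExists (X : Trace n m k Tx) (j : ℕ) (C : Chain k Tx) : Prop :=
  C = .genesis ∨ ∃ l < j, X.mined l = some (.series C)

/-- The Umbrella proof of work on `top` exists (published or not) just before ring `j`. -/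
def UmbrellaExists (X : Trace n m k Tx) (j : ℕ) (top : Chain k Tx) (u : Umbrella k Tx) : Prop :=
  ∃ l < j, X.mined l = some (.umbrella top u)

/-- The block exists (published or not) just before ring `j`. -/
def BlockExists (X : Trace n m k Tx) (j : ℕ) : Block k Tx → Prop
  | .ser C => X.ChainExists j C
  | .par top u _ => X.UmbrellaExists j top u

/-- The job would lead to a valid block: its pointers refer to existing blocks, and the `k`-set of
a series block has distinct proofs of work. -/
def ValidJob (X : Trace n m k Tx) (j : ℕ) : Job k Tx → Prop
  | .parallel top _ => X.ChainExists j top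
  | .series top kset _ => X.ChainExists j top ∧ (∀ a, X.UmbrellaExists j top (kset a)) ∧
      Function.Injective fun a => (kset a).id

/-- The view `K` has the outcome `b` of a proof of work of an honest party. An honest miner
republishes its Umbrella proof of work on another sub-chain in case of a conflict, so it is
available on every sub-chain. -/
def Has (K : View k Tx) : Mined k Tx → Prop
  | .series C => Block.ser C ∈ K
  | .umbrella top u => ∀ a, Block.par top u a ∈ K

/-- The run obeys the protocol and the network model with delay bound `δ`. Nothing is asked of the
adversarial parties but that they mine on existing blocks (anything else is never part of a valid
chain). They may withhold their blocks, show them to selected honest parties at any time, and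
delay every message of an honest party by up to `δ`. -/
structure Follows (X : Trace n m k Tx) (δ : ℝ) : Prop where
  /-- Honest parties only know blocks that exist. -/
  view_exists : ∀ j i, ∀ b ∈ X.view j i, X.BlockExists j b
  view_genesis : ∀ j i, Block.ser Chain.genesis ∈ X.view j i
  /-- Blocks are received together with the chain they are part of. -/
  view_prev : ∀ j i prev kset id txs, Block.ser (Chain.extend prev kset id txs) ∈ X.view j i →
    Block.ser prev ∈ X.view j i ∧ ∀ a, Block.par prev (kset a) a ∈ X.view j i
  view_top : ∀ j i top u a, Block.par top u a ∈ X.view j i → Block.ser top ∈ X.view j i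
  /-- Nothing is forgotten. -/
  view_mono : ∀ j j' i, j ≤ j' → X.view j i ⊆ X.view j' i
  /-- An honest party knows the blocks it has mined. -/
  own : ∀ j j' i b, j < j' → X.party j = Sum.inl i → X.mined j = some b → Has (X.view j' i) b
  /-- Blocks mined by an honest party reach every honest party within time `δ`. -/
  broadcast_mined : ∀ j j' i i' b, j < j' → X.time j + δ ≤ X.time j' →
    X.party j = Sum.inl i → X.mined j = some b → Has (X.view j' i') b
  /-- The chain selected by an honest party reaches every honest party within time `δ`, together
  with the available parallel blocks on top of it. -/
  broadcast_chain : ∀ j j' i i' C, j < j' → X.time j + δ ≤ X.time j' →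
    Adopts X.hash (X.view j i) C → Block.ser C ∈ X.view j' i' ∧
      ∀ u a, Block.par C u a ∈ X.view j i → Block.par C u a ∈ X.view j' i'
  /-- Honest parties mine as prescribed. -/
  honest : ∀ j i, HonestJob X.hash (X.view j i) (X.job j (Sum.inl i))
  adversary : ∀ j a, X.ValidJob j (X.job j (Sum.inr a))

/-- The round in progress just before ring `j`: the number of series blocks mined by honest
parties so far. -/
noncomputable def round (X : Trace n m k Tx) (j : ℕ) : ℕ :=
  Set.ncard {l | l < j ∧ (∃ i, X.party l = Sum.inl i) ∧ ∃ C, X.mined l = some (.series C)}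

/-- Failure of safety: some honest party accepts `T` with security parameter `κ` in round `r₀`
and, then or later, `|C*| - |C'| ≤ 0` for some honest party. -/
def Reverted (X : Trace n m k Tx) (T : Tx) (κ r₀ : ℕ) : Prop :=
  ∃ j₀ i₀, X.round j₀ = r₀ ∧ Accepts κ (X.view j₀ i₀) T ∧
    ∃ j i, j₀ ≤ j ∧ (lenWith (X.view j i) T : ℤ) - (lenWithout (X.view j i) T : ℤ) ≤ 0

end Trace

/-! ### The probabilistic model -/

/-- Gap, party, kind and hash value of a ring. -/
abbrev Ring (n m : ℕ) := ℝ × Party n m × Bool × ℝ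

/-- Every party has one Poisson clock of rate `lam / n` for parallel blocks and one of rate `β / n`
for series blocks. The superposition of these `2 (n + m)` independent processes has independent
exponential gaps with the total rate as parameter, and every ring has an independent mark: a
uniformly distributed party and a kind that is `series` with probability `β / (lam + β)`. Hash
values are uniform (up to scaling). -/
noncomputable def ringLaw (P : Params) : Measure (Ring P.n P.m) :=
  (expMeasure (((P.n : ℝ) + P.m) * (P.lam / P.n + P.β / P.n))).prod
    ((uniformOn (Set.univ : Set (Party P.n P.m))).prod
      ((ENNReal.ofReal (P.lam / (P.lam + P.β)) • Measure.dirac false +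
        ENNReal.ofReal (P.β / (P.lam + P.β)) • Measure.dirac true).prod
          (volume.restrict (Set.Icc (0 : ℝ) 1))))

/-- A random run of the protocol. `ℱ j` is the information available after the rings before
ring `j` (it may contain private randomness of the adversary). Which block a party is mining and
what has been delivered at the time of ring `j` may depend on `ℱ j` and on that time, in an
arbitrary way, but neither on whose clock rings nor on the kind of the ring. -/
structure IsExecution {Ω : Type*} {mΩ : MeasurableSpace Ω} (P : Params) (μ : Measure Ω)
    (ℱ : Filtration ℕ mΩ) (X : Ω → Trace P.n P.m P.k Tx) : Prop where
  follows : ∀ ω, (X ω).Follows P.δ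
  ring_meas : ∀ j, Measurable[ℱ (j + 1)] fun ω =>
    (((X ω).gap j, (X ω).party j, (X ω).kind j, (X ω).hash j) : Ring P.n P.m)
  ring_law : ∀ j, μ.map (fun ω =>
    (((X ω).gap j, (X ω).party j, (X ω).kind j, (X ω).hash j) : Ring P.n P.m)) = ringLaw P
  ring_indep : ∀ j, Indep (MeasurableSpace.comap (fun ω =>
    (((X ω).gap j, (X ω).party j, (X ω).kind j, (X ω).hash j) : Ring P.n P.m)) inferInstance)
      (ℱ j) μ
  view_meas : ∀ j i K, MeasurableSet[ℱ j ⊔ MeasurableSpace.comap (fun ω => (X ω).gap j)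
    inferInstance] {ω | (X ω).view j i = K}
  job_meas : ∀ j p J, MeasurableSet[ℱ j ⊔ MeasurableSpace.comap (fun ω => (X ω).gap j)
    inferInstance] {ω | (X ω).job j p = J}

/-- A random walk on the integers with independent steps `-1`, `0`, `1` of probabilities
`1/2 - ε`, `1/4`, `1/4 + ε`. -/
structure IsBiasedWalk {Ω : Type*} {mΩ : MeasurableSpace Ω} (ε : ℝ) (μ : Measure Ω)
    (step : ℕ → Ω → ℤ) : Prop where
  meas : ∀ t, Measurable (step t)
  indep : iIndepFun step μ
  down : ∀ t, μ {ω | step t ω = -1} = ENNReal.ofReal (1 / 2 - ε)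
  stay : ∀ t, μ {ω | step t ω = 0} = ENNReal.ofReal (1 / 4)
  up : ∀ t, μ {ω | step t ω = 1} = ENNReal.ofReal (1 / 4 + ε)

/-- The base `p` of the ruin probability. -/
noncomputable def Params.p (P : Params) : ℝ := 2 * (1 - 2 * P.ε) / (1 + 4 * P.ε)

end Interlude

/-! Safety. Work is measured in units of a series block: a parallel block weighs `om` = β/λ. A
complete `k`-set then weighs k·om ≤ 1, and a ring has the same mean value whichever kind of block
its party is mining. Let `ht` be the greatest length of a chain selected by an honest party. When
the honest parties reach a new height, or a complete `k`-set becomes available at the current height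
(`Special`), their information may differ for a time δ. Afterwards they are synchronized (`Prod`),
and all they mine is useful. `advSum` adds up the adversarial work and the honest series blocks
mined out of synchronization; it subtracts 57/100 of the useful honest work and a charge `d` for
each special index. The weight 57/100 exceeds 1/2 by enough to give `advSum` negative drift when α <
1/2, second-order terms included (`mark_gain`). It is still small enough that a height at which the
adversary supplies one series block and one `k`-set is not to its disadvantage: the honest parties
subtract about 2·57/100 + 2d there.

Splitting `advSum` by heights therefore bounds it from below between consecutive `ZeroStock`
switches, the moments at which the honest parties reach a new height and no longer chain exists
(`le_advSum`). At such a switch an attempt may start. With a probability bounded below, the honest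
parties gain 60 heights during a `Clean` period, one in which all series blocks come from
synchronized honest parties. After a success, every competitive chain contains the first block of
that period until the adversary has gained an advantage of 56 (`settled`): a fork would have to
replace all 60 heights. While this holds the bookkeeping `mode` is pending.

If a transaction is reverted, then the mode, started at a suitable `Base` (an honest block longer
than all others), is at some time not pending although many series blocks have been mined since that
base (`exists_base_of_reverted`). This is improbable because of the potential `pot`. Its main term
is exp(η·advSum) outside the pending mode and about exp((advSum − 56)/20) inside it. During an
attempt a correction exp(−150 + progress) is subtracted, which stands for the chance of success.
Further factors account for the remaining lag and reward each series block mined by exp(`decay`).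
Resetting `advSum` at a zero-stock switch may cost a few η; since η = e^(−160), the correction
e^(−150) pays for it. Hence `pot` is a supermartingale (`lintegral_pot_succ_le`). It is at most 2
just after a base and at least a quarter of the accumulated reward whenever the mode is not pending,
so a maximal inequality gives the bound 8·exp(−decay·x) for x series blocks. Bases of the same round
are disjoint events, and a base of round r leaves at least max κ (r₀ − r) series blocks, so the
union over all bases is a geometric sum independent of r₀.

Random walk. The number p solves E[p^step] = 1, so p^S is a martingale, where S is the walk. The
walk moves up by at most one and so hits κ exactly. Optional stopping gives p^κ·P(hit by time N) +
remainder = 1. The remainder vanishes because p^S ≤ (√p)^κ·(√p)^S below κ and E[(√p)^step] < 1. -/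

namespace Interlude

section Trace

open scoped Classical

variable {n m k : ℕ} {Tx : Type*}

/-! ### Combinatorics of a run -/

/-- The last series block of the chain a job builds on. -/
def Job.top : Job k Tx → Chain k Tx
  | .parallel C _ => C
  | .series C _ _ => C

/-- Whether the job is for a series block. -/
def Job.isSer : Job k Tx → Bool
  | .parallel _ _ => false
  | .series _ _ _ => true

/-- The chain obtained if the job succeeds at ring `j` (for a parallel block: its top). -/
def Job.out (j : ℕ) : Job k Tx → Chain k Tx
  | .parallel C _ => C
  | .series C kset txs => .extend C kset j txs

/-- The prefix of a chain that has `l` series blocks. -/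
def Chain.trunc (l : ℕ) : Chain k Tx → Chain k Tx
  | .genesis => .genesis
  | .extend prev kset id txs =>
      if prev.length + 1 ≤ l then .extend prev kset id txs else prev.trunc l

theorem Chain.trunc_of_length_le {l : ℕ} {C : Chain k Tx} (h : C.length ≤ l) : C.trunc l = C := by
  cases C with
  | genesis => rfl
  | extend prev kset id txs => simp only [Chain.length] at h; simp [Chain.trunc, h]

theorem Chain.length_trunc {l : ℕ} (C : Chain k Tx) (h : l ≤ C.length) :
    (C.trunc l).length = l := by
  induction C with
  | genesis => simp [Chain.trunc, Chain.length] at *; omega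
  | extend prev kset id txs ih =>
    simp only [Chain.length] at h
    simp only [Chain.trunc]
    split_ifs with h1
    · simp only [Chain.length]; omega
    · exact ih (by omega)

theorem Chain.trunc_trunc {l l' : ℕ} (h : l ≤ l') (C : Chain k Tx) :
    (C.trunc l').trunc l = C.trunc l := by
  induction C with
  | genesis => rfl
  | extend prev kset id txs ih =>
    by_cases h1 : prev.length + 1 ≤ l'
    · simp [Chain.trunc, h1]
    · have h2 : ¬ prev.length + 1 ≤ l := by omega
      simp [Chain.trunc, h1, h2, ih]

theorem Chain.Contains.of_trunc {T : Tx} {l : ℕ} {C : Chain k Tx}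
    (h : (C.trunc l).Contains T) : C.Contains T := by
  induction C with
  | genesis => exact h
  | extend prev kset id txs ih =>
    simp only [Chain.trunc] at h
    split_ifs at h with h1
    · exact h
    · exact Or.inl (ih h)

theorem Chain.length_pos_iff {C : Chain k Tx} : 0 < C.length ↔ C ≠ .genesis := by
  cases C <;> simp [Chain.length]

namespace Trace

variable (X : Trace n m k Tx)

/-- The job of the party whose clock rings at ring `j`. -/
def jobAt (j : ℕ) : Job k Tx := X.job j (X.party j)

/-- The last series block below the block worked on by the party whose clock rings. -/
def tip (j : ℕ) : Chain k Tx := (X.jobAt j).top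

/-- A series block is mined at ring `j`. -/
def Ser (j : ℕ) : Prop := (X.jobAt j).isSer = true ∧ X.kind j = true

/-- A parallel block is mined at ring `j`. -/
def Par (j : ℕ) : Prop := (X.jobAt j).isSer = false ∧ X.kind j = false

/-- The clock of an honest party rings. -/
def Hon (j : ℕ) : Prop := (X.party j).isLeft = true

/-- The chain mined at ring `j`. -/
def res (j : ℕ) : Chain k Tx := (X.jobAt j).out j

/-- The largest length of a chain selected by an honest party just before ring `j`. -/
def ht (j : ℕ) : ℕ := Finset.univ.sup fun i : Fin n => (X.job j (Sum.inl i)).top.length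

variable {X}

theorem mined_eq_series_iff {j : ℕ} {C : Chain k Tx} :
    X.mined j = some (.series C) ↔ X.Ser j ∧ X.res j = C := by
  unfold mined Ser res jobAt
  cases X.job j (X.party j) <;> cases X.kind j <;> simp [Job.result, Job.isSer, Job.out]

theorem mined_eq_umbrella_iff {j : ℕ} {C : Chain k Tx} {u : Umbrella k Tx}
    (h : X.mined j = some (.umbrella C u)) : X.Par j ∧ X.tip j = C ∧ u.id = j := by
  unfold mined at h
  unfold Par tip jobAt
  cases hj : X.job j (X.party j) <;> cases hk : X.kind j <;>
    simp_all [Job.result, Job.isSer, Job.top]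
  rw [← h.2]

theorem Par.mined {j : ℕ} (h : X.Par j) :
    ∃ txs, X.mined j = some (.umbrella (X.tip j) ⟨j, txs⟩) := by
  unfold Par tip jobAt at *
  unfold Trace.mined
  cases hj : X.job j (X.party j) <;> cases hk : X.kind j <;>
    simp_all [Job.result, Job.isSer, Job.top]

theorem Ser.length_res {j : ℕ} (h : X.Ser j) : (X.res j).length = (X.tip j).length + 1 := by
  unfold Ser res tip at *
  cases hj : X.jobAt j <;> simp_all [Job.isSer, Job.out, Job.top, Chain.length]

theorem chainExists_iff {j : ℕ} {C : Chain k Tx} :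
    X.ChainExists j C ↔ C = .genesis ∨ ∃ l < j, X.Ser l ∧ X.res l = C := by
  unfold ChainExists; simp only [mined_eq_series_iff]

theorem ChainExists.mono {i j : ℕ} (hij : i ≤ j) {C : Chain k Tx} (h : X.ChainExists i C) :
    X.ChainExists j C := by
  rcases h with h | ⟨l, hl, h⟩
  · exact Or.inl h
  · exact Or.inr ⟨l, by omega, h⟩

theorem ChainExists.exists_ser {j : ℕ} {C : Chain k Tx} (h : X.ChainExists j C)
    (hC : 0 < C.length) : ∃ l < j, X.Ser l ∧ X.res l = C := by
  rcases chainExists_iff.1 h with h | h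
  · exact absurd h (Chain.length_pos_iff.1 hC)
  · exact h

variable {δ : ℝ}

theorem Follows.adopts (hX : X.Follows δ) (j : ℕ) (i : Fin n) :
    Adopts X.hash (X.view j i) (X.job j (Sum.inl i)).top := by
  have := hX.honest j i
  cases hj : X.job j (Sum.inl i) <;> rw [hj] at this <;> exact this.1

theorem Follows.length_le (hX : X.Follows δ) {j : ℕ} {i : Fin n} {D : Chain k Tx}
    (hD : Block.ser D ∈ X.view j i) : D.length ≤ (X.job j (Sum.inl i)).top.length := by
  rcases (hX.adopts j i).2 D hD with h | h
  · exact h.le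
  · exact h.1.le

theorem Follows.top_exists (hX : X.Follows δ) (j : ℕ) (p : Party n m) :
    X.ChainExists j (X.job j p).top := by
  rcases p with i | a
  · exact hX.view_exists j i _ (hX.adopts j i).1
  · have := hX.adversary j a
    cases hj : X.job j (Sum.inr a) <;> rw [hj] at this
    · exact this
    · exact this.1

theorem Follows.tip_exists (hX : X.Follows δ) (j : ℕ) : X.ChainExists j (X.tip j) :=
  hX.top_exists j _

theorem Follows.kset_exists (hX : X.Follows δ) {j : ℕ} {p : Party n m} {C : Chain k Tx}
    {kset : Fin k → Umbrella k Tx} {txs : Finset Tx} (h : X.job j p = .series C kset txs) :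
    (∀ a, X.UmbrellaExists j C (kset a)) ∧ Function.Injective fun a => (kset a).id := by
  rcases p with i | a
  · have := hX.honest j i
    rw [h] at this
    exact ⟨fun a => hX.view_exists j i _ (this.2.1.1 a), this.2.1.2⟩
  · have := hX.adversary j a
    rw [h] at this
    exact this.2

/-- A series block has `k` parallel blocks below it, mined earlier. -/
theorem Follows.card_par (hX : X.Follows δ) {j : ℕ} (hj : X.Ser j) :
    k ≤ ((Finset.range j).filter fun i => X.Par i ∧ X.tip i = X.tip j).card := by
  have h1 := hj.1
  cases hjob : X.jobAt j with
  | parallel C txs => rw [hjob] at h1; simp [Job.isSer] at h1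
  | series C kset txs =>
    obtain ⟨h2, h3⟩ := hX.kset_exists (p := X.party j) hjob
    have h4 : (Finset.univ.image fun a => (kset a).id) ⊆
        (Finset.range j).filter fun i => X.Par i ∧ X.tip i = X.tip j := by
      intro i hi
      simp only [Finset.mem_image, Finset.mem_univ, true_and] at hi
      obtain ⟨a, rfl⟩ := hi
      obtain ⟨l, hl, hm⟩ := h2 a
      obtain ⟨h5, h6, h7⟩ := mined_eq_umbrella_iff hm
      have h8 : X.tip j = C := by unfold tip; rw [hjob]; rfl
      simp only [Finset.mem_filter, Finset.mem_range]
      rw [h7, h8]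
      exact ⟨hl, h5, h6⟩
    have h5 := Finset.card_le_card h4
    rwa [Finset.card_image_of_injective _ h3, Finset.card_univ, Fintype.card_fin] at h5

theorem Follows.prev_exists (hX : X.Follows δ) {j : ℕ} {prev : Chain k Tx}
    {kset : Fin k → Umbrella k Tx} {id : ℕ} {txs : Finset Tx}
    (h : X.ChainExists j (.extend prev kset id txs)) : X.ChainExists j prev := by
  obtain ⟨l, hl, hs, hr⟩ := h.exists_ser (by simp [Chain.length])
  have h1 := hs.1
  have h2 : X.tip l = prev := by
    unfold tip
    unfold res at hr
    cases hjob : X.jobAt l <;> rw [hjob] at hr h1 <;> simp_all [Job.isSer, Job.out, Job.top]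
  exact h2 ▸ (hX.tip_exists l).mono hl.le

theorem Ser.trunc_res {j l : ℕ} (hj : X.Ser j) (hl : l ≤ (X.tip j).length) :
    (X.res j).trunc l = (X.tip j).trunc l := by
  have h1 := hj.1
  unfold res
  unfold tip at *
  cases hjob : X.jobAt j with
  | parallel C txs => rw [hjob] at h1; simp [Job.isSer] at h1
  | series C kset txs =>
    rw [hjob] at hl
    simp only [Job.top] at hl
    have : ¬ C.length + 1 ≤ l := by omega
    simp [Job.out, Job.top, Chain.trunc, this]

theorem Follows.trunc_exists (hX : X.Follows δ) {j : ℕ} {C : Chain k Tx} (l : ℕ)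
    (h : X.ChainExists j C) : X.ChainExists j (C.trunc l) := by
  induction C with
  | genesis => exact h
  | extend prev kset id txs ih =>
    simp only [Chain.trunc]
    split_ifs
    · exact h
    · exact ih (hX.prev_exists h)

/-- Below a chain of length at least `l ≥ 1` there is the ring at which its prefix of length `l`
was mined. -/
theorem Follows.exists_ser_trunc (hX : X.Follows δ) {j l : ℕ} {C : Chain k Tx}
    (h : X.ChainExists j C) (hl : 0 < l) (hlC : l ≤ C.length) :
    ∃ i < j, X.Ser i ∧ X.res i = C.trunc l ∧ (X.tip i).length + 1 = l := by
  have h1 := C.length_trunc hlC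
  obtain ⟨i, hi, hs, hr⟩ := (hX.trunc_exists l h).exists_ser (by omega)
  refine ⟨i, hi, hs, hr, ?_⟩
  rw [← hs.length_res, hr, h1]

theorem le_ht (j : ℕ) (i : Fin n) : (X.job j (Sum.inl i)).top.length ≤ X.ht j :=
  Finset.le_sup (f := fun i : Fin n => (X.job j (Sum.inl i)).top.length) (Finset.mem_univ i)

theorem exists_eq_ht [NeZero n] (j : ℕ) : ∃ i : Fin n, (X.job j (Sum.inl i)).top.length = X.ht j := by
  obtain ⟨i, -, hi⟩ := Finset.exists_mem_eq_sup (Finset.univ : Finset (Fin n))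
    ⟨⟨0, Nat.pos_of_ne_zero (NeZero.ne n)⟩, Finset.mem_univ _⟩
    (fun i : Fin n => (X.job j (Sum.inl i)).top.length)
  exact ⟨i, hi.symm⟩

theorem Hon.length_tip_le {j : ℕ} (h : X.Hon j) : (X.tip j).length ≤ X.ht j := by
  unfold Hon at h
  unfold tip jobAt
  cases hp : X.party j with
  | inl i => exact le_ht j i
  | inr a => rw [hp] at h; simp at h

theorem Follows.ht_mono (hX : X.Follows δ) : Monotone X.ht := by
  intro j j' hjj
  refine Finset.sup_le fun i _ => ?_
  exact (hX.length_le (hX.view_mono j j' i hjj (hX.adopts j i).1)).trans (le_ht j' i)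

/-- The chain selected by any honest party reaches all others within δ, so each of them then selects
a chain at least as long. -/
theorem Follows.ht_le_of_late (hX : X.Follows δ) {j j' : ℕ} (h : j < j')
    (hl : X.time j + δ ≤ X.time j') (i' : Fin n) :
    X.ht j ≤ (X.job j' (Sum.inl i')).top.length :=
  Finset.sup_le fun i _ =>
    hX.length_le (hX.broadcast_chain j j' i i' _ h hl (hX.adopts j i)).1

theorem Follows.ht_succ_of_hon (hX : X.Follows δ) {j : ℕ} (h : X.Hon j) (hs : X.Ser j) :
    (X.tip j).length + 1 ≤ X.ht (j + 1) := by
  unfold Hon at h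
  cases hp : X.party j with
  | inl i =>
    have := hX.own j (j + 1) i _ (by omega) hp (mined_eq_series_iff.2 ⟨hs, rfl⟩)
    rw [← hs.length_res]
    exact (hX.length_le this).trans (le_ht _ i)
  | inr a => rw [hp] at h; simp at h

theorem Follows.exists_ser_ht [NeZero n] (hX : X.Follows δ) {j l : ℕ} (hl : 0 < l)
    (h : l ≤ X.ht j) : ∃ i < j, X.Ser i ∧ (X.tip i).length + 1 = l := by
  obtain ⟨i, hi⟩ := exists_eq_ht (X := X) j
  obtain ⟨a, b, c, -, e⟩ := hX.exists_ser_trunc (hX.top_exists j (Sum.inl i)) hl (hi ▸ h)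
  exact ⟨a, b, c, e⟩

theorem Follows.ht_zero [NeZero n] (hX : X.Follows δ) : X.ht 0 = 0 := by
  by_contra h
  obtain ⟨i, hi, -⟩ := hX.exists_ser_ht (j := 0) (l := X.ht 0) (by omega) le_rfl
  omega

end Trace
end Trace
end Interlude

/-! ### Synchronization of the honest parties. -/

namespace Interlude

section Trace

open scoped Classical

variable {n m k : ℕ} {Tx : Type*}

theorem IsKSet.le_ksetSize {K : View k Tx} {C : Chain k Tx} {kset : Fin k → Umbrella k Tx}
    (h : IsKSet K C kset) : k ≤ ksetSize K C := by
  refine le_csSup ⟨k, ?_⟩ ⟨Finset.univ, kset, fun a _ => h.1 a, h.2.injOn, by simp⟩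
  rintro s ⟨A, φ, -, -, rfl⟩
  simpa using Finset.card_le_univ A

namespace Trace

variable (X : Trace n m k Tx) (δ : ℝ)

/-- A complete `k`-set on top of a longest chain of the honest parties is known to one of them or
consists of their own blocks. -/
def Complete (j : ℕ) : Prop :=
  (∃ i : Fin n, (X.job j (Sum.inl i)).isSer = true ∧ (X.job j (Sum.inl i)).top.length = X.ht j) ∨
    ∃ C : Chain k Tx, C.length = X.ht j ∧
      k ≤ ((Finset.range j).filter fun i => (X.Hon i ∧ X.Par i) ∧ X.tip i = C).card

/-- A complete `k`-set has become available at the current height. -/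
def Ready (j : ℕ) : Prop := ∃ j' ≤ j, X.ht j' = X.ht j ∧ X.Complete j'

/-- The honest parties reach a new height. -/
def Switch (j : ℕ) : Prop := j = 0 ∨ X.ht (j - 1) < X.ht j

/-- The beginning of a period during which the honest parties may have different information. -/
def Special (j : ℕ) : Prop := X.Switch j ∨ (X.Ready j ∧ ¬ X.Ready (j - 1))

/-- The last special index up to `j`. -/
noncomputable def lastSp (j : ℕ) : ℕ := Nat.findGreatest X.Special j

/-- At ring `j` the honest parties have had time to learn about the last special index. -/
def Prod (j : ℕ) : Prop := X.lastSp j < j ∧ X.time (X.lastSp j) + δ ≤ X.time j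

variable {X δ}

theorem special_zero : X.Special 0 := Or.inl (Or.inl rfl)

theorem lastSp_le (j : ℕ) : X.lastSp j ≤ j := Nat.findGreatest_le j

theorem Special.lastSp_eq {j : ℕ} (h : X.Special j) : X.lastSp j = j :=
  Nat.findGreatest_eq h

theorem lastSp_succ {j : ℕ} (h : ¬ X.Special (j + 1)) : X.lastSp (j + 1) = X.lastSp j :=
  Nat.findGreatest_of_not h

theorem Prod.not_special {j : ℕ} (h : X.Prod δ j) : ¬ X.Special j := fun hs => by
  have := h.1
  rw [hs.lastSp_eq] at this
  exact lt_irrefl _ this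

theorem Follows.ht_eq_of_not_special (hX : X.Follows δ) {j : ℕ} (h : ¬ X.Special (j + 1)) :
    X.ht (j + 1) = X.ht j := by
  have h1 : ¬ X.ht j < X.ht (j + 1) := fun h2 => h (Or.inl (Or.inr h2))
  exact le_antisymm (not_lt.1 h1) (hX.ht_mono (Nat.le_succ j))

theorem Follows.ht_lastSp (hX : X.Follows δ) (j : ℕ) : X.ht (X.lastSp j) = X.ht j := by
  induction j with
  | zero => rw [special_zero.lastSp_eq]
  | succ j ih =>
    by_cases h : X.Special (j + 1)
    · rw [h.lastSp_eq]
    · rw [lastSp_succ h, ih, hX.ht_eq_of_not_special h]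

/-- Becoming ready is itself special, so readiness cannot be newer than the last special index. Once
the parties are synchronized, the `k`-set responsible for it is therefore at least δ old. -/
theorem ready_lastSp {j : ℕ} (hr : X.Ready j) : X.Ready (X.lastSp j) := by
  induction j with
  | zero => rwa [special_zero.lastSp_eq]
  | succ j ih =>
    by_cases h : X.Special (j + 1)
    · rwa [h.lastSp_eq]
    · rw [lastSp_succ h]
      refine ih ?_
      by_contra h1
      exact h (Or.inr ⟨hr, h1⟩)

/-- A party mining a parallel block has fewer than `k` blocks on top of its selected chain. A chain
of maximal length with a complete `k`-set would be preferred by the selection order. -/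
theorem Follows.isSer_of_isKSet (hX : X.Follows δ) {j : ℕ} {i : Fin n} {C : Chain k Tx}
    {kset : Fin k → Umbrella k Tx} (hk : IsKSet (X.view j i) C kset)
    (hC : Block.ser C ∈ X.view j i) (hl : C.length = X.ht j) :
    (X.job j (Sum.inl i)).isSer = true := by
  cases hjob : X.job j (Sum.inl i) with
  | series D kset' txs => rfl
  | parallel D txs =>
    have h1 := hX.honest j i
    have h3 := le_ht (X := X) j i
    rw [hjob] at h1 h3
    simp only [Job.top] at h3
    have h2 := h1.1.2 C hC
    have h4 := hk.le_ksetSize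
    have h5 := h1.2
    rcases h2 with h2 | ⟨-, h2 | h2⟩ <;> omega

theorem Follows.length_top_eq (hX : X.Follows δ) {j : ℕ} (hp : X.Prod δ j) (i : Fin n) :
    (X.job j (Sum.inl i)).top.length = X.ht j := by
  refine le_antisymm (le_ht j i) ?_
  rw [← hX.ht_lastSp j]
  exact hX.ht_le_of_late hp.1 hp.2 i

/-- Both forms of `Complete` propagate within δ. A `k`-set known to a party that selects its top is
forwarded with the chain; `k` honest parallel blocks are broadcast individually, each available on
every sub-chain. -/
theorem Prod.isSer_eq_true (hX : X.Follows δ) (hk : 0 < k) (ht : Monotone X.time) {j : ℕ}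
    (hp : X.Prod δ j) (hr : X.Ready j) (i : Fin n) : (X.job j (Sum.inl i)).isSer = true := by
  obtain ⟨j', hj', hh, hc⟩ := ready_lastSp hr
  have hlt : j' < j := lt_of_le_of_lt hj' hp.1
  have hh' : X.ht j' = X.ht j := by rw [hh, hX.ht_lastSp]
  have hlate : X.time j' + δ ≤ X.time j := by have := ht hj'; have := hp.2; linarith
  rcases hc with ⟨i₀, hs, hlen⟩ | ⟨C, hC, hcard⟩
  · have h1 := hX.honest j' i₀
    cases hjob : X.job j' (Sum.inl i₀) with
    | parallel D txs => rw [hjob] at hs; simp [Job.isSer] at hs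
    | series D kset txs =>
      rw [hjob] at h1 hlen
      simp only [Job.top] at hlen
      obtain ⟨h2, h3⟩ := hX.broadcast_chain j' j i₀ i D hlt hlate h1.1
      exact hX.isSer_of_isKSet (kset := kset) ⟨fun a => h3 _ _ (h1.2.1.1 a), h1.2.1.2⟩ h2
        (hlen.trans hh')
  · obtain ⟨A, hA, hcA⟩ := Finset.exists_subset_card_eq hcard
    let f := A.orderEmbOfFin hcA
    have hf : ∀ a, f a < j' ∧ (X.Hon (f a) ∧ X.Par (f a)) ∧ X.tip (f a) = C := fun a => by
      have := hA (A.orderEmbOfFin_mem hcA a)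
      simpa only [Finset.mem_filter, Finset.mem_range] using this
    choose txs htxs using fun a => (hf a).2.1.2.mined
    have hv : ∀ a b, Block.par C ⟨f a, txs a⟩ b ∈ X.view j i := by
      intro a b
      have hhon := (hf a).2.1.1
      unfold Hon at hhon
      cases hpa : X.party (f a) with
      | inr _ => rw [hpa] at hhon; simp at hhon
      | inl i₁ =>
        have h1 := ht (hf a).1.le
        have h2 := hX.broadcast_mined (f a) j i₁ i _ ((hf a).1.trans hlt) (by linarith) hpa (htxs a)
        rw [(hf a).2.2] at h2
        exact h2 b
    refine hX.isSer_of_isKSet (C := C) (kset := fun a => ⟨f a, txs a⟩)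
      ⟨fun a => hv a a, ?_⟩ (hX.view_top _ _ _ _ _ (hv ⟨0, hk⟩ ⟨0, hk⟩)) (hC.trans hh')
    exact f.injective

theorem Prod.length_tip (hX : X.Follows δ) {j : ℕ} (hp : X.Prod δ j) (hh : X.Hon j) :
    (X.tip j).length = X.ht j := by
  unfold Hon at hh
  unfold tip jobAt
  cases hpj : X.party j with
  | inr a => rw [hpj] at hh; simp at hh
  | inl i => exact hX.length_top_eq hp i

theorem Prod.not_ready_of_par (hX : X.Follows δ) (hk : 0 < k) (ht : Monotone X.time) {j : ℕ}
    (hp : X.Prod δ j) (hh : X.Hon j) (hpar : X.Par j) : ¬ X.Ready j := by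
  intro hr
  unfold Hon at hh
  cases hpj : X.party j with
  | inr a => rw [hpj] at hh; simp at hh
  | inl i =>
    have h1 := hp.isSer_eq_true hX hk ht hr i
    have h2 := hpar.1
    unfold jobAt at h2
    rw [hpj, h1] at h2
    cases h2

theorem Prod.ht_lt_succ (hX : X.Follows δ) {j : ℕ} (hp : X.Prod δ j) (hh : X.Hon j)
    (hs : X.Ser j) : X.ht j < X.ht (j + 1) := by
  have h1 := hX.ht_succ_of_hon hh hs
  rw [hp.length_tip hX hh] at h1
  exact h1

/-- A switch after which no chain is longer than those of the honest parties. -/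
def ZeroStock (X : Trace n m k Tx) (t : ℕ) : Prop :=
  X.Switch t ∧ ∀ i < t, X.Ser i → (X.tip i).length + 1 ≤ X.ht t

/-- A switch is the earliest index of its height. -/
theorem Switch.le_of_ht_le (hX : X.Follows δ) {z i : ℕ} (hz : X.Switch z)
    (h : X.ht z ≤ X.ht i) : z ≤ i := by
  rcases hz with rfl | hz
  · omega
  · by_contra hlt
    have := hX.ht_mono (show i ≤ z - 1 by omega)
    omega

end Trace
end Trace
end Interlude

/-! ### The advantage of the adversary, accounted for by heights. -/

namespace Interlude

section Trace

open scoped Classical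

variable {n m k : ℕ} {Tx : Type*}

namespace Trace

/-- The number of rings in `[z, t)` with the property `p`. -/
noncomputable def cnt (z t : ℕ) (p : ℕ → Prop) : ℕ := ((Finset.Ico z t).filter p).card

theorem cnt_eq_card (z t : ℕ) (p : ℕ → Prop) [DecidablePred p] :
    cnt z t p = ((Finset.Ico z t).filter p).card := by
  unfold cnt
  congr

theorem cnt_eq_zero {z t : ℕ} {p : ℕ → Prop} (h : ∀ i, z ≤ i → i < t → ¬ p i) : cnt z t p = 0 := by
  unfold cnt
  rw [Finset.card_eq_zero, Finset.filter_eq_empty_iff]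
  intro i hi
  rw [Finset.mem_Ico] at hi
  exact h i hi.1 hi.2

theorem cnt_pos {z t i : ℕ} {p : ℕ → Prop} (h1 : z ≤ i) (h2 : i < t) (h3 : p i) :
    1 ≤ cnt z t p :=
  Finset.card_pos.2 ⟨i, by simp [h1, h2, h3]⟩

theorem cnt_le_one {z t : ℕ} {p : ℕ → Prop} (h : ∀ i j, i < j → p i → p j → False) :
    cnt z t p ≤ 1 := by
  refine Finset.card_le_one.2 fun a ha b hb => ?_
  rw [Finset.mem_filter] at ha hb
  rcases lt_trichotomy a b with h1 | h1 | h1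
  · exact (h a b h1 ha.2 hb.2).elim
  · exact h1
  · exact (h b a h1 hb.2 ha.2).elim

theorem cnt_mono {z t : ℕ} {p q : ℕ → Prop} (h : ∀ i, z ≤ i → i < t → p i → q i) :
    cnt z t p ≤ cnt z t q := by
  refine Finset.card_le_card fun i hi => ?_
  rw [Finset.mem_filter, Finset.mem_Ico] at *
  exact ⟨hi.1, h i hi.1.1 hi.1.2 hi.2⟩

theorem cnt_split {z s t : ℕ} (h1 : z ≤ s) (h2 : s ≤ t) (p : ℕ → Prop) :
    cnt z t p = cnt z s p + cnt s t p := by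
  unfold cnt
  rw [← Finset.Ico_union_Ico_eq_Ico h1 h2, Finset.filter_union, Finset.card_union_of_disjoint]
  exact Finset.disjoint_filter_filter (Finset.Ico_disjoint_Ico_consecutive _ _ _)

theorem cnt_eq_sum_levels {z t L : ℕ} {p : ℕ → Prop} (f : ℕ → ℕ)
    (h : ∀ i, z ≤ i → i < t → f i < L) :
    cnt z t p = ∑ l ∈ Finset.range L, cnt z t fun i => p i ∧ f i = l := by
  simp only [cnt_eq_card]
  rw [Finset.card_eq_sum_card_fiberwise (t := Finset.range L) (f := f)]
  · simp only [Finset.filter_filter]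
  · intro i hi
    rw [Finset.mem_coe, Finset.mem_filter, Finset.mem_Ico] at hi
    simpa using h i hi.1.1 hi.1.2

variable (X : Trace n m k Tx) (δ : ℝ)

def AdvSer (i : ℕ) : Prop := ¬ X.Hon i ∧ X.Ser i
def AdvPar (i : ℕ) : Prop := ¬ X.Hon i ∧ X.Par i
def HonSer (i : ℕ) : Prop := X.Hon i ∧ X.Ser i
/-- An honest parallel block that counts as progress. -/
def ProdPar (i : ℕ) : Prop := (X.Hon i ∧ X.Par i) ∧ X.Prod δ i
/-- An honest series block that counts as progress. -/
def ProdSer (i : ℕ) : Prop := X.HonSer i ∧ X.Prod δ i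
/-- An honest series block mined while the honest parties are not synchronized. -/
def ExtraSer (i : ℕ) : Prop := X.HonSer i ∧ ¬ X.Prod δ i

/-- The number of adversarial series blocks at the height of the honest parties. -/
noncomputable def sib (t : ℕ) : ℕ := cnt 0 t fun i => X.AdvSer i ∧ (X.tip i).length + 1 = X.ht t

/-- The advantage the adversary gains at index `i`, in units of mean series block times. -/
noncomputable def adv (om d : ℝ) (i : ℕ) : ℝ :=
  (if X.Special i then -d else 0) + (if X.AdvSer i then 1 else 0) + (if X.AdvPar i then om else 0)
    - (if X.ProdPar δ i then 57 / 100 * om else 0) - (if X.ProdSer δ i then 57 / 100 else 0)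
    + (if X.ExtraSer δ i then 1 else 0)

/-- The advantage the adversary gains at the indices in `[z, t)`. -/
noncomputable def advSum (om d : ℝ) (z t : ℕ) : ℝ := ∑ i ∈ Finset.Ico z t, X.adv δ om d i

/-- The part of `advSum` that concerns height `l`. -/
noncomputable def advLevel (om d : ℝ) (z t l : ℕ) : ℝ :=
  -(d * cnt z t fun i => X.Special i ∧ X.ht i = l)
    + (cnt z t fun i => X.AdvSer i ∧ (X.tip i).length + 1 = l)
    + om * (cnt z t fun i => X.AdvPar i ∧ (X.tip i).length = l)
    - 57 / 100 * om * (cnt z t fun i => X.ProdPar δ i ∧ X.ht i = l)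
    - 57 / 100 * (cnt z t fun i => X.ProdSer δ i ∧ X.ht i = l)
    + (cnt z t fun i => X.ExtraSer δ i ∧ (X.tip i).length + 1 = l)

variable {X δ}

theorem exists_level_bound (t : ℕ) : ∃ L, ∀ i < t, X.ht i < L ∧ (X.tip i).length + 1 < L := by
  refine ⟨(Finset.range t).sup (fun i => max (X.ht i) ((X.tip i).length + 1)) + 1, fun i hi => ?_⟩
  have := Finset.le_sup (f := fun i => max (X.ht i) ((X.tip i).length + 1)) (Finset.mem_range.2 hi)
  omega

theorem sum_ite_eq_mul_cnt (z t : ℕ) (p : ℕ → Prop) (c : ℝ) :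
    ∑ i ∈ Finset.Ico z t, (if p i then c else 0) = c * cnt z t p := by
  rw [cnt_eq_card, ← Finset.sum_filter, Finset.sum_const, nsmul_eq_mul, mul_comm]

/-- Honest work is assigned to the current height, all other blocks to the height they occupy. The
identity holds for every large range so that later arguments may enlarge the range to contain the
heights they single out. -/
theorem exists_advSum_eq (om d : ℝ) (z t : ℕ) :
    ∃ L₀, ∀ L ≥ L₀, X.advSum δ om d z t = ∑ l ∈ Finset.range L, X.advLevel δ om d z t l := by
  obtain ⟨L₀, hL₀⟩ := exists_level_bound (X := X) t
  refine ⟨L₀, fun L hL => ?_⟩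
  unfold advSum adv advLevel
  simp only [Finset.sum_add_distrib, Finset.sum_sub_distrib, sum_ite_eq_mul_cnt]
  rw [cnt_eq_sum_levels (L := L) (p := X.Special) X.ht
      (fun i _ hi => by have := hL₀ i hi; omega),
    cnt_eq_sum_levels (L := L) (p := X.AdvSer) (fun i => (X.tip i).length + 1)
      (fun i _ hi => by have := hL₀ i hi; omega),
    cnt_eq_sum_levels (L := L) (p := X.AdvPar) (fun i => (X.tip i).length)
      (fun i _ hi => by have := hL₀ i hi; omega),
    cnt_eq_sum_levels (L := L) (p := X.ProdPar δ) X.ht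
      (fun i _ hi => by have := hL₀ i hi; omega),
    cnt_eq_sum_levels (L := L) (p := X.ProdSer δ) X.ht
      (fun i _ hi => by have := hL₀ i hi; omega),
    cnt_eq_sum_levels (L := L) (p := X.ExtraSer δ) (fun i => (X.tip i).length + 1)
      (fun i _ hi => by have := hL₀ i hi; omega)]
  push_cast
  simp only [Finset.mul_sum, Finset.sum_neg_distrib, neg_mul, one_mul]

/-- A height is entered once, and once ready it stays ready until it is left. -/
theorem Follows.cnt_special_le (hX : X.Follows δ) (z t l : ℕ) :
    (cnt z t fun i => X.Special i ∧ X.ht i = l) ≤ 2 := by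
  have h1 : (cnt z t fun i => X.Special i ∧ X.ht i = l) ≤
      (cnt z t fun i => X.Switch i ∧ X.ht i = l) +
      (cnt z t fun i => (X.Ready i ∧ ¬ X.Ready (i - 1) ∧ ¬ X.Switch i) ∧ X.ht i = l) := by
    simp only [cnt_eq_card]
    refine le_trans (Finset.card_le_card ?_) (Finset.card_union_le _ _)
    intro i hi
    simp only [Finset.mem_union, Finset.mem_filter] at *
    unfold Special at hi
    tauto
  have h2 : (cnt z t fun i => X.Switch i ∧ X.ht i = l) ≤ 1 := by
    refine cnt_le_one fun i j hij hi hj => ?_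
    have := hj.1.le_of_ht_le hX (i := i) (by omega)
    omega
  have h3 : (cnt z t fun i => (X.Ready i ∧ ¬ X.Ready (i - 1) ∧ ¬ X.Switch i) ∧ X.ht i = l) ≤ 1 := by
    refine cnt_le_one fun i j hij hi hj => ?_
    refine hj.1.2.1 ?_
    obtain ⟨j', hj', hh, hc⟩ := hi.1.1
    have h4 := hX.ht_mono (show i ≤ j - 1 by omega)
    have h5 := hX.ht_mono (show j - 1 ≤ j by omega)
    exact ⟨j', by omega, by omega, hc⟩
  omega

/-- A synchronized honest series block builds on the current height and so ends it. -/
theorem Follows.cnt_prodSer_le (hX : X.Follows δ) (z t l : ℕ) :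
    (cnt z t fun i => X.ProdSer δ i ∧ X.ht i = l) ≤ 1 := by
  refine cnt_le_one fun i j hij hi hj => ?_
  have h1 := hi.1.2.ht_lt_succ hX hi.1.1.1 hi.1.1.2
  have h2 := hX.ht_mono (show i + 1 ≤ j by omega)
  omega

/-- The honest parties mine at most `k` useful parallel blocks on every chain of a given length. -/
theorem Follows.cnt_prodPar_le (hX : X.Follows δ) (hk : 0 < k) (ht : Monotone X.time) {z t l : ℕ}
    (hz : X.Switch z) (hl : X.ht z ≤ l) :
    (cnt z t fun i => X.ProdPar δ i ∧ X.ht i = l) ≤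
      k * (1 + (cnt z t fun i => X.ExtraSer δ i ∧ (X.tip i).length + 1 = l) +
        cnt 0 t fun i => X.AdvSer i ∧ (X.tip i).length + 1 = l) := by
  set A := (Finset.Ico z t).filter fun i => X.ProdPar δ i ∧ X.ht i = l with hA
  have hAmem : ∀ i ∈ A, i < t ∧ X.ProdPar δ i ∧ X.ht i = l ∧ (X.tip i).length = l := by
    intro i hi
    rw [hA, Finset.mem_filter, Finset.mem_Ico] at hi
    refine ⟨hi.1.2, hi.2.1, hi.2.2, ?_⟩
    rw [hi.2.1.2.length_tip hX hi.2.1.1.1, hi.2.2]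
  -- At the last useful parallel block on a given chain the height is not yet ready, so fewer than
  -- `k` honest parallel blocks on that chain precede it.
  have h1 : A.card ≤ k * (A.image X.tip).card := by
    refine Finset.card_le_mul_card_image A k fun C hC => ?_
    obtain ⟨i₀, hi₀, rfl⟩ := Finset.mem_image.1 hC
    set B := A.filter fun i => X.tip i = X.tip i₀ with hB
    have hBne : B.Nonempty := ⟨i₀, by simp [hB, hi₀]⟩
    set i₁ := B.max' hBne
    have hi₁ : i₁ ∈ B := B.max'_mem hBne
    have hi₁A := hAmem i₁ (Finset.mem_filter.1 hi₁).1
    have hnr := hi₁A.2.1.2.not_ready_of_par hX hk ht hi₁A.2.1.1.1 hi₁A.2.1.1.2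
    have hcard : ((Finset.range i₁).filter fun i =>
        (X.Hon i ∧ X.Par i) ∧ X.tip i = X.tip i₀).card < k := by
      by_contra hge
      refine hnr ⟨i₁, le_rfl, rfl, Or.inr ⟨X.tip i₀, ?_, not_lt.1 hge⟩⟩
      rw [(hAmem i₀ hi₀).2.2.2, hi₁A.2.2.1]
    have hsub : B.erase i₁ ⊆ (Finset.range i₁).filter fun i =>
        (X.Hon i ∧ X.Par i) ∧ X.tip i = X.tip i₀ := by
      intro i hi
      have h2 := Finset.mem_erase.1 hi
      have h3 := B.le_max' i h2.2
      have h4 := Finset.mem_filter.1 h2.2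
      have h5 := hAmem i h4.1
      rw [Finset.mem_filter, Finset.mem_range]
      exact ⟨lt_of_le_of_ne h3 h2.1, h5.2.1.1, h4.2⟩
    have h6 := Finset.card_le_card hsub
    rw [Finset.card_erase_of_mem hi₁] at h6
    show B.card ≤ k
    omega
  -- Only one honest block of length `l` is mined while the height is below `l`, since it raises the
  -- height at once. Any other honest block of that length builds below the current height, hence is
  -- mined after `z` and out of synchronization.
  have h2 : (A.image X.tip).card ≤ 1 + (cnt z t fun i => X.ExtraSer δ i ∧ (X.tip i).length + 1 = l) +
        cnt 0 t fun i => X.AdvSer i ∧ (X.tip i).length + 1 = l := by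
    rcases Nat.eq_zero_or_pos l with rfl | hlpos
    · have : A.image X.tip ⊆ {Chain.genesis} := by
        intro C hC
        obtain ⟨i, hi, rfl⟩ := Finset.mem_image.1 hC
        have h3 := (hAmem i hi).2.2.2
        rw [Finset.mem_singleton]
        by_contra hne
        have := Chain.length_pos_iff.2 hne
        omega
      have := Finset.card_le_card this
      simp only [Finset.card_singleton] at this
      omega
    · have hsub : A.image X.tip ⊆ ((Finset.Ico 0 t).filter fun i =>
          X.Ser i ∧ (X.tip i).length + 1 = l).image X.res := by
        intro C hC
        obtain ⟨i, hi, rfl⟩ := Finset.mem_image.1 hC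
        have h3 := hAmem i hi
        obtain ⟨i', hi', hs, hr⟩ := (hX.tip_exists i).exists_ser (by omega)
        refine Finset.mem_image.2 ⟨i', ?_, hr⟩
        rw [Finset.mem_filter, Finset.mem_Ico]
        refine ⟨⟨by omega, by omega⟩, hs, ?_⟩
        rw [← hs.length_res, hr, h3.2.2.2]
      refine (Finset.card_le_card hsub).trans (Finset.card_image_le.trans ?_)
      have hfirst : (cnt 0 t fun i => X.HonSer i ∧ (X.tip i).length + 1 = l ∧ X.ht i < l) ≤ 1 := by
        refine cnt_le_one fun i j hij hi hj => ?_
        have h3 := hX.ht_succ_of_hon hi.1.1 hi.1.2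
        have h4 := hX.ht_mono (show i + 1 ≤ j by omega)
        omega
      have hcover : ((Finset.Ico 0 t).filter fun i => X.Ser i ∧ (X.tip i).length + 1 = l) ⊆
          (((Finset.Ico 0 t).filter fun i => X.HonSer i ∧ (X.tip i).length + 1 = l ∧ X.ht i < l) ∪
          ((Finset.Ico z t).filter fun i => X.ExtraSer δ i ∧ (X.tip i).length + 1 = l)) ∪
          ((Finset.Ico 0 t).filter fun i => X.AdvSer i ∧ (X.tip i).length + 1 = l) := by
        intro i hi
        simp only [Finset.mem_union, Finset.mem_filter, Finset.mem_Ico] at *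
        by_cases hh : X.Hon i
        · left
          by_cases hlt : X.ht i < l
          · left; exact ⟨hi.1, ⟨hh, hi.2.1⟩, hi.2.2, hlt⟩
          · right
            have h3 := hz.le_of_ht_le hX (i := i) (by omega)
            refine ⟨⟨h3, hi.1.2⟩, ⟨⟨hh, hi.2.1⟩, fun hp => ?_⟩, hi.2.2⟩
            have h4 := hp.length_tip hX hh
            omega
        · right; exact ⟨hi.1, ⟨hh, hi.2.1⟩, hi.2.2⟩
      refine (Finset.card_le_card hcover).trans ((Finset.card_union_le _ _).trans ?_)
      have h5 := Finset.card_union_le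
        ((Finset.Ico 0 t).filter fun i => X.HonSer i ∧ (X.tip i).length + 1 = l ∧ X.ht i < l)
        ((Finset.Ico z t).filter fun i => X.ExtraSer δ i ∧ (X.tip i).length + 1 = l)
      simp only [cnt_eq_card] at *
      omega
  calc (cnt z t fun i => X.ProdPar δ i ∧ X.ht i = l) = A.card := cnt_eq_card _ _ _
    _ ≤ _ := h1.trans (Nat.mul_le_mul_left k h2)

theorem ZeroStock.cnt_eq_zero_of_lt {z l : ℕ} (hz : X.ZeroStock z) (hl : X.ht z < l)
    (p : ℕ → Prop) (hp : ∀ i, p i → X.Ser i) :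
    (cnt 0 z fun i => p i ∧ (X.tip i).length + 1 = l) = 0 := by
  refine cnt_eq_zero fun i _ hi h => ?_
  have := hz.2 i hi (hp i h.1)
  omega

theorem ZeroStock.cnt_advSer_eq {z t l : ℕ} (hz : X.ZeroStock z) (hzt : z ≤ t) (hl : X.ht z < l) :
    (cnt 0 t fun i => X.AdvSer i ∧ (X.tip i).length + 1 = l) =
      cnt z t fun i => X.AdvSer i ∧ (X.tip i).length + 1 = l := by
  rw [cnt_split (Nat.zero_le z) hzt, hz.cnt_eq_zero_of_lt hl _ fun i h => h.2, zero_add]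

/-- If a chain longer than `l` exists when the honest parties reach height `l`, the adversary has
mined a series block and a `k`-set for it at that height. -/
theorem Follows.cnt_adv_of_private (hX : X.Follows δ) {z t t₀ l : ℕ}
    (hz : X.ZeroStock z) (hl : X.ht z < l) (ht₀ : t₀ ≤ t)
    (hlow : ∀ i < t₀, X.ht i < l) (hex : ∃ i < t₀, X.Ser i ∧ l < (X.tip i).length + 1) :
    (1 ≤ cnt z t fun i => X.AdvSer i ∧ (X.tip i).length + 1 = l) ∧
      k ≤ cnt z t fun i => X.AdvPar i ∧ (X.tip i).length = l := by
  obtain ⟨i, hi, hs, hlen⟩ := hex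
  have hres : X.ChainExists t₀ (X.res i) := chainExists_iff.2 (Or.inr ⟨i, hi, hs, rfl⟩)
  obtain ⟨i₁, hi₁, hs₁, -, hlen₁⟩ := hX.exists_ser_trunc hres (l := l + 1) (by omega)
    (by rw [hs.length_res]; omega)
  obtain ⟨i₂, hi₂, hs₂, hr₂⟩ := (hX.tip_exists i₁).exists_ser (by omega)
  have hlen₂ : (X.tip i₂).length + 1 = l := by rw [← hs₂.length_res, hr₂]; omega
  have hcard := hX.card_par hs₁
  -- A mined chain carries the number of its ring, so `i₂` is the only ring that produces this
  -- chain, and every parallel block on top of it is later.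
  have hafter : ∀ i', X.tip i' = X.tip i₁ → i₂ < i' := by
    intro i' h
    obtain ⟨i₃, hi₃, hs₃, hr₃⟩ := (hX.tip_exists i').exists_ser (by rw [h]; omega)
    have : i₃ = i₂ := by
      have h4 : X.res i₃ = X.res i₂ := by rw [hr₃, hr₂, h]
      have h5 := hs₃.1
      have h6 := hs₂.1
      unfold res at h4
      cases h7 : X.jobAt i₃ <;> cases h8 : X.jobAt i₂ <;> rw [h7, h8] at h4 <;>
        rw [h7] at h5 <;> rw [h8] at h6 <;> simp_all [Job.out, Job.isSer]
    omega
  have hz₂ : z ≤ i₂ := by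
    by_contra hlt
    have := hz.2 i₂ (by omega) hs₂
    omega
  -- No honest party works on a chain of length `l` before the honest height reaches `l`.
  have hadv : ∀ i' < t₀, (X.tip i').length = l → ¬ X.Hon i' := by
    intro i' hi' hlen' hh
    have h1 := hh.length_tip_le
    have h2 := hlow i' hi'
    omega
  constructor
  · refine cnt_pos hz₂ (by omega) ⟨⟨fun hh => ?_, hs₂⟩, hlen₂⟩
    have h1 := hX.ht_succ_of_hon hh hs₂
    have h2 := hlow (i₂ + 1) (by omega)
    omega
  · rw [cnt_eq_card]
    refine hcard.trans (Finset.card_le_card fun i' hi' => ?_)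
    rw [Finset.mem_filter, Finset.mem_range] at hi'
    have h1 := hafter i' hi'.2.2
    have h2 : (X.tip i').length = l := by rw [hi'.2.2]; omega
    rw [Finset.mem_filter, Finset.mem_Ico]
    exact ⟨⟨by omega, by omega⟩, ⟨hadv i' (by omega) h2, hi'.2.1⟩, h2⟩

end Trace
end Trace
end Interlude

/-! ### Lower bounds on the advantage between zero-stock switches. -/

namespace Interlude

section Trace

open scoped Classical

variable {n m k : ℕ} {Tx : Type*}

namespace Trace

/-- Conditions on the weight `om` of a parallel block and on the charge `d` for a special index. -/
structure Weights (k : ℕ) (om d : ℝ) : Prop where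
  k_pos : 0 < k
  om_pos : 0 < om
  mul_le : k * om ≤ 1
  d_nonneg : 0 ≤ d
  d_le : d ≤ 1 / 10

variable {X : Trace n m k Tx} {δ om d : ℝ}

/-- All negative terms of `advLevel` are indexed by the honest height, so none of them occurs. -/
theorem advLevel_ge_of_not_attained {z t l : ℕ}
    (h : ∀ i, z ≤ i → i < t → X.ht i ≠ l) :
    ((cnt z t fun i => X.AdvSer i ∧ (X.tip i).length + 1 = l) : ℝ)
      + om * (cnt z t fun i => X.AdvPar i ∧ (X.tip i).length = l)
      + (cnt z t fun i => X.ExtraSer δ i ∧ (X.tip i).length + 1 = l) ≤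
      X.advLevel δ om d z t l := by
  unfold advLevel
  rw [cnt_eq_zero (p := fun i => X.Special i ∧ X.ht i = l) fun i h1 h2 h3 => h i h1 h2 h3.2,
    cnt_eq_zero (p := fun i => X.ProdPar δ i ∧ X.ht i = l) fun i h1 h2 h3 => h i h1 h2 h3.2,
    cnt_eq_zero (p := fun i => X.ProdSer δ i ∧ X.ht i = l) fun i h1 h2 h3 => h i h1 h2 h3.2]
  simp

theorem advLevel_nonneg_of_not_attained (hw : Weights k om d) {z t l : ℕ}
    (h : ∀ i, z ≤ i → i < t → X.ht i ≠ l) : 0 ≤ X.advLevel δ om d z t l := by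
  refine le_trans ?_ (advLevel_ge_of_not_attained h)
  have := hw.om_pos
  positivity

/-- Each chain of length `l` allows useful parallel work of at most `k * om`. An unsynchronized
honest block pays with its own weight 1 for the additional chain it creates. Adversarial siblings
are counted from time 0, because those mined before `z` also create chains the honest parties may
work on. -/
theorem Follows.advLevel_ge (hX : X.Follows δ) (ht : Monotone X.time) (hw : Weights k om d)
    {z t l : ℕ} (hz : X.ZeroStock z) (hl : X.ht z ≤ l) :
    ((cnt z t fun i => X.AdvSer i ∧ (X.tip i).length + 1 = l) : ℝ)
      + om * (cnt z t fun i => X.AdvPar i ∧ (X.tip i).length = l)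
      - 57 / 100 * (k * om) * (1 + cnt 0 t fun i => X.AdvSer i ∧ (X.tip i).length + 1 = l)
      - 57 / 100 - 2 * d ≤ X.advLevel δ om d z t l := by
  unfold advLevel
  have h1 := hX.cnt_prodPar_le hw.k_pos ht (t := t) hz.1 hl
  have h2 := hX.cnt_prodSer_le z t l
  have h3 := hX.cnt_special_le z t l
  set a := cnt z t fun i => X.AdvSer i ∧ (X.tip i).length + 1 = l
  set A := cnt 0 t fun i => X.AdvSer i ∧ (X.tip i).length + 1 = l
  set aP := cnt z t fun i => X.AdvPar i ∧ (X.tip i).length = l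
  set hP := cnt z t fun i => X.ProdPar δ i ∧ X.ht i = l
  set hS := cnt z t fun i => X.ProdSer δ i ∧ X.ht i = l
  set sp := cnt z t fun i => X.Special i ∧ X.ht i = l
  set e := cnt z t fun i => X.ExtraSer δ i ∧ (X.tip i).length + 1 = l
  have h1' : (hP : ℝ) ≤ k * (1 + e + A) := by exact_mod_cast h1
  have h2' : (hS : ℝ) ≤ 1 := by exact_mod_cast h2
  have h3' : (sp : ℝ) ≤ 2 := by exact_mod_cast h3
  have h4 : om * (hP : ℝ) ≤ om * (k * (1 + e + A)) := mul_le_mul_of_nonneg_left h1' hw.om_pos.le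
  have h5 : d * (sp : ℝ) ≤ d * 2 := mul_le_mul_of_nonneg_left h3' hw.d_nonneg
  have h6 : (k * om) * (e : ℝ) ≤ 1 * e := mul_le_mul_of_nonneg_right hw.mul_le (Nat.cast_nonneg e)
  have h7 : (0 : ℝ) ≤ e := Nat.cast_nonneg e
  nlinarith

/-- The first index of a given height is a switch. -/
theorem Follows.ht_eq_or (hX : X.Follows δ) {i₀ l : ℕ} (h : X.ht i₀ = l) :
    ∃ t₀ ≤ i₀, X.ht t₀ = l ∧ X.Switch t₀ ∧ ∀ i < t₀, X.ht i < l := by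
  have hex : ∃ i, l ≤ X.ht i := ⟨i₀, h.ge⟩
  refine ⟨Nat.find hex, Nat.find_min' hex h.ge, ?_, ?_, fun i hi => not_le.1 (Nat.find_min hex hi)⟩
  · exact le_antisymm ((hX.ht_mono (Nat.find_min' hex h.ge)).trans h.le) (Nat.find_spec hex)
  · by_cases h0 : Nat.find hex = 0
    · exact Or.inl h0
    · right
      have := Nat.find_min hex (show Nat.find hex - 1 < Nat.find hex by omega)
      have := Nat.find_spec hex
      omega

/-- Heights that the honest parties reach when a longer chain already exists are not to their
advantage. -/
theorem Follows.advLevel_nonneg (hX : X.Follows δ) (ht : Monotone X.time) (hw : Weights k om d)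
    {z t l : ℕ} (hz : X.ZeroStock z) (hzt : z ≤ t) (hl : l ≠ X.ht z)
    (hno : ∀ i, z < i → i < t → ¬ X.ZeroStock i) : 0 ≤ X.advLevel δ om d z t l := by
  by_cases hatt : ∃ i, z ≤ i ∧ i < t ∧ X.ht i = l
  swap
  · push Not at hatt
    exact advLevel_nonneg_of_not_attained hw hatt
  obtain ⟨i₀, hi₀, hi₀t, hi₀l⟩ := hatt
  have hlt : X.ht z < l := lt_of_le_of_ne (hi₀l ▸ hX.ht_mono hi₀) hl.symm
  obtain ⟨t₀, ht₀, ht₀l, hsw, hmin⟩ := hX.ht_eq_or hi₀l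
  have hzt₀ : z < t₀ := by
    by_contra hge
    have := hX.ht_mono (not_lt.1 hge)
    omega
  have hnz := hno t₀ hzt₀ (by omega)
  have hex : ∃ i < t₀, X.Ser i ∧ l < (X.tip i).length + 1 := by
    by_contra hne
    push Not at hne
    exact hnz ⟨hsw, fun i hi hs => by rw [ht₀l]; exact hne i hi hs⟩
  obtain ⟨ha, hp⟩ := hX.cnt_adv_of_private (t := t) hz hlt (by omega) hmin hex
  have h1 := hX.advLevel_ge ht hw (t := t) hz hlt.le
  rw [hz.cnt_advSer_eq hzt hlt] at h1
  refine le_trans ?_ h1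
  have ha' : (1 : ℝ) ≤ (cnt z t fun i => X.AdvSer i ∧ (X.tip i).length + 1 = l) := by
    exact_mod_cast ha
  have hp' : (k : ℝ) ≤ (cnt z t fun i => X.AdvPar i ∧ (X.tip i).length = l) := by
    exact_mod_cast hp
  have h2 := mul_le_mul_of_nonneg_left hp' hw.om_pos.le
  have h3 := hw.mul_le
  have h4 := hw.d_le
  have h5 : 0 ≤ (k : ℝ) * om := by have := hw.om_pos; positivity
  -- With x = k·om ≤ 1, one adversarial series block and a `k`-set leave at least 1 + x − 57/100·2x
  -- − 57/100 − 2/10 = 0.23 − 0.14x > 0. Further adversarial series blocks only help, as 57/100·x <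
  -- 1.
  nlinarith

/-- Only the starting height can contribute negatively, since no private chain need exist there. Its
deficit is at most 2·57/100 + 2/10 < 2, apart from the work allowed by siblings already present at
`z`. The height `l'` is kept separate so that a known surplus there can be used. -/
theorem Follows.le_advSum_aux (hX : X.Follows δ) (ht : Monotone X.time) (hw : Weights k om d)
    {z t : ℕ} (hz : X.ZeroStock z) (hzt : z ≤ t)
    (hno : ∀ i, z < i → i < t → ¬ X.ZeroStock i) (l' : ℕ) (hl' : l' ≠ X.ht z) :
    X.advLevel δ om d z t l' - 2 ≤
      X.advSum δ om d z t + 57 / 100 * (k * om) * X.sib z := by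
  obtain ⟨L₀, hL₀⟩ := exists_advSum_eq (X := X) (δ := δ) om d z t
  rw [hL₀ (max L₀ (max l' (X.ht z) + 1)) (le_max_left _ _)]
  set L := max L₀ (max l' (X.ht z) + 1)
  have hsub : ({l', X.ht z} : Finset ℕ) ⊆ Finset.range L := by
    intro l hl
    simp only [Finset.mem_insert, Finset.mem_singleton] at hl
    rw [Finset.mem_range]
    omega
  have h1 : ∑ l ∈ ({l', X.ht z} : Finset ℕ), X.advLevel δ om d z t l ≤
      ∑ l ∈ Finset.range L, X.advLevel δ om d z t l := by
    refine Finset.sum_le_sum_of_subset_of_nonneg hsub fun l _ hl => ?_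
    simp only [Finset.mem_insert, Finset.mem_singleton, not_or] at hl
    exact hX.advLevel_nonneg ht hw hz hzt hl.2 hno
  rw [Finset.sum_pair hl'] at h1
  have h2 := hX.advLevel_ge ht hw (t := t) hz (le_refl (X.ht z))
  have h3 : (cnt 0 t fun i => X.AdvSer i ∧ (X.tip i).length + 1 = X.ht z) = X.sib z +
      cnt z t fun i => X.AdvSer i ∧ (X.tip i).length + 1 = X.ht z :=
    cnt_split (Nat.zero_le z) hzt _
  rw [h3] at h2
  push_cast at h2
  have h4 := hw.mul_le
  have h5 := hw.d_le
  have h6 := hw.om_pos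
  have h7 : (0 : ℝ) ≤ (cnt z t fun i => X.AdvSer i ∧ (X.tip i).length + 1 = X.ht z) :=
    Nat.cast_nonneg _
  have h8 : (0 : ℝ) ≤ om * (cnt z t fun i => X.AdvPar i ∧ (X.tip i).length = X.ht z) := by
    positivity
  have h9 : 0 ≤ (k : ℝ) * om := by positivity
  nlinarith [mul_le_mul_of_nonneg_right h4 h7]

/-- As long as the adversary has kept a longer chain in stock, its advantage is bounded below. -/
theorem Follows.le_advSum (hX : X.Follows δ) (ht : Monotone X.time) (hw : Weights k om d)
    {z t : ℕ} (hz : X.ZeroStock z) (hzt : z ≤ t)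
    (hno : ∀ i, z < i → i < t → ¬ X.ZeroStock i) :
    -2 ≤ X.advSum δ om d z t + 57 / 100 * (k * om) * X.sib z := by
  have h1 := hX.le_advSum_aux ht hw hz hzt hno (X.ht z + 1) (by omega)
  have h2 := hX.advLevel_nonneg ht hw hz hzt (l := X.ht z + 1) (by omega) hno
  linarith

/-- The height reached at `t` is new: nothing is subtracted there before `t`, and every sibling at
that height was mined since `z` and counts 1. -/
theorem Follows.sib_le_advSum (hX : X.Follows δ) (ht : Monotone X.time) (hw : Weights k om d)
    {z t : ℕ} (hz : X.ZeroStock z) (hzt : z < t) (htz : X.ZeroStock t)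
    (hno : ∀ i, z < i → i < t → ¬ X.ZeroStock i) :
    X.sib t - 2 ≤ X.advSum δ om d z t + 57 / 100 * (k * om) * X.sib z := by
  have hlt : X.ht (t - 1) < X.ht t := by
    rcases htz.1 with h | h
    · omega
    · exact h
  have hlt' : X.ht z < X.ht t := lt_of_le_of_lt (hX.ht_mono (by omega)) hlt
  have h1 := hX.le_advSum_aux ht hw hz hzt.le hno (X.ht t) (by omega)
  have h2 := advLevel_ge_of_not_attained (X := X) (δ := δ) (om := om) (d := d) (z := z) (t := t) (l := X.ht t)
    fun i _ hi => by have := hX.ht_mono (show i ≤ t - 1 by omega); omega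
  have h3 : X.sib t = cnt z t fun i => X.AdvSer i ∧ (X.tip i).length + 1 = X.ht t :=
    hz.cnt_advSer_eq hzt.le hlt'
  rw [h3]
  have h6 := hw.om_pos
  have h7 : (0 : ℝ) ≤ (cnt z t fun i => X.ExtraSer δ i ∧ (X.tip i).length + 1 = X.ht t) :=
    Nat.cast_nonneg _
  have h8 : (0 : ℝ) ≤ om * (cnt z t fun i => X.AdvPar i ∧ (X.tip i).length = X.ht t) := by
    positivity
  linarith

end Trace
end Trace
end Interlude

/-! ### Clean periods and the settlement of their first block. -/

namespace Interlude

section Trace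

open scoped Classical

variable {n m k : ℕ} {Tx : Type*}

namespace Trace

variable (X : Trace n m k Tx) (δ : ℝ)

/-- All series blocks mined in `[s, t)` are due to synchronized honest parties. -/
def Clean (s t : ℕ) : Prop := ∀ i, s ≤ i → i < t → ¬ X.AdvSer i ∧ ¬ X.ExtraSer δ i

/-- The progress of the honest parties in `[s, t)`. -/
noncomputable def prog (om fd : ℝ) (i : ℕ) : ℝ :=
  (if X.Special i then fd else 0) + (if X.ProdPar δ i then om else 0) +
    (if X.ProdSer δ i then 1 else 0)

noncomputable def progSum (om fd : ℝ) (s t : ℕ) : ℝ := ∑ i ∈ Finset.Ico s t, X.prog δ om fd i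

variable {X δ} {om d : ℝ}

theorem Clean.prodSer {s t i : ℕ} (h : X.Clean δ s t) (h1 : s ≤ i) (h2 : i < t) (hs : X.Ser i) :
    X.ProdSer δ i := by
  have h3 := h i h1 h2
  unfold AdvSer ExtraSer ProdSer HonSer at *
  tauto

theorem Clean.length_le (hX : X.Follows δ) {s t : ℕ} (hc : X.Clean δ s t) (hs : X.ZeroStock s)
    (hst : s ≤ t) {i : ℕ} (hi : i < t) (h : X.Ser i) : (X.tip i).length + 1 ≤ X.ht t := by
  by_cases h1 : i < s
  · exact (hs.2 i h1 h).trans (hX.ht_mono hst)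
  · have h2 := hc.prodSer (not_lt.1 h1) hi h
    exact (hX.ht_succ_of_hon h2.1.1 h).trans (hX.ht_mono (by omega))

theorem Clean.zeroStock (hX : X.Follows δ) {s t : ℕ} (hc : X.Clean δ s t) (hs : X.ZeroStock s)
    (hst : s ≤ t) (hsw : X.Switch t) : X.ZeroStock t :=
  ⟨hsw, fun _ hi h => hc.length_le hX hs hst hi h⟩

theorem Clean.cnt_advSer {s t l : ℕ} (hc : X.Clean δ s t) (hs : X.ZeroStock s)
    (hst : s ≤ t) (hl : X.ht s < l) :
    (cnt 0 t fun i => X.AdvSer i ∧ (X.tip i).length + 1 = l) = 0 := by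
  rw [hs.cnt_advSer_eq hst hl]
  exact cnt_eq_zero fun i h1 h2 h3 => (hc i h1 h2).1 h3.1

theorem Clean.sib_eq_zero {s t : ℕ} (hc : X.Clean δ s t) (hs : X.ZeroStock s)
    (hst : s ≤ t) (hl : X.ht s < X.ht t) : X.sib t = 0 :=
  hc.cnt_advSer hs hst hl

/-- Each of the `M` heights has at most two special indices, one useful series block and useful
parallel work of weight 1 on a single chain. Only the starting height may have additional chains,
one for each sibling. -/
theorem Clean.progSum_le (hX : X.Follows δ) (ht : Monotone X.time) (hw : Weights k om d)
    {fd : ℝ} (hfd : 0 ≤ fd) {s t M : ℕ} (hc : X.Clean δ s t) (hs : X.ZeroStock s)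
    (hst : s ≤ t) (hM : ∀ i, s ≤ i → i < t → X.ht i < X.ht s + M) :
    X.progSum δ om fd s t ≤ fd * (2 * M) + (M + X.sib s) + M := by
  unfold progSum prog
  simp only [Finset.sum_add_distrib, sum_ite_eq_mul_cnt]
  have hf : ∀ i, s ≤ i → i < t → X.ht i - X.ht s < M := fun i h1 h2 => by
    have := hM i h1 h2
    have := hX.ht_mono h1
    omega
  have hcon : ∀ (p : ℕ → Prop) (l : ℕ), (cnt s t fun i => p i ∧ X.ht i - X.ht s = l) ≤
      cnt s t fun i => p i ∧ X.ht i = X.ht s + l := fun p l => by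
    refine cnt_mono fun i h1 h2 h3 => ⟨h3.1, ?_⟩
    have := hX.ht_mono h1
    omega
  have h1 : cnt s t X.Special ≤ 2 * M := by
    rw [cnt_eq_sum_levels (fun i => X.ht i - X.ht s) hf]
    refine (Finset.sum_le_card_nsmul _ _ 2 fun l _ => (hcon _ l).trans
      (hX.cnt_special_le _ _ _)).trans ?_
    simp [mul_comm]
  have h2 : cnt s t (X.ProdSer δ) ≤ M := by
    rw [cnt_eq_sum_levels (fun i => X.ht i - X.ht s) hf]
    refine (Finset.sum_le_card_nsmul _ _ 1 fun l _ => (hcon _ l).trans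
      (hX.cnt_prodSer_le _ _ _)).trans ?_
    simp
  have h3 : cnt s t (X.ProdPar δ) ≤ k * (M + X.sib s) := by
    rw [cnt_eq_sum_levels (fun i => X.ht i - X.ht s) hf]
    have h4 : ∀ l ∈ Finset.range M, (cnt s t fun i => X.ProdPar δ i ∧ X.ht i - X.ht s = l) ≤
        k * (1 + if l = 0 then X.sib s else 0) := by
      intro l _
      refine ((hcon _ l).trans (hX.cnt_prodPar_le hw.k_pos ht hs.1 (by omega))).trans
        (Nat.mul_le_mul_left k ?_)
      rw [cnt_eq_zero (p := fun i => X.ExtraSer δ i ∧ (X.tip i).length + 1 = X.ht s + l)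
        fun i h1 h2 h3 => (hc i h1 h2).2 h3.1]
      split_ifs with h0
      · subst h0
        rw [cnt_split (Nat.zero_le s) hst, cnt_eq_zero (z := s)
          (p := fun i => X.AdvSer i ∧ (X.tip i).length + 1 = X.ht s + 0)
          fun i h1 h2 h3 => (hc i h1 h2).1 h3.1]
        unfold sib
        simp
      · rw [hc.cnt_advSer hs hst (by omega)]
    refine (Finset.sum_le_sum h4).trans ?_
    rw [← Finset.mul_sum, Finset.sum_add_distrib]
    refine Nat.mul_le_mul_left k ?_
    simp only [Finset.sum_const, Finset.card_range, smul_eq_mul, mul_one, Finset.sum_ite_eq',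
      Finset.mem_range]
    split_ifs <;> omega
  have h1' : (cnt s t X.Special : ℝ) ≤ 2 * M := by exact_mod_cast h1
  have h2' : (cnt s t (X.ProdSer δ) : ℝ) ≤ M := by exact_mod_cast h2
  have h3' : (cnt s t (X.ProdPar δ) : ℝ) ≤ k * (M + X.sib s) := by exact_mod_cast h3
  have h4 := mul_le_mul_of_nonneg_left h1' hfd
  have h5 := mul_le_mul_of_nonneg_left h3' hw.om_pos.le
  have h6 : om * (k * ((M : ℝ) + X.sib s)) ≤ 1 * (M + X.sib s) := by
    have := mul_le_mul_of_nonneg_right hw.mul_le (show (0 : ℝ) ≤ (M : ℝ) + X.sib s by positivity)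
    linarith
  linarith

/-- In a clean period all new chains extend the first series block of that period. -/
theorem Clean.trunc_eq (hX : X.Follows δ) {s e i₀ : ℕ} (hc : X.Clean δ s e) (hs : X.ZeroStock s)
    (h₀ : s ≤ i₀) (h₀e : i₀ < e) (hser : X.Ser i₀) (hlen : (X.tip i₀).length = X.ht s)
    {C : Chain k Tx} (hC : X.ChainExists e C) (hl : X.ht s < C.length) :
    C.trunc (X.ht s + 1) = X.res i₀ := by
  obtain ⟨i, hi, hsi, hr, hli⟩ := hX.exists_ser_trunc hC (l := X.ht s + 1) (by omega) hl
  have hsle : s ≤ i := by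
    by_contra h
    have := hs.2 i (by omega) hsi
    omega
  have h1 := hc.prodSer hsle hi hsi
  have h2 := hc.prodSer h₀ h₀e hser
  have h3 := h1.2.length_tip hX h1.1.1
  have h4 := h2.2.length_tip hX h2.1.1
  have h5 := h1.2.ht_lt_succ hX h1.1.1 hsi
  have h6 := h2.2.ht_lt_succ hX h2.1.1 hser
  have h7 : i = i₀ := by
    rcases lt_trichotomy i i₀ with h | h | h
    · have := hX.ht_mono (show i + 1 ≤ i₀ by omega); omega
    · exact h
    · have := hX.ht_mono (show i₀ + 1 ≤ i by omega); omega
  rw [← hr, h7]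

/-- The height at a synchronized ring was already attained at the last special index, at least δ
earlier. -/
theorem Prod.ht_le_of_competitive (hX : X.Follows δ) (ht : Monotone X.time) {i t L : ℕ}
    (hp : X.Prod δ i) (hit : i < t)
    (hL : ∀ j < t, X.time j + δ ≤ X.time t → X.ht j ≤ L) : X.ht i ≤ L := by
  rw [← hX.ht_lastSp i]
  refine hL _ (lt_trans hp.1 hit) ?_
  have := ht hit.le
  have := hp.2
  linarith

/-- After a long clean period all competitive chains contain its first series block, as long as
the advantage gained by the adversary since then is small. -/
theorem Follows.settled [NeZero n] (hX : X.Follows δ) (ht : Monotone X.time) (hw : Weights k om d)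
    {s e i₀ : ℕ} (hs : X.ZeroStock s) (he : X.ZeroStock e) (hc : X.Clean δ s e)
    (hM : X.ht s + 60 ≤ X.ht e) (h₀ : s ≤ i₀) (h₀e : i₀ < e) (hser : X.Ser i₀)
    (hlen : (X.tip i₀).length = X.ht s) (t : ℕ) (het : e ≤ t)
    (hsmall : ∀ t', e < t' → t' ≤ t → X.advSum δ om d e t' < 56) (D : Chain k Tx)
    (hD : X.ChainExists t D) (hcomp : ∀ j < t, X.time j + δ ≤ X.time t → X.ht j ≤ D.length) :
    D.trunc (X.ht s + 1) = X.res i₀ := by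
  induction t using Nat.strong_induction_on generalizing D with
  | _ t ih =>
  by_contra hne
  have hA : ∀ C : Chain k Tx, X.ChainExists e C → X.ht s < C.length →
      C.trunc (X.ht s + 1) = X.res i₀ :=
    fun C h1 h2 => hc.trunc_eq hX hs h₀ h₀e hser hlen h1 h2
  -- The chain an honest party works on is competitive at its own time, so the induction hypothesis
  -- applies to it.
  have hB : ∀ j, e ≤ j → j < t → X.Hon j → (X.tip j).trunc (X.ht s + 1) = X.res i₀ := by
    intro j hj hjt hh
    refine ih j hjt hj (fun t' h1 h2 => hsmall t' h1 (by omega)) _ (hX.tip_exists j) ?_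
    intro j' hj' hl
    unfold Hon at hh
    unfold tip jobAt
    cases hp : X.party j with
    | inl i => exact hX.ht_le_of_late hj' hl i
    | inr a => rw [hp] at hh; simp at hh
  have hlres : (X.res i₀).length = X.ht s + 1 := by rw [hser.length_res, hlen]
  have hlong : ∀ C : Chain k Tx, C.trunc (X.ht s + 1) = X.res i₀ → X.ht s < C.length := by
    intro C h
    by_contra hle
    rw [Chain.trunc_of_length_le (by omega)] at h
    rw [h] at hle
    omega
  set lD := D.length with hlD
  -- The block that led to the height of `e` was mined by a synchronized honest party one height
  -- below, and a competitive chain must have reached that height.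
  have hDlong : X.ht e ≤ lD + 1 := by
    obtain ⟨i, hi, hsi, hli⟩ := hX.exists_ser_ht (j := e) (l := X.ht e) (by omega) le_rfl
    have hsle : s ≤ i := by
      by_contra h
      have := hs.2 i (by omega) hsi
      omega
    have h1 := hc.prodSer hsle hi hsi
    have h2 := h1.2.length_tip hX h1.1.1
    have h3 := h1.2.ht_le_of_competitive hX ht (show i < t by omega) hcomp
    omega
  -- the fork is mined by the adversary alone
  have hS : ∀ l, X.ht s < l → l ≤ lD →
      1 ≤ cnt e t fun i => X.AdvSer i ∧ (X.tip i).length + 1 = l := by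
    intro l h1 h2
    obtain ⟨i, hi, hsi, hr, hli⟩ := hX.exists_ser_trunc hD (l := l) (by omega) h2
    have hDt : (X.res i).trunc (X.ht s + 1) = D.trunc (X.ht s + 1) := by
      rw [hr, Chain.trunc_trunc (by omega)]
    have hei : e ≤ i := by
      by_contra h
      refine hne ?_
      rw [← hDt]
      refine hA _ (chainExists_iff.2 (Or.inr ⟨i, by omega, hsi, rfl⟩)) ?_
      rw [hsi.length_res]; omega
    refine cnt_pos hei hi ⟨⟨fun hh => hne ?_, hsi⟩, hli⟩
    have h3 := hB i hei hi hh
    have h4 := hlong _ h3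
    rw [← hDt, hsi.trunc_res (by omega), h3]
  -- The inequality `l < lD` is strict because the end of the fork needs no `k`-set on top of it.
  have hP : ∀ l, X.ht s < l → l < lD →
      k ≤ cnt e t fun i => X.AdvPar i ∧ (X.tip i).length = l := by
    intro l h1 h2
    obtain ⟨i, hi, hsi, hr, hli⟩ := hX.exists_ser_trunc hD (l := l + 1) (by omega) h2
    have htip : X.tip i = D.trunc l := by
      have h3 := hsi.trunc_res (l := l) (by omega)
      rw [hr, Chain.trunc_trunc (by omega)] at h3
      rw [h3, Chain.trunc_of_length_le (by omega)]
    have htt : (X.tip i).trunc (X.ht s + 1) = D.trunc (X.ht s + 1) := by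
      rw [htip, Chain.trunc_trunc (by omega)]
    rw [cnt_eq_card]
    refine (hX.card_par hsi).trans (Finset.card_le_card fun i' hi' => ?_)
    rw [Finset.mem_filter, Finset.mem_range] at hi'
    rw [Finset.mem_filter, Finset.mem_Ico]
    have hei : e ≤ i' := by
      by_contra h
      refine hne ?_
      rw [← htt, ← hi'.2.2]
      refine hA _ ((hX.tip_exists i').mono (by omega)) ?_
      rw [hi'.2.2]; omega
    refine ⟨⟨hei, by omega⟩, ⟨fun hh => hne ?_, hi'.2.1⟩, by rw [hi'.2.2]; omega⟩
    rw [← htt, ← hi'.2.2, hB i' hei (by omega) hh]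
  have het' : e < t := by
    rcases Nat.eq_or_lt_of_le het with h | h
    · exfalso
      have h1 := hS lD (by omega) le_rfl
      rw [h, cnt_eq_zero fun i h1 h2 => by omega] at h1
      omega
    · exact h
  have hprod : ∀ i, i < t → X.Prod δ i → X.ht i ≤ lD := fun i hi hp =>
    hp.ht_le_of_competitive hX ht hi hcomp
  obtain ⟨L₀, hL₀⟩ := exists_advSum_eq (X := X) (δ := δ) om d e t
  have hsum := hL₀ (max L₀ (lD + 2)) (le_max_left _ _)
  set L := max L₀ (lD + 2)
  have hd := hw.d_le
  have hd0 := hw.d_nonneg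
  have hx := hw.mul_le
  have hom := hw.om_pos
  have hx0 : 0 ≤ (k : ℝ) * om := by positivity
  -- Between the heights of `s` and `e` the fork gains 1 per height, as honest work after `e`
  -- happens no lower than `ht e`. From there up to `lD` the fork's series block and `k`-set
  -- outweigh the honest work. Two heights may be negative: `lD`, where the `k`-set may be missing,
  -- and `lD + 1`, where special indices may be charged with nothing to offset them.
  have hlev : ∀ l ∈ Finset.range L, (if X.ht s < l ∧ l < X.ht e then (1 : ℝ) else 0) +
      (if l = lD then (-1 : ℝ) else 0) + (if l = lD + 1 then (-1 : ℝ) else 0) ≤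
      X.advLevel δ om d e t l := by
    intro l _
    by_cases hle : l < X.ht e
    · have hna : ∀ i, e ≤ i → i < t → X.ht i ≠ l := fun i h1 _ => by
        have := hX.ht_mono h1; omega
      have h1 := advLevel_ge_of_not_attained (δ := δ) (om := om) (d := d) hna
      have h2 : (0 : ℝ) ≤ om * (cnt e t fun i => X.AdvPar i ∧ (X.tip i).length = l) := by positivity
      have h3 : (0 : ℝ) ≤ (cnt e t fun i => X.ExtraSer δ i ∧ (X.tip i).length + 1 = l) :=
        Nat.cast_nonneg _
      by_cases hls : X.ht s < l
      · have h4 : (1 : ℝ) ≤ (cnt e t fun i => X.AdvSer i ∧ (X.tip i).length + 1 = l) := by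
          exact_mod_cast hS l hls (by omega)
        have h5 : ¬ l = lD + 1 := by omega
        simp only [hls, hle, and_self, if_true, h5, if_false]
        split_ifs <;> linarith
      · have h4 : (0 : ℝ) ≤ (cnt e t fun i => X.AdvSer i ∧ (X.tip i).length + 1 = l) :=
          Nat.cast_nonneg _
        simp only [hls, false_and, if_false]
        split_ifs <;> linarith
    · have hcl : (cnt 0 t fun i => X.AdvSer i ∧ (X.tip i).length + 1 = l) =
          cnt e t fun i => X.AdvSer i ∧ (X.tip i).length + 1 = l := by
        rw [cnt_split (Nat.zero_le e) het'.le, hc.cnt_advSer hs (by omega) (by omega), zero_add]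
      simp only [hle, and_false, if_false]
      rcases lt_or_ge lD l with hgt | hle'
      · -- no useful honest work above the fork
        have h1 : (cnt e t fun i => X.ProdPar δ i ∧ X.ht i = l) = 0 :=
          cnt_eq_zero fun i h1 h2 h3 => by have := hprod i h2 h3.1.2; omega
        have h2 : (cnt e t fun i => X.ProdSer δ i ∧ X.ht i = l) = 0 :=
          cnt_eq_zero fun i h1 h2 h3 => by have := hprod i h2 h3.1.2; omega
        have h3 : (0 : ℝ) ≤ om * (cnt e t fun i => X.AdvPar i ∧ (X.tip i).length = l) := by
          positivity
        have h4 : ((cnt e t fun i => X.Special i ∧ X.ht i = l) : ℝ) ≤ 2 := by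
          exact_mod_cast hX.cnt_special_le e t l
        have h5 := mul_le_mul_of_nonneg_left h4 hd0
        have h6 : (0 : ℝ) ≤ (cnt e t fun i => X.ExtraSer δ i ∧ (X.tip i).length + 1 = l) :=
          Nat.cast_nonneg _
        have h7 : (0 : ℝ) ≤ (cnt e t fun i => X.AdvSer i ∧ (X.tip i).length + 1 = l) :=
          Nat.cast_nonneg _
        have h8 : ¬ l = lD := by omega
        simp only [h8, if_false]
        by_cases h9 : l = lD + 1
        · simp only [h9, if_true]
          rw [← h9]
          unfold advLevel
          rw [h1, h2]
          push_cast
          linarith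
        · simp only [h9, if_false, add_zero]
          -- Synchronized parties never work above `lD`, so a height above `lD + 1` is reached
          -- through an adversarial or unsynchronized block. That block's weight 1 covers the charge
          -- 2d.
          by_cases hatt : ∃ i, e ≤ i ∧ i < t ∧ X.ht i = l
          swap
          · push Not at hatt
            exact advLevel_nonneg_of_not_attained hw hatt
          obtain ⟨i, hei, hit, hil⟩ := hatt
          obtain ⟨i', hi', hsi', hli'⟩ := hX.exists_ser_ht (j := i) (l := l) (by omega) hil.ge
          have hei' : e ≤ i' := by
            by_contra h
            have := he.2 i' (by omega) hsi'
            omega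
          have h10 : (1 : ℝ) ≤ (cnt e t fun i => X.AdvSer i ∧ (X.tip i).length + 1 = l) +
              (cnt e t fun i => X.ExtraSer δ i ∧ (X.tip i).length + 1 = l) := by
            by_cases hh : X.Hon i'
            · by_cases hp : X.Prod δ i'
              · have := hprod i' (by omega) hp
                have := hp.length_tip hX hh
                omega
              · have h11 : 1 ≤ cnt e t (fun i => X.ExtraSer δ i ∧ (X.tip i).length + 1 = l) :=
                  cnt_pos hei' (by omega) ⟨⟨⟨hh, hsi'⟩, hp⟩, hli'⟩
                have : (1 : ℝ) ≤ (cnt e t fun i => X.ExtraSer δ i ∧ (X.tip i).length + 1 = l) := by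
                  exact_mod_cast h11
                linarith
            · have h11 : 1 ≤ cnt e t (fun i => X.AdvSer i ∧ (X.tip i).length + 1 = l) :=
                cnt_pos hei' (by omega) ⟨⟨hh, hsi'⟩, hli'⟩
              have : (1 : ℝ) ≤ (cnt e t fun i => X.AdvSer i ∧ (X.tip i).length + 1 = l) := by
                exact_mod_cast h11
              linarith
          unfold advLevel
          rw [h1, h2]
          push_cast
          linarith
      · have h1 := hX.advLevel_ge ht hw (t := t) he (l := l) (by omega)
        rw [hcl] at h1
        have h2 : (1 : ℝ) ≤ (cnt e t fun i => X.AdvSer i ∧ (X.tip i).length + 1 = l) := by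
          exact_mod_cast hS l (by omega) hle'
        have h5 : ¬ l = lD + 1 := by omega
        simp only [h5, if_false, add_zero, zero_add]
        refine le_trans ?_ h1
        split_ifs with h6
        · have h3 : (0 : ℝ) ≤ om * (cnt e t fun i => X.AdvPar i ∧ (X.tip i).length = l) := by
            positivity
          nlinarith
        · have h3 : (k : ℝ) ≤ (cnt e t fun i => X.AdvPar i ∧ (X.tip i).length = l) := by
            exact_mod_cast hP l (by omega) (by omega)
          have h4 := mul_le_mul_of_nonneg_left h3 hom.le
          nlinarith
  -- The total is at least 59 − 1 − 1 = 57, against the assumed bound 56.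
  have htot := Finset.sum_le_sum hlev
  rw [← hsum, Finset.sum_add_distrib, Finset.sum_add_distrib, Finset.sum_ite_eq',
    Finset.sum_ite_eq', if_pos (Finset.mem_range.2 (by omega)),
    if_pos (Finset.mem_range.2 (by omega)), Finset.sum_boole] at htot
  have hcard : 59 ≤ ((Finset.range L).filter fun l => X.ht s < l ∧ l < X.ht e).card := by
    have hsub : Finset.Ioo (X.ht s) (X.ht e) ⊆
        (Finset.range L).filter fun l => X.ht s < l ∧ l < X.ht e := by
      intro l hl
      rw [Finset.mem_Ioo] at hl
      rw [Finset.mem_filter, Finset.mem_range]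
      omega
    have := Finset.card_le_card hsub
    rw [Nat.card_Ioo] at this
    omega
  have hcard' : (59 : ℝ) ≤ ((Finset.range L).filter fun l => X.ht s < l ∧ l < X.ht e).card := by
    exact_mod_cast hcard
  have := hsmall t het' le_rfl
  linarith

end Trace
end Trace
end Interlude

/-! ### Bookkeeping of attempts, and reduction of a safety failure to it. -/

namespace Interlude

section Trace

open scoped Classical

variable {n m k : ℕ} {Tx : Type*}

/-- The state of the bookkeeping: between attempts, in an attempt to obtain a long clean period
that began at `s`, or after such a period from `s` to `e`. -/
inductive Mode where
  | idle : Mode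
  | attempt (s : ℕ) : Mode
  | pending (s e : ℕ) : Mode

/-- Whether the state is after a long clean period. -/
def Mode.IsPending : Mode → Prop
  | .pending _ _ => True
  | _ => False

namespace Trace

variable (X : Trace n m k Tx) (δ om d : ℝ)

/-- The change of the mode at index `t` before the clock rings. -/
noncomputable def updMode (t : ℕ) : Mode → Mode
  | .idle => if X.ZeroStock t ∧ X.sib t ≤ 5 then .attempt t else .idle
  | .attempt s => if X.ZeroStock t ∧ X.ht s + 60 ≤ X.ht t then .pending s t else .attempt s
  | .pending s e => .pending s e

/-- The change of the mode due to ring `t`. -/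
noncomputable def markMode (t : ℕ) : Mode → Mode
  | .idle => .idle
  | .attempt s => if X.AdvSer t ∨ X.ExtraSer δ t then .idle else .attempt s
  | .pending s e => if 56 ≤ X.advSum δ om d e (t + 1) then .idle else .pending s e

/-- The mode after the rings before `t`, if the bookkeeping begins at index `z`. -/
noncomputable def mode (z : ℕ) : ℕ → Mode
  | 0 => .idle
  | t + 1 => if t < z then .idle else X.markMode δ om d t (X.updMode t (mode z t))

/-- What is known about the mode after the rings before `t`. -/
def ModeInv (t : ℕ) : Mode → Prop
  | .idle => True
  | .attempt s => s < t ∧ X.ZeroStock s ∧ X.sib s ≤ 5 ∧ X.Clean δ s t ∧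
      ∀ i, s ≤ i → i < t → X.ht i < X.ht s + 60
  | .pending s e => s < e ∧ e < t ∧ X.ZeroStock s ∧ X.ZeroStock e ∧ X.Clean δ s e ∧
      X.ht s + 60 ≤ X.ht e ∧ (∀ t', e < t' → t' ≤ t → X.advSum δ om d e t' < 56)

/-- What is known about the mode just before ring `t`. -/
def ModeInvPre (t : ℕ) : Mode → Prop
  | .idle => True
  | .attempt s => s ≤ t ∧ X.ZeroStock s ∧ X.sib s ≤ 5 ∧ X.Clean δ s t ∧
      ∀ i, s ≤ i → i ≤ t → X.ht i < X.ht s + 60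
  | .pending s e => s < e ∧ e ≤ t ∧ X.ZeroStock s ∧ X.ZeroStock e ∧ X.Clean δ s e ∧
      X.ht s + 60 ≤ X.ht e ∧ (∀ t', e < t' → t' ≤ t → X.advSum δ om d e t' < 56)

variable {X δ om d}

theorem mode_of_le {z t : ℕ} (h : t ≤ z) : X.mode δ om d z t = .idle := by
  cases t with
  | zero => rfl
  | succ t => simp [mode, show t < z by omega]

theorem mode_succ {z t : ℕ} (h : z ≤ t) :
    X.mode δ om d z (t + 1) = X.markMode δ om d t (X.updMode t (X.mode δ om d z t)) := by
  simp [mode, show ¬ t < z by omega]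

theorem ModeInv.upd (hX : X.Follows δ) {t : ℕ} {M : Mode} (h : X.ModeInv δ om d t M) :
    X.ModeInvPre δ om d t (X.updMode t M) := by
  cases M with
  | idle =>
    simp only [updMode]
    split_ifs with h1
    · refine ⟨le_rfl, h1.1, h1.2, fun i _ _ => by omega, fun i h2 h3 => ?_⟩
      rw [le_antisymm h3 h2]; omega
    · trivial
  | attempt s =>
    obtain ⟨h2, h3, h4, h5, h6⟩ := h
    simp only [updMode]
    split_ifs with h1
    · refine ⟨h2, le_rfl, h3, h1.1, h5, h1.2, fun t' _ _ => by omega⟩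
    · refine ⟨h2.le, h3, h4, h5, fun i h7 h8 => ?_⟩
      rcases Nat.lt_or_eq_of_le h8 with h9 | rfl
      · exact h6 i h7 h9
      -- Passing the height `ht s + 60` is a switch, and it is zero-stock because the period is
      -- clean, so the attempt would have become pending.
      · by_contra h10
        have h11 := h6 (i - 1) (by omega) (by omega)
        exact h1 ⟨h5.zeroStock hX h3 h7 (Or.inr (by omega)), by omega⟩
  | pending s e =>
    obtain ⟨h1, h2, h3, h4, h5, h6, h7⟩ := h
    exact ⟨h1, h2.le, h3, h4, h5, h6, h7⟩

theorem ModeInvPre.mark {t : ℕ} {M : Mode} (h : X.ModeInvPre δ om d t M) :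
    X.ModeInv δ om d (t + 1) (X.markMode δ om d t M) := by
  cases M with
  | idle => trivial
  | attempt s =>
    obtain ⟨h2, h3, h4, h5, h6⟩ := h
    simp only [markMode]
    split_ifs with h1
    · trivial
    · refine ⟨by omega, h3, h4, fun i h7 h8 => ?_, fun i h7 h8 => h6 i h7 (by omega)⟩
      by_cases h9 : i < t
      · exact h5 i h7 h9
      · rw [show i = t by omega]
        tauto
  | pending s e =>
    obtain ⟨h2, h3, h4, h5, h6, h7, h8⟩ := h
    simp only [markMode]
    split_ifs with h1
    · trivial
    · refine ⟨h2, by omega, h4, h5, h6, h7, fun t' h9 h10 => ?_⟩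
      by_cases h11 : t' ≤ t
      · exact h8 t' h9 h11
      · rw [show t' = t + 1 by omega]
        exact not_le.1 h1

theorem Follows.modeInv (hX : X.Follows δ) (z t : ℕ) :
    X.ModeInv δ om d t (X.mode δ om d z t) := by
  induction t with
  | zero => trivial
  | succ t ih =>
    by_cases h : t < z
    · rw [mode_of_le (by omega)]; trivial
    · rw [mode_succ (not_lt.1 h)]
      exact (ih.upd hX).mark

/-- An attempt records the index at which it starts, and a pending mode inherits it. This places the
base found in a clean period after the base where the bookkeeping began. -/
theorem le_start (z t s : ℕ) : (X.mode δ om d z t = .attempt s → z ≤ s) ∧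
    ∀ e, X.mode δ om d z t = .pending s e → z ≤ s := by
  induction t with
  | zero => simp [mode]
  | succ t ih =>
    by_cases h : t < z
    · simp [mode, h]
    · rw [mode_succ (not_lt.1 h)]
      cases hm : X.mode δ om d z t with
      | idle =>
        simp only [updMode]
        split_ifs <;> simp only [markMode] <;> (try split_ifs) <;> simp <;> omega
      | attempt s' =>
        simp only [updMode]
        rw [hm] at ih
        split_ifs <;> simp only [markMode] <;> (try split_ifs) <;> simp_all
      | pending s' e' =>
        rw [hm] at ih
        simp only [updMode, markMode]
        split_ifs <;> simp_all

variable (X) in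
/-- The run starts afresh at `z`: `z = 0`, or ring `z - 1` has produced an honest series block
that is longer than all others. -/
def Base (z : ℕ) : Prop :=
  z = 0 ∨ (0 < z ∧ X.HonSer (z - 1) ∧
    ∀ i < z - 1, X.Ser i → (X.tip i).length < (X.tip (z - 1)).length)

theorem base_zero : X.Base 0 := Or.inl rfl

theorem Base.ht_eq [NeZero n] (hX : X.Follows δ) {z : ℕ} (hz : X.Base z) (h0 : 0 < z) :
    X.ht z = (X.tip (z - 1)).length + 1 := by
  rcases hz with rfl | ⟨-, h1, h2⟩
  · omega
  · have h3 := hX.ht_succ_of_hon h1.1 h1.2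
    rw [Nat.sub_add_cancel h0] at h3
    refine le_antisymm ?_ h3
    obtain ⟨i, hi, hsi, hli⟩ := hX.exists_ser_ht (j := z) (l := X.ht z) (by omega) le_rfl
    by_cases h4 : i < z - 1
    · have := h2 i h4 hsi; omega
    · rw [show i = z - 1 by omega] at hli; omega

theorem Base.length_le [NeZero n] (hX : X.Follows δ) {z : ℕ} (hz : X.Base z) {i : ℕ} (hi : i < z)
    (hs : X.Ser i) : (X.tip i).length + 1 ≤ X.ht z := by
  rw [hz.ht_eq hX (by omega)]
  rcases hz with rfl | ⟨-, h1, h2⟩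
  · omega
  · by_cases h4 : i < z - 1
    · have := h2 i h4 hs; omega
    · rw [show i = z - 1 by omega]

theorem Base.zeroStock [NeZero n] (hX : X.Follows δ) {z : ℕ} (hz : X.Base z) : X.ZeroStock z := by
  refine ⟨?_, fun i hi hs => hz.length_le hX hi hs⟩
  by_cases h0 : z = 0
  · exact Or.inl h0
  · right
    rw [hz.ht_eq hX (by omega)]
    rcases hz with h | ⟨-, h1, h2⟩
    · exact absurd h h0
    · by_contra h3
      obtain ⟨i, hi, hsi, hli⟩ := hX.exists_ser_ht (j := z - 1)
        (l := (X.tip (z - 1)).length + 1) (by omega) (by omega)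
      have := h2 i hi hsi
      omega

theorem Base.sib_eq_zero [NeZero n] (hX : X.Follows δ) {z : ℕ} (hz : X.Base z) : X.sib z = 0 := by
  refine cnt_eq_zero fun i _ hi h => ?_
  have h0 := hz.ht_eq hX (by omega)
  rcases hz with rfl | ⟨-, h1, h2⟩
  · omega
  · by_cases h4 : i < z - 1
    · have := h2 i h4 h.1.2; omega
    · rw [show i = z - 1 by omega] at h
      exact h.1.1 h1.1

/-- The first series block of a clean period is a base. -/
theorem Clean.base (hX : X.Follows δ) {s e i₀ : ℕ} (hc : X.Clean δ s e) (hs : X.ZeroStock s)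
    (h₀ : s ≤ i₀) (h₀e : i₀ < e) (hser : X.Ser i₀) (hlen : (X.tip i₀).length = X.ht s) :
    X.Base (i₀ + 1) := by
  have h2 := hc.prodSer h₀ h₀e hser
  refine Or.inr ⟨by omega, h2.1, fun i hi hsi => ?_⟩
  have h4 := h2.2.length_tip hX h2.1.1
  have h5 : X.Clean δ s i₀ := fun j h6 h7 => hc j h6 (by omega)
  have h6 := h5.length_le hX hs h₀ hi hsi
  simp only [Nat.add_sub_cancel]
  omega

/-- This puts `round` into the form used for counts over intervals of rings. -/
theorem round_eq (j : ℕ) : X.round j = cnt 0 j X.HonSer := by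
  unfold round
  rw [cnt_eq_card, ← Set.ncard_coe_finset]
  congr 1
  ext l
  simp only [Set.mem_ofPred_eq, Finset.coe_filter, Finset.mem_Ico, Nat.zero_le, true_and,
    mined_eq_series_iff]
  unfold HonSer Hon
  refine and_congr_right fun _ => and_congr ?_ ?_
  · cases X.party l <;> simp
  · simp

theorem Follows.ser_view_of_trunc (hX : X.Follows δ) {j : ℕ} {i : Fin n} {C : Chain k Tx} (l : ℕ)
    (h : Block.ser C ∈ X.view j i) : Block.ser (C.trunc l) ∈ X.view j i := by
  induction C with
  | genesis => exact h
  | extend prev kset id txs ih =>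
    simp only [Chain.trunc]
    split_ifs
    · exact h
    · exact ih (hX.view_prev _ _ _ _ _ _ h).1

theorem bddAbove_lengths (K : View k Tx) (p : Chain k Tx → Prop) :
    BddAbove {l | ∃ C, Block.ser C ∈ K ∧ p C ∧ C.length = l} := by
  refine ⟨K.sup fun b => match b with | .ser C => C.length | .par _ _ _ => 0, ?_⟩
  rintro l ⟨C, hC, -, rfl⟩
  exact Finset.le_sup
    (f := fun b : Block k Tx => match b with | .ser C => C.length | .par _ _ _ => 0) hC

theorem le_maxLength {K : View k Tx} {p : Chain k Tx → Prop} {C : Chain k Tx}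
    (h : Block.ser C ∈ K) (hp : p C) : C.length ≤ maxLength K p :=
  le_csSup (bddAbove_lengths K p) ⟨C, h, hp, rfl⟩

theorem exists_maxLength {K : View k Tx} {p : Chain k Tx → Prop} {C₀ : Chain k Tx}
    (h : Block.ser C₀ ∈ K) (hp : p C₀) :
    ∃ C, Block.ser C ∈ K ∧ p C ∧ C.length = maxLength K p :=
  Nat.sSup_mem (s := {l | ∃ C, Block.ser C ∈ K ∧ p C ∧ C.length = l}) ⟨_, C₀, h, hp, rfl⟩
    (bddAbove_lengths K p)

theorem Follows.lenMax_eq (hX : X.Follows δ) (j : ℕ) (i : Fin n) :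
    lenMax (X.view j i) = (X.job j (Sum.inl i)).top.length := by
  have h1 := (hX.adopts j i).1
  refine le_antisymm ?_ (le_maxLength h1 trivial)
  obtain ⟨C, hC, -, hl⟩ := exists_maxLength (p := fun _ => True) h1 trivial
  unfold lenMax
  rw [← hl]
  exact hX.length_le hC

/-- Between two indices in pending mode with a different state, the mode is not pending. -/
theorem exists_mode_not_pending {z j₀ j s e : ℕ} (hz : z ≤ j₀) (hj : j₀ ≤ j)
    (h : X.mode δ om d z j₀ = .pending s e) (hne : X.mode δ om d z j ≠ .pending s e) :
    ∃ t, j₀ ≤ t ∧ t ≤ j ∧ ¬ (X.mode δ om d z t).IsPending := by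
  induction j, hj using Nat.le_induction with
  | base => exact absurd h hne
  | succ j hj ih =>
    by_cases h1 : X.mode δ om d z j = .pending s e
    · refine ⟨j + 1, by omega, le_rfl, ?_⟩
      rw [mode_succ (by omega), h1] at hne ⊢
      simp only [updMode, markMode] at hne ⊢
      split_ifs at hne ⊢
      · exact fun h => h
      · exact absurd rfl hne
    · obtain ⟨t, h2, h3, h4⟩ := ih h1
      exact ⟨t, h2, by omega, h4⟩

/-- If safety fails, the mode is not pending although many series blocks have been mined since
the run started afresh. -/
theorem Follows.exists_base_of_reverted [NeZero n] (hX : X.Follows δ) (ht : Monotone X.time)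
    (hw : Weights k om d) {T : Tx} {κ r₀ : ℕ} (h : X.Reverted T κ r₀) :
    ∃ z t, X.Base z ∧ X.round z ≤ r₀ ∧ z < t ∧ ¬ (X.mode δ om d z t).IsPending ∧
      κ ≤ cnt z t X.Ser ∧ r₀ - X.round z ≤ cnt z t X.Ser := by
  obtain ⟨j₀, i₀, hround, hacc, j, i, hj, hrev⟩ := h
  set C₀ := (X.job j₀ (Sum.inl i₀)).top with hC₀
  have hC₀v := (hX.adopts j₀ i₀).1
  unfold Accepts at hacc
  rw [hX.lenMax_eq, ← hC₀] at hacc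
  set L := C₀.length - κ with hL
  have hLlt : lenWithout (X.view j₀ i₀) T < L := by omega
  -- the common prefix contains the transaction
  have hpre : (C₀.trunc L).Contains T := by
    by_contra hno
    have := le_maxLength (p := fun C => ¬ C.Contains T) (hX.ser_view_of_trunc L hC₀v) hno
    rw [← hC₀, Chain.length_trunc _ (by omega)] at this
    unfold lenWithout at hLlt
    omega
  obtain ⟨D, hDv, hDT, hDl⟩ := exists_maxLength (p := fun C : Chain k Tx => ¬ C.Contains T)
    (hX.view_genesis j i) (fun h => h)
  have hDmax : (X.job j (Sum.inl i)).top.length ≤ D.length := by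
    by_cases hc : (X.job j (Sum.inl i)).top.Contains T
    · have h1 := le_maxLength (p := fun C => C.Contains T) (hX.adopts j i).1 hc
      unfold lenWith lenWithout at hrev
      omega
    · have h1 := le_maxLength (p := fun C => ¬ C.Contains T) (hX.adopts j i).1 hc
      omega
  -- The last base lower than `L` is used. Being lower than `L`, it leaves more than κ blocks of
  -- `C₀` to be mined after it; being the last, it excludes a later such base inside a clean period.
  let P : ℕ → Prop := fun z => X.Base z ∧ X.ht z < L
  have hP0 : P 0 := ⟨base_zero, by rw [hX.ht_zero]; omega⟩
  set z := Nat.findGreatest P j₀ with hz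
  have hPz : P z := Nat.findGreatest_spec (P := P) (Nat.zero_le j₀) hP0
  have hzj : z ≤ j₀ := Nat.findGreatest_le j₀
  have hzs := hPz.1.zeroStock hX
  have hN1 : κ + 1 ≤ cnt z j₀ X.Ser := by
    have h1 : ∀ l ∈ Finset.Ioc (X.ht z) C₀.length, ∃ i', (z ≤ i' ∧ i' < j₀) ∧ X.Ser i' ∧
        (X.tip i').length + 1 = l := by
      intro l hl
      rw [Finset.mem_Ioc] at hl
      obtain ⟨i', h2, h3, -, h4⟩ := hX.exists_ser_trunc (hX.top_exists j₀ (Sum.inl i₀))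
        (l := l) (by omega) hl.2
      refine ⟨i', ⟨?_, h2⟩, h3, h4⟩
      by_contra h5
      have := hzs.2 i' (by omega) h3
      omega
    choose! f hf using h1
    have h2 : (Finset.Ioc (X.ht z) C₀.length).card ≤ cnt z j₀ X.Ser := by
      rw [cnt_eq_card]
      refine Finset.card_le_card_of_injOn f (fun l hl => ?_) (fun l hl l' hl' hll => ?_)
      · have := hf l hl
        simp only [Finset.coe_filter, Finset.mem_Ico, Set.mem_ofPred_eq]
        exact ⟨this.1, this.2.1⟩
      · have h3 := (hf l hl).2.2
        have h4 := (hf l' hl').2.2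
        rw [hll] at h3
        omega
    rw [Nat.card_Ioc] at h2
    have := hPz.2
    omega
  have hr1 : X.round j₀ = X.round z + cnt z j₀ X.HonSer := by
    rw [round_eq, round_eq, cnt_split (Nat.zero_le z) hzj]
  have hN2 : cnt z j₀ X.HonSer ≤ cnt z j₀ X.Ser := cnt_mono fun _ _ _ h => h.2
  have hfin : ∀ t, j₀ ≤ t → ¬ (X.mode δ om d z t).IsPending →
      ∃ z t, X.Base z ∧ X.round z ≤ r₀ ∧ z < t ∧ ¬ (X.mode δ om d z t).IsPending ∧
        κ ≤ cnt z t X.Ser ∧ r₀ - X.round z ≤ cnt z t X.Ser := by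
    intro t h1 h2
    have h3 := cnt_split hzj h1 X.Ser
    refine ⟨z, t, hPz.1, by omega, ?_, h2, by omega, by omega⟩
    by_contra h4
    rw [show j₀ = z by omega, cnt_eq_zero fun i _ _ => by omega] at hN1
    omega
  by_cases hpend : (X.mode δ om d z j₀).IsPending
  swap
  · exact hfin j₀ le_rfl hpend
  obtain ⟨s, e, hse⟩ : ∃ s e, X.mode δ om d z j₀ = .pending s e := by
    cases hm : X.mode δ om d z j₀ with
    | idle => rw [hm] at hpend; exact hpend.elim
    | attempt s => rw [hm] at hpend; exact hpend.elim
    | pending s e => exact ⟨s, e, rfl⟩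
  by_cases hj' : X.mode δ om d z j = .pending s e
  swap
  · obtain ⟨t, h1, -, h3⟩ := exists_mode_not_pending hzj hj hse hj'
    exact hfin t h1 h3
  exfalso
  have hinv₀ := hX.modeInv (om := om) (d := d) z j₀
  have hinv := hX.modeInv (om := om) (d := d) z j
  rw [hse] at hinv₀
  rw [hj'] at hinv
  obtain ⟨h1, h2, h3, h4, h5, h6, h7⟩ := hinv
  have he₀ := hinv₀.2.1
  obtain ⟨b, hb, hbs, hbl⟩ := hX.exists_ser_ht (j := e) (l := X.ht s + 1) (by omega) (by omega)
  have hsb : s ≤ b := by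
    by_contra h8
    have := h3.2 b (by omega) hbs
    omega
  have hbl' : (X.tip b).length = X.ht s := by omega
  have hbase := h5.base hX h3 hsb hb hbs hbl'
  -- Otherwise the first block of the clean period gives the base `b + 1`, lower than `L`;
  -- maximality puts it at most at `z`, although `z ≤ s ≤ b`.
  have hLs : L ≤ X.ht s + 1 := by
    by_contra h8
    have h9 : P (b + 1) := by
      refine ⟨hbase, ?_⟩
      rw [hbase.ht_eq hX (by omega), Nat.add_sub_cancel]
      omega
    have h10 : b + 1 ≤ z := Nat.le_findGreatest (by omega) h9
    have h11 := (le_start (X := X) (δ := δ) (om := om) (d := d) z j s).2 e hj'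
    omega
  have hC := hX.settled ht hw h3 h4 h5 h6 hsb hb hbs hbl' j₀ he₀.le
    (fun t' h8 h9 => h7 t' h8 (by omega)) C₀ (hX.top_exists j₀ _)
    (fun j' h8 h9 => hX.ht_le_of_late h8 h9 i₀)
  have hDD := hX.settled ht hw h3 h4 h5 h6 hsb hb hbs hbl' j h2.le h7 D
    (hX.view_exists j i _ hDv)
    (fun j' h8 h9 => (hX.ht_le_of_late h8 h9 i).trans hDmax)
  -- Both chains are competitive in their own views, so both contain the settled block. They agree
  -- up to its length and a fortiori up to `L`.
  have h15 : D.trunc L = C₀.trunc L := by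
    rw [← Chain.trunc_trunc hLs D, ← Chain.trunc_trunc hLs C₀, hC, hDD]
  rw [← h15] at hpre
  exact hDT hpre.of_trunc

end Trace
end Trace
end Interlude

/-! ### Constants, and drift estimates for a single ring. -/

namespace Interlude

section Constants

/-- The work for a parallel block in units of the work for a series block. -/
noncomputable def Params.om (P : Params) : ℝ := P.β / P.lam

/-- The probability that a ring is the series clock of an honest party. -/
noncomputable def Params.rinv (P : Params) : ℝ :=
  P.n * P.β / ((P.n + P.m) * (P.lam + P.β))

/-- The charge at a special index in `advSum`. -/
noncomputable def Params.d (P : Params) : ℝ := 8 / 5 * (P.β * P.δ + P.rinv)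

/-- The charge at a special index in `progSum`. -/
noncomputable def Params.fd (P : Params) : ℝ := 2 * (P.β * P.δ + 2 * P.rinv) + 3 / 50

/-- The total rate of all clocks. -/
noncomputable def Params.rate (P : Params) : ℝ := ((P.n : ℝ) + P.m) * (P.lam / P.n + P.β / P.n)

/-- The probability that a ring is of the given kind. -/
noncomputable def Params.kindProb (P : Params) (b : Bool) : ℝ :=
  if b then P.β / (P.lam + P.β) else P.lam / (P.lam + P.β)

/-- The probability of the mark of a ring. -/
noncomputable def Params.markProb (P : Params) (b : Bool) : ℝ :=
  1 / ((P.n : ℝ) + P.m) * P.kindProb b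

/-- The exponent of the potential. -/
noncomputable def eta : ℝ := Real.exp (-160)

/-- The decay rate per series block. -/
noncomputable def decay : ℝ := eta / 100

theorem eta_pos : 0 < eta := Real.exp_pos _

theorem decay_pos : 0 < decay := div_pos eta_pos (by norm_num)

theorem exp_neg_eq : Real.exp (-150) = Real.exp 10 * eta := by
  rw [eta, ← Real.exp_add]; norm_num

theorem two_pow_le_exp (j : ℕ) : (2 : ℝ) ^ j ≤ Real.exp j := by
  have h1 : (2 : ℝ) ≤ Real.exp 1 := by have := Real.add_one_le_exp (1 : ℝ); linarith
  calc (2 : ℝ) ^ j ≤ Real.exp 1 ^ j := pow_le_pow_left₀ (by norm_num) h1 j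
    _ = Real.exp j := by rw [← Real.exp_nat_mul, mul_one]

/-- The correction term of an attempt is at least e^(−150); this makes it dominate the losses at
resets, which are a few `eta`. -/
theorem mul_eta_le : 1000 * eta ≤ Real.exp (-150) := by
  rw [exp_neg_eq]
  have := two_pow_le_exp 10
  push_cast at this
  exact mul_le_mul_of_nonneg_right (by linarith) eta_pos.le

theorem eta_le : eta ≤ 1 / 1000000 := by
  have h1 := two_pow_le_exp 20
  push_cast at h1
  have h2 : eta ≤ Real.exp (-20) := Real.exp_le_exp.2 (by norm_num)
  rw [Real.exp_neg] at h2
  refine h2.trans ?_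
  rw [one_div]
  exact inv_anti₀ (by norm_num) (by linarith)

variable {P : Params}

namespace Params.Admissible

theorem n_pos_real (hP : P.Admissible) : (0 : ℝ) < P.n := Nat.cast_pos.2 hP.n_pos

theorem om_pos (hP : P.Admissible) : 0 < P.om := div_pos hP.β_pos hP.lam_pos

theorem delay_nonneg (hP : P.Admissible) : 0 ≤ P.β * P.δ := mul_nonneg hP.β_pos.le hP.δ_nonneg

/-- This is the assumption k/λ < 1/β − δ, multiplied by β. -/
theorem k_mul_om_le (hP : P.Admissible) : P.k * P.om ≤ 1 := by
  have h1 := mul_le_mul_of_nonneg_right hP.series_slow.le hP.β_pos.le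
  have h2 : (1 / P.β - P.δ) * P.β = 1 - P.β * P.δ := by
    have := hP.β_pos.ne'
    field_simp
  have h3 := hP.delay_nonneg
  have h4 : (P.k : ℝ) * P.om = P.k / P.lam * P.β := by unfold Params.om; ring
  linarith

theorem om_le (hP : P.Admissible) : P.om ≤ 1 / 100 := by
  have h1 := hP.k_mul_om_le
  have h2 : (100 : ℝ) ≤ P.k := by exact_mod_cast hP.many_subchains.le
  have h3 := mul_le_mul_of_nonneg_right h2 hP.om_pos.le
  linarith

theorem delay_le (hP : P.Admissible) : P.β * P.δ ≤ 1 / 20 := by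
  have h1 := mul_le_mul_of_nonneg_left hP.delay_small.le hP.β_pos.le
  rw [mul_one_div_cancel hP.β_pos.ne'] at h1
  linarith

theorem kindProb_pos (hP : P.Admissible) (b : Bool) : 0 < P.kindProb b := by
  have := hP.lam_pos
  have := hP.β_pos
  unfold Params.kindProb
  split_ifs <;> positivity

theorem kindProb_add (hP : P.Admissible) : P.kindProb false + P.kindProb true = 1 := by
  have := hP.lam_pos
  have := hP.β_pos
  simp only [Params.kindProb, if_true, Bool.false_eq_true, if_false]
  field_simp

/-- The weight `om` makes a ring worth the same on average for both kinds of work, so the drift does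
not depend on which block a party chooses to mine. -/
theorem kindProb_mul_om (hP : P.Admissible) : P.kindProb false * P.om = P.kindProb true := by
  have := hP.lam_pos
  have := hP.β_pos
  simp only [Params.kindProb, Params.om, if_true, Bool.false_eq_true, if_false]
  field_simp

theorem rinv_eq (P : Params) : P.rinv = P.n / (P.n + P.m) * P.kindProb true := by
  simp only [Params.kindProb, Params.rinv, if_true]
  rw [div_mul_div_comm]

theorem rinv_pos (hP : P.Admissible) : 0 < P.rinv := by
  rw [rinv_eq]
  have := hP.n_pos_real
  have := hP.kindProb_pos true
  positivity

theorem rinv_le (hP : P.Admissible) : P.rinv ≤ 1 / 100 := by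
  rw [rinv_eq, ← hP.kindProb_mul_om]
  have h1 := hP.n_pos_real
  have h2 := hP.kindProb_add
  have h3 := hP.kindProb_pos true
  have h4 := hP.kindProb_pos false
  have h5 : (P.n : ℝ) / (P.n + P.m) ≤ 1 := by
    rw [div_le_one (by positivity)]
    have : (0 : ℝ) ≤ P.m := Nat.cast_nonneg _
    linarith
  have h6 : P.kindProb false * P.om ≤ 1 * (1 / 100) :=
    mul_le_mul (by linarith) hP.om_le hP.om_pos.le (by norm_num)
  calc _ ≤ 1 * (P.kindProb false * P.om) :=
        mul_le_mul_of_nonneg_right h5 (mul_nonneg h4.le hP.om_pos.le)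
    _ ≤ _ := by linarith

theorem rate_pos (hP : P.Admissible) : 0 < P.rate := by
  have := hP.n_pos_real
  have := hP.lam_pos
  have := hP.β_pos
  unfold Params.rate
  positivity

theorem div_rate (hP : P.Admissible) : P.β / P.rate = P.rinv := by
  have := hP.n_pos_real
  have := hP.lam_pos
  have := hP.β_pos
  unfold Params.rate Params.rinv
  field_simp

theorem m_le (hP : P.Admissible) : (P.m : ℝ) ≤ P.n / 2 := by
  have h := hP.minority
  unfold Params.α at h
  rw [div_lt_iff₀ hP.n_pos_real] at h
  linarith

theorem d_nonneg (hP : P.Admissible) : 0 ≤ P.d := by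
  have := hP.delay_nonneg
  have := hP.rinv_pos
  unfold Params.d
  linarith

theorem weights (hP : P.Admissible) : Trace.Weights P.k P.om P.d where
  k_pos := by have := hP.many_subchains; omega
  om_pos := hP.om_pos
  mul_le := hP.k_mul_om_le
  d_nonneg := hP.d_nonneg
  d_le := by
    have := hP.delay_le
    have := hP.rinv_le
    unfold Params.d
    linarith

theorem fd_nonneg (hP : P.Admissible) : 0 ≤ P.fd := by
  have := hP.delay_nonneg
  have := hP.rinv_pos
  unfold Params.fd
  linarith

theorem fd_le (hP : P.Admissible) : P.fd ≤ 1 / 5 := by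
  have := hP.delay_le
  have := hP.rinv_le
  unfold Params.fd
  linarith

end Params.Admissible

/-! ### Averages over the mark of a ring -/

/-- A bound on the factor by which the main term of the potential changes at a ring. `prod` says
whether the honest parties are synchronized, and `ser` whether the party mines a series block. -/
noncomputable def gainFac (om τ σ : ℝ) (prod : Bool) {n m : ℕ} (p : Party n m) (ser b : Bool) : ℝ :=
  if ser = b then
    if p.isLeft then
      if b then (if prod then Real.exp (-(57 / 100 * τ) + decay) else Real.exp (σ + decay))
      else (if prod then Real.exp (-(57 / 100 * τ * om)) else 1)
    else if b then Real.exp (σ + decay) else Real.exp (σ * om)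
  else 1

/-- A bound on the factor by which the correction term of the potential changes at a ring. -/
noncomputable def progFac (om : ℝ) (prod : Bool) {n m : ℕ} (p : Party n m) (ser b : Bool) : ℝ :=
  if ser = b then
    if p.isLeft then
      if b then (if prod then Real.exp 1 else 0) else (if prod then Real.exp om else 1)
    else if b then 0 else 1
  else 1

theorem gainFac_pos (om τ σ : ℝ) (prod : Bool) {n m : ℕ} (p : Party n m) (ser b : Bool) :
    0 < gainFac om τ σ prod p ser b := by
  unfold gainFac
  split_ifs <;> first | exact Real.exp_pos _ | exact one_pos

theorem progFac_nonneg (om : ℝ) (prod : Bool) {n m : ℕ} (p : Party n m) (ser b : Bool) :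
    0 ≤ progFac om prod p ser b := by
  unfold progFac
  split_ifs <;> positivity

theorem exp_sub_one_le {y : ℝ} (h0 : 0 ≤ y) (h1 : y ≤ 1) : Real.exp y - 1 ≤ y * (1 + y) := by
  have := Real.abs_exp_sub_one_sub_id_le (x := y) (by rw [abs_of_nonneg h0]; exact h1)
  have := (abs_le.1 this).2
  nlinarith

theorem exp_neg_sub_one_le {y : ℝ} (h0 : 0 ≤ y) : Real.exp (-y) - 1 ≤ -(y * (1 - y)) := by
  have h1 := Real.add_one_le_exp y
  have h2 := Real.exp_pos (-y)
  have h3 : Real.exp (-y) * Real.exp y = 1 := by rw [← Real.exp_add]; simp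
  have h4 : Real.exp (-y) * (1 + y) ≤ 1 := by nlinarith
  nlinarith [mul_nonneg h0 h0, mul_nonneg (mul_nonneg h0 h0) h2.le]

variable {τ σ : ℝ}

/-- The exponent of a series block is at most 1.01·τ ≤ 101/2000, so e^y − 1 ≤ y(1 + y) gives
1.01·1.0505 < 1.062. A parallel block has an even smaller second-order term. -/
theorem kind_gain_adv (hP : P.Admissible) (hτ : 0 < τ) (hτ' : τ ≤ 1 / 20) (hσ : 0 ≤ σ)
    (hστ : σ + decay ≤ 101 / 100 * τ) (prod ser : Bool) {n m : ℕ} (a : Fin m) :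
    ∑ b, P.kindProb b * gainFac P.om τ σ prod (Sum.inr a : Party n m) ser b ≤
      1 + 1062 / 1000 * τ * P.kindProb true := by
  have h1 := hP.kindProb_add
  have h2 := hP.kindProb_mul_om
  have h3 := hP.kindProb_pos true
  have h4 := hP.kindProb_pos false
  have hom := hP.om_pos
  have hom' := hP.om_le
  have hd := decay_pos
  rw [Fintype.sum_bool]
  cases ser
  · simp only [gainFac, Bool.false_eq_true, if_false, if_true, Sum.isLeft_inr]
    have h5 := exp_sub_one_le (y := σ * P.om) (by positivity) (by nlinarith)
    have h6 : σ * P.om ≤ 101 / 100 * τ * P.om := mul_le_mul_of_nonneg_right (by linarith) hom.le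
    have h7 : σ * P.om * (1 + σ * P.om) ≤ 1062 / 1000 * τ * P.om := by
      have h8 : σ * P.om ≤ 1 / 100 := by nlinarith
      have h9 := mul_le_mul h6 (show 1 + σ * P.om ≤ 101 / 100 by linarith) (by positivity)
        (by positivity)
      nlinarith [mul_pos hτ hom]
    have h8 := mul_le_mul_of_nonneg_left (h5.trans h7) h4.le
    have h9 : P.kindProb false * (1062 / 1000 * τ * P.om) = 1062 / 1000 * τ * P.kindProb true := by
      rw [← h2]; ring
    linarith
  · simp only [gainFac, Bool.false_eq_true, if_false, if_true, Sum.isLeft_inr,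
      reduceCtorEq]
    have h5 := exp_sub_one_le (y := σ + decay) (by linarith) (by linarith)
    have h7 : (σ + decay) * (1 + (σ + decay)) ≤ 1062 / 1000 * τ := by
      have : σ + decay ≤ 101 / 2000 := by linarith
      nlinarith
    have h8 := mul_le_mul_of_nonneg_left (h5.trans h7) h3.le
    linarith

/-- Of the weight 57/100, at most 1/100 goes to the reward `decay`; the second-order term then
leaves 54/100. Out of synchronization an honest series block counts like an adversarial one. -/
theorem kind_gain_hon (hP : P.Admissible) (hτ : 0 < τ) (hτ' : τ ≤ 1 / 20) (hσ : 0 ≤ σ)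
    (hστ : σ + decay ≤ 101 / 100 * τ) (hd : decay ≤ τ / 100) (prod ser : Bool) {n m : ℕ}
    (a : Fin n) :
    ∑ b, P.kindProb b * gainFac P.om τ σ prod (Sum.inl a : Party n m) ser b ≤
      1 + (if prod then -(54 / 100) else 1062 / 1000) * τ * P.kindProb true := by
  have h1 := hP.kindProb_add
  have h2 := hP.kindProb_mul_om
  have h3 := hP.kindProb_pos true
  have h4 := hP.kindProb_pos false
  have hom := hP.om_pos
  have hom' := hP.om_le
  have hd0 := decay_pos
  rw [Fintype.sum_bool]
  cases ser <;> cases prod <;>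
    simp only [gainFac, Bool.false_eq_true, if_false, if_true, Sum.isLeft_inl, reduceCtorEq]
  · have := mul_pos hτ h3
    linarith
  · have h5 := exp_neg_sub_one_le (y := 57 / 100 * τ * P.om) (by positivity)
    have h7 : 54 / 100 * τ * P.om ≤ 57 / 100 * τ * P.om * (1 - 57 / 100 * τ * P.om) := by
      have h8 : 57 / 100 * τ * P.om ≤ 57 / 200000 := by nlinarith
      nlinarith [mul_pos hτ hom]
    have h8 := mul_le_mul_of_nonneg_left (h5.trans (neg_le_neg h7)) h4.le
    have h9 : P.kindProb false * (-(54 / 100 * τ * P.om)) = -(54 / 100) * τ * P.kindProb true := by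
      rw [← h2]; ring
    linarith
  · have h5 := exp_sub_one_le (y := σ + decay) (by linarith) (by linarith)
    have h7 : (σ + decay) * (1 + (σ + decay)) ≤ 1062 / 1000 * τ := by
      have : σ + decay ≤ 101 / 2000 := by linarith
      nlinarith
    have h8 := mul_le_mul_of_nonneg_left (h5.trans h7) h3.le
    linarith
  · have h5 := exp_neg_sub_one_le (y := 57 / 100 * τ - decay) (by linarith)
    rw [neg_sub] at h5
    rw [neg_add_eq_sub]
    have h7 : 54 / 100 * τ ≤ (57 / 100 * τ - decay) * (1 - (57 / 100 * τ - decay)) := by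
      have h8 : 56 / 100 * τ ≤ 57 / 100 * τ - decay := by linarith
      have h9 : 57 / 100 * τ - decay ≤ 57 / 2000 := by linarith
      nlinarith
    have h8 := mul_le_mul_of_nonneg_left (h5.trans (neg_le_neg h7)) h3.le
    linarith

/-- The adversarial parties number at most n/2, so their contribution enters with weight one half.
-/
theorem sum_party_le (hP : P.Admissible) (f : Party P.n P.m → ℝ) (x y : ℝ)
    (hx : ∀ a, f (Sum.inl a) ≤ 1 + x * P.kindProb true)
    (hy : ∀ a, f (Sum.inr a) ≤ 1 + y * P.kindProb true) (hy0 : 0 ≤ y) :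
    1 / ((P.n : ℝ) + P.m) * ∑ p, f p ≤ 1 + (x + y / 2) * P.rinv := by
  have hn := hP.n_pos_real
  have hm : (0 : ℝ) ≤ P.m := Nat.cast_nonneg _
  rw [Fintype.sum_sum_type]
  have h1 := Finset.sum_le_card_nsmul Finset.univ (fun a => f (Sum.inl a)) _ fun a _ => hx a
  have h2 := Finset.sum_le_card_nsmul Finset.univ (fun a => f (Sum.inr a)) _ fun a _ => hy a
  simp only [Finset.card_univ, Fintype.card_fin, nsmul_eq_mul] at h1 h2
  have hm2 := hP.m_le
  have hq := hP.kindProb_pos true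
  rw [Params.Admissible.rinv_eq, one_div, inv_mul_le_iff₀ (by positivity)]
  have h3 : ((P.n : ℝ) + P.m) * (1 + (x + y / 2) * (P.n / (P.n + P.m) * P.kindProb true)) =
      P.n + P.m + (x + y / 2) * P.n * P.kindProb true := by
    field_simp
  rw [h3]
  have h4 := mul_le_mul_of_nonneg_right hm2 (mul_nonneg hy0 hq.le)
  nlinarith

/-- The drift is −0.54 + 1.062/2 < 0 in synchronization and 1.062 + 1.062/2 < 8/5 otherwise. This is
where α < 1/2 decides. -/
theorem mark_gain (hP : P.Admissible) (hτ : 0 < τ) (hτ' : τ ≤ 1 / 20) (hσ : 0 ≤ σ)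
    (hστ : σ + decay ≤ 101 / 100 * τ) (hd : decay ≤ τ / 100) (prod : Bool)
    (ser : Party P.n P.m → Bool) :
    ∑ p, ∑ b, P.markProb b * gainFac P.om τ σ prod p (ser p) b ≤
      1 + if prod then 0 else 8 / 5 * τ * P.rinv := by
  have h1 := sum_party_le hP
    (fun p => ∑ b, P.kindProb b * gainFac P.om τ σ prod p (ser p) b)
    ((if prod then -(54 / 100) else 1062 / 1000) * τ) (1062 / 1000 * τ)
    (fun a => kind_gain_hon hP hτ hτ' hσ hστ hd prod _ a)
    (fun a => kind_gain_adv hP hτ hτ' hσ hστ prod _ a) (by positivity)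
  have hr := mul_pos hτ hP.rinv_pos
  simp only [Finset.mul_sum, ← mul_assoc] at h1
  simp only [Params.markProb]
  refine h1.trans ?_
  cases prod <;> simp only [Bool.false_eq_true, if_false, if_true] <;> linarith

/-- In synchronization the growth e − 1 ≥ 1 from an honest series block outweighs the risk that an
adversarial one ends the attempt. Otherwise the risk is at most 3/2 of `rinv`. -/
theorem mark_prog (hP : P.Admissible) (prod : Bool) (ser : Party P.n P.m → Bool) :
    1 - (if prod then 0 else 2 * P.rinv) ≤
      ∑ p, ∑ b, P.markProb b * progFac P.om prod p (ser p) b := by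
  have h1 := hP.kindProb_add
  have h2 := hP.kindProb_mul_om
  have h3 := hP.kindProb_pos true
  have h4 := hP.kindProb_pos false
  have hom := hP.om_pos
  have he : 1 ≤ Real.exp 1 - 1 := by have := Real.add_one_le_exp (1 : ℝ); linarith
  have he' : P.om ≤ Real.exp P.om - 1 := by have := Real.add_one_le_exp P.om; linarith
  have h5 := mul_le_mul_of_nonneg_left he h3.le
  have h6 := mul_le_mul_of_nonneg_left he' h4.le
  -- Passing to 2 minus the mean factor turns the lower bound into an upper bound covered by
  -- `sum_party_le`.
  have h7 := sum_party_le hP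
    (fun p => 2 - ∑ b, P.kindProb b * progFac P.om prod p (ser p) b)
    (if prod then -1 else 1) 1
    (fun a => by
      simp only [Fintype.sum_bool]
      cases ser (Sum.inl a) <;> cases prod <;>
        simp only [progFac, Bool.false_eq_true, if_false, if_true, Sum.isLeft_inl, reduceCtorEq] <;>
        linarith)
    (fun a => by
      simp only [Fintype.sum_bool]
      cases ser (Sum.inr a) <;>
        simp only [progFac, Bool.false_eq_true, if_false, if_true, Sum.isLeft_inr, reduceCtorEq] <;>
        linarith) zero_le_one
  have hn := hP.n_pos_real
  have hm : (0 : ℝ) ≤ P.m := Nat.cast_nonneg _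
  have h8 : 1 / ((P.n : ℝ) + P.m) * ∑ p : Party P.n P.m, (2 : ℝ) = 2 := by
    simp only [Finset.sum_const, Finset.card_univ, Fintype.card_sum, Fintype.card_fin,
      nsmul_eq_mul, Nat.cast_add]
    field_simp
  rw [Finset.sum_sub_distrib, mul_sub, h8] at h7
  simp only [Finset.mul_sum, ← mul_assoc] at h7
  have hr := hP.rinv_pos
  simp only [Params.markProb]
  cases prod <;> simp only [Bool.false_eq_true, if_false, if_true] at h7 ⊢ <;> linarith

end Constants
end Interlude

/-! ### The potential, and its change due to the mark of a ring. -/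

namespace Interlude

section Potential

open scoped Classical

namespace Mode

/-- The rate at which the potential grows with the advantage of the adversary. -/
noncomputable def rate : Mode → ℝ
  | .pending _ _ => 1 / 20
  | _ => eta

/-- The rate at which the potential grows with the blocks of the adversary. -/
noncomputable def gainRate : Mode → ℝ
  | .pending _ _ => 1 / 20 + eta
  | _ => eta

theorem rate_pos (M : Mode) : 0 < M.rate := by
  cases M <;> simp only [rate] <;> first | exact eta_pos | norm_num

theorem rate_le (M : Mode) : M.rate ≤ 1 / 20 := by
  have := eta_le
  cases M <;> simp only [rate] <;> linarith

theorem eta_le_rate (M : Mode) : eta ≤ M.rate := by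
  have := eta_le
  cases M <;> simp only [rate] <;> linarith

theorem gainRate_nonneg (M : Mode) : 0 ≤ M.gainRate := by
  have := eta_pos
  cases M <;> simp only [gainRate] <;> linarith

theorem gainRate_add_le (M : Mode) : M.gainRate + decay ≤ 101 / 100 * M.rate := by
  have := eta_pos
  have := eta_le
  unfold decay
  cases M <;> simp only [gainRate, rate] <;> linarith

end Mode

namespace Trace

variable {P : Params} {Tx : Type*} (X : Trace P.n P.m P.k Tx)

/-- The last zero-stock switch up to `t`. -/
noncomputable def lastZs (t : ℕ) : ℕ := Nat.findGreatest X.ZeroStock t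

/-- The blocks that may help the adversary, in units of series blocks. -/
noncomputable def gain (i : ℕ) : ℝ :=
  (if X.AdvSer i then 1 else 0) + (if X.AdvPar i then P.om else 0) +
    (if X.ExtraSer P.δ i then 1 else 0)

noncomputable def gainSum (e t : ℕ) : ℝ := ∑ i ∈ Finset.Ico e t, X.gain i

/-- The exponent of the main term of the potential. -/
noncomputable def expo (z t : ℕ) : Mode → ℝ
  | .pending _ e => 1 / 20 * (X.advSum P.δ P.om P.d e t - 56) + eta * X.gainSum e t
  | _ => eta * (X.advSum P.δ P.om P.d z t + 57 / 100 * (P.k * P.om) * X.sib z)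

/-- The correction term of the potential. -/
noncomputable def corr (t : ℕ) : Mode → ℝ
  | .attempt s => Real.exp (-150 + X.progSum P.δ P.om P.fd s t)
  | _ => 0

/-- The time after ring `t` until the honest parties are synchronized. -/
noncomputable def lag (t : ℕ) : ℝ := max 0 (X.time (X.lastSp t) + P.δ - X.time t)

/-- `1` at a special index. -/
noncomputable def sp (t : ℕ) : ℝ := if X.Special t then 1 else 0

/-- The mode of the bookkeeping that starts at `z`. -/
noncomputable abbrev md (z t : ℕ) : Mode := X.mode P.δ P.om P.d z t

/-- The mode just before ring `t`. -/
noncomputable abbrev mdPre (z t : ℕ) : Mode := X.updMode t (X.md z t)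

/-- The discount for the series blocks mined. -/
noncomputable def disc (z t : ℕ) : ℝ := Real.exp (decay * cnt z t X.Ser)

/-- The potential after the rings before `t`. -/
noncomputable def pot (z t : ℕ) : ℝ :=
  X.disc z t * (Real.exp (X.expo (X.lastZs (t - 1)) t (X.md z t)) *
      Real.exp (8 / 5 * (X.md z t).rate * P.β * X.lag (t - 1)) -
    X.corr t (X.md z t) * Real.exp (-(2 * P.β * X.lag (t - 1))))

/-- The main term of the potential just before ring `t`. -/
noncomputable def preMain (z t : ℕ) : ℝ :=
  X.disc z t * (Real.exp (X.expo (X.lastZs t) t (X.mdPre z t) - (X.mdPre z t).rate * P.d * X.sp t) *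
    Real.exp (8 / 5 * (X.mdPre z t).rate * P.β * X.lag t))

/-- The correction term of the potential just before ring `t`. -/
noncomputable def preCorr (z t : ℕ) : ℝ :=
  X.disc z t * (X.corr t (X.mdPre z t) * Real.exp (P.fd * X.sp t) *
    Real.exp (-(2 * P.β * X.lag t)))

variable {X}

theorem zeroStock_zero : X.ZeroStock 0 := ⟨Or.inl rfl, fun i hi => by omega⟩

theorem zeroStock_lastZs (t : ℕ) : X.ZeroStock (X.lastZs t) :=
  Nat.findGreatest_spec (P := X.ZeroStock) (Nat.zero_le t) zeroStock_zero

theorem lastZs_le (t : ℕ) : X.lastZs t ≤ t := Nat.findGreatest_le t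

theorem not_zeroStock_of_lastZs_lt {i t : ℕ} (h : X.lastZs t < i) (hi : i ≤ t) :
    ¬ X.ZeroStock i := Nat.findGreatest_is_greatest h hi

theorem ZeroStock.lastZs_eq {t : ℕ} (h : X.ZeroStock t) : X.lastZs t = t := Nat.findGreatest_eq h

theorem lastZs_of_not {t : ℕ} (ht : 0 < t) (h : ¬ X.ZeroStock t) :
    X.lastZs t = X.lastZs (t - 1) := by
  obtain ⟨t, rfl⟩ := Nat.exists_eq_succ_of_ne_zero ht.ne'
  exact Nat.findGreatest_of_not h

theorem lag_nonneg (t : ℕ) : 0 ≤ X.lag t := le_max_left _ _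

theorem disc_pos (z t : ℕ) : 0 < X.disc z t := Real.exp_pos _

theorem corr_nonneg (t : ℕ) (M : Mode) : 0 ≤ X.corr t M := by
  cases M <;> simp only [corr] <;> first | exact le_rfl | exact (Real.exp_pos _).le

theorem advSum_succ {e t : ℕ} (h : e ≤ t) :
    X.advSum P.δ P.om P.d e (t + 1) = X.advSum P.δ P.om P.d e t + X.adv P.δ P.om P.d t :=
  Finset.sum_Ico_succ_top h _

theorem gainSum_succ {e t : ℕ} (h : e ≤ t) : X.gainSum e (t + 1) = X.gainSum e t + X.gain t :=
  Finset.sum_Ico_succ_top h _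

theorem progSum_succ {e t : ℕ} (h : e ≤ t) : X.progSum P.δ P.om P.fd e (t + 1) =
    X.progSum P.δ P.om P.fd e t + X.prog P.δ P.om P.fd t :=
  Finset.sum_Ico_succ_top h _

theorem cnt_succ {z t : ℕ} (h : z ≤ t) (p : ℕ → Prop) :
    (cnt z (t + 1) p : ℝ) = cnt z t p + if p t then 1 else 0 := by
  have h1 := sum_ite_eq_mul_cnt z (t + 1) p 1
  have h2 := sum_ite_eq_mul_cnt z t p 1
  rw [Finset.sum_Ico_succ_top h, h2] at h1
  linarith

theorem disc_succ {z t : ℕ} (h : z ≤ t) :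
    X.disc z (t + 1) = X.disc z t * Real.exp (decay * if X.Ser t then 1 else 0) := by
  unfold disc
  rw [cnt_succ h, mul_add, Real.exp_add]

theorem prog_nonneg (hP : P.Admissible) (i : ℕ) : 0 ≤ X.prog P.δ P.om P.fd i := by
  have := hP.om_pos
  have := hP.fd_nonneg
  unfold prog
  positivity

theorem adv_le_gain (hP : P.Admissible) (i : ℕ) : X.adv P.δ P.om P.d i ≤ X.gain i := by
  have := hP.om_pos
  have := hP.d_nonneg
  have h1 : 0 ≤ if X.ProdPar P.δ i then 57 / 100 * P.om else 0 := by positivity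
  have h2 : (0 : ℝ) ≤ if X.ProdSer P.δ i then 57 / 100 else 0 := by positivity
  have h3 : (if X.Special i then -P.d else 0) ≤ 0 := by split_ifs <;> linarith
  unfold adv gain
  linarith

/-- This links the finite table `gainFac`, over which means are taken, to the increments of the
exponent. The charge at a special index is added back, being fixed before the mark and already
contained in `preMain`. -/
theorem gainFac_eq (t : ℕ) (τ σ : ℝ) :
    gainFac P.om τ σ (decide (X.Prod P.δ t)) (X.party t) (X.job t (X.party t)).isSer (X.kind t) =
      Real.exp (τ * (X.adv P.δ P.om P.d t + P.d * X.sp t) + (σ - τ) * X.gain t +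
        decay * if X.Ser t then 1 else 0) := by
  unfold gainFac adv gain sp
  unfold AdvSer AdvPar ProdPar ProdSer ExtraSer HonSer Hon Ser Par jobAt
  by_cases hsp : X.Special t
  · have hp : ¬ X.Prod P.δ t := fun h => h.not_special hsp
    cases X.party t <;> cases (X.job t _).isSer <;> cases X.kind t <;>
      simp [hsp, hp] <;> ring_nf
  · by_cases hp : X.Prod P.δ t <;>
    cases X.party t <;> cases (X.job t _).isSer <;> cases X.kind t <;>
      simp [hsp, hp] <;> ring_nf

theorem progFac_eq_zero {t : ℕ} (h : X.AdvSer t ∨ X.ExtraSer P.δ t) :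
    progFac P.om (decide (X.Prod P.δ t)) (X.party t) (X.job t (X.party t)).isSer (X.kind t) = 0 := by
  unfold progFac
  unfold AdvSer ExtraSer HonSer Hon Ser jobAt at h
  cases hp : X.party t <;> rw [hp] at h <;> cases hs : (X.job t _).isSer <;> rw [hs] at h <;>
    cases hk : X.kind t <;> rw [hk] at h <;> simp_all

theorem progFac_le (hP : P.Admissible) (t : ℕ) :
    progFac P.om (decide (X.Prod P.δ t)) (X.party t) (X.job t (X.party t)).isSer (X.kind t) ≤
      Real.exp (X.prog P.δ P.om P.fd t - P.fd * X.sp t) := by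
  have hom := hP.om_pos
  unfold progFac prog sp
  unfold ProdPar ProdSer HonSer Hon Ser Par jobAt
  by_cases hsp : X.Special t
  · have hp : ¬ X.Prod P.δ t := fun h => h.not_special hsp
    cases X.party t <;> cases (X.job t _).isSer <;> cases X.kind t <;>
      simp [hsp, hp]
  · by_cases hp : X.Prod P.δ t <;>
    cases X.party t <;> cases (X.job t _).isSer <;> cases X.kind t <;>
      simp [hsp, hp]

/-- After a clean period, the advantage since the last zero-stock switch is due to new blocks. -/
theorem expo_idle_le_gainSum (hP : P.Admissible) {s e t : ℕ} (hs : X.ZeroStock s)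
    (he : X.ZeroStock e) (hc : X.Clean P.δ s e) (hse : s ≤ e) (hlt : X.ht s < X.ht e) (het : e ≤ t)
    (hX : X.Follows P.δ) :
    X.advSum P.δ P.om P.d (X.lastZs t) (t + 1) + 57 / 100 * (P.k * P.om) * X.sib (X.lastZs t) ≤
      X.gainSum e (t + 1) := by
  set z := X.lastZs t with hz
  have hez : e ≤ z := Nat.le_findGreatest het he
  have hzt : z ≤ t := lastZs_le t
  have h1 : X.advSum P.δ P.om P.d z (t + 1) ≤ X.gainSum z (t + 1) :=
    Finset.sum_le_sum fun i _ => adv_le_gain hP i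
  have h2 : X.gainSum e (t + 1) = X.gainSum e z + X.gainSum z (t + 1) :=
    (Finset.sum_Ico_consecutive _ hez (by omega)).symm
  have h3 : (X.sib z : ℝ) ≤ X.gainSum e z := by
    -- The siblings at `z` were mined since `e`: at `e` itself there are none, by cleanliness, and
    -- before `e` no block lies above its height.
    have h4 : (X.sib z : ℝ) ≤ (cnt e z X.AdvSer : ℝ) := by
      rcases Nat.eq_or_lt_of_le hez with h | h
      · rw [← h, hc.sib_eq_zero hs hse hlt]; simp
      · have hzs : X.ZeroStock z := zeroStock_lastZs t
        have hlt' : X.ht e < X.ht z := by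
          rcases hzs.1 with h0 | h0
          · omega
          · exact lt_of_le_of_lt (hX.ht_mono (by omega)) h0
        unfold sib
        rw [he.cnt_advSer_eq hez hlt']
        have h5 : (cnt e z fun i => X.AdvSer i ∧ (X.tip i).length + 1 = X.ht z) ≤
            cnt e z X.AdvSer := cnt_mono fun i _ _ h => h.1
        exact_mod_cast h5
    refine h4.trans ?_
    have h5 := sum_ite_eq_mul_cnt e z X.AdvSer 1
    rw [one_mul] at h5
    rw [← h5]
    refine Finset.sum_le_sum fun i _ => ?_
    have hom := hP.om_pos
    have h6 : 0 ≤ if X.AdvPar i then P.om else 0 := by positivity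
    have h7 : (0 : ℝ) ≤ if X.ExtraSer P.δ i then 1 else 0 := by positivity
    unfold gain
    linarith
  have h4 := hP.k_mul_om_le
  have h5 : (0 : ℝ) ≤ P.k * P.om := mul_nonneg (Nat.cast_nonneg _) hP.om_pos.le
  have h6 : (0 : ℝ) ≤ X.sib z := Nat.cast_nonneg _
  have h7 := mul_le_mul_of_nonneg_right h4 h6
  nlinarith

/-- The change of the potential due to the mark of ring `t`. -/
theorem Follows.pot_succ_le (hP : P.Admissible) (hX : X.Follows P.δ) {z t : ℕ} (hzt : z ≤ t) :
    X.pot z (t + 1) +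
      X.preCorr z t * progFac P.om (decide (X.Prod P.δ t)) (X.party t)
        (X.job t (X.party t)).isSer (X.kind t) ≤
      X.preMain z t * gainFac P.om (X.mdPre z t).rate (X.mdPre z t).gainRate
        (decide (X.Prod P.δ t)) (X.party t) (X.job t (X.party t)).isSer (X.kind t) := by
  have hinv : X.ModeInvPre P.δ P.om P.d t (X.mdPre z t) := (hX.modeInv z t).upd hX
  have hmd : X.md z (t + 1) = X.markMode P.δ P.om P.d t (X.mdPre z t) := mode_succ hzt
  unfold pot preCorr preMain
  rw [hmd, disc_succ hzt, Nat.add_sub_cancel, gainFac_eq]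
  set M := X.mdPre z t
  have hlag := lag_nonneg (X := X) t
  have hβ := hP.β_pos
  have hdisc := disc_pos (X := X) z t
  have hmain : ∀ z' ≤ t, Real.exp (decay * if X.Ser t then 1 else 0) *
      (Real.exp (X.expo z' (t + 1) M) * Real.exp (8 / 5 * M.rate * P.β * X.lag t)) =
      Real.exp (X.expo z' t M - M.rate * P.d * X.sp t) *
        Real.exp (8 / 5 * M.rate * P.β * X.lag t) *
        Real.exp (M.rate * (X.adv P.δ P.om P.d t + P.d * X.sp t) + (M.gainRate - M.rate) * X.gain t +
          decay * if X.Ser t then 1 else 0) := by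
    intro z' hz'
    simp only [← Real.exp_add]
    congr 1
    cases hM : M with
    | idle => simp only [expo, Mode.rate, Mode.gainRate, advSum_succ hz']; ring
    | attempt s => simp only [expo, Mode.rate, Mode.gainRate, advSum_succ hz']; ring
    | pending s e =>
      rw [hM] at hinv
      simp only [expo, Mode.rate, Mode.gainRate, advSum_succ hinv.2.1, gainSum_succ hinv.2.1]
      ring
  have hmain' := hmain (X.lastZs t) (lastZs_le t)
  have hexp : 1 ≤ Real.exp (decay * if X.Ser t then 1 else 0) := by
    refine Real.one_le_exp ?_
    have := decay_pos
    positivity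
  set W := Real.exp (decay * if X.Ser t then 1 else 0)
  rw [mul_assoc (X.disc z t) W, mul_assoc (X.disc z t) (X.corr t M * _ * _),
    mul_assoc (X.disc z t) (Real.exp _ * _), ← mul_add]
  refine mul_le_mul_of_nonneg_left ?_ hdisc.le
  rw [← hmain']
  cases hM : M with
  | idle =>
    simp only [markMode, corr]
    linarith
  | attempt s =>
    rw [hM] at hinv
    -- When an attempt fails, the new correction and `progFac` are both zero, and the main term is
    -- the same for the attempt and idle modes.
    by_cases h1 : X.AdvSer t ∨ X.ExtraSer P.δ t
    · simp only [markMode, if_pos h1, corr, progFac_eq_zero h1, expo, Mode.rate]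
      linarith
    · simp only [markMode, if_neg h1, corr]
      have h2 := progFac_le (X := X) hP t
      set H := progFac P.om (decide (X.Prod P.δ t)) (X.party t)
        (X.job t (X.party t)).isSer (X.kind t)
      have h3 : Real.exp (-150 + X.progSum P.δ P.om P.fd s t) * Real.exp (P.fd * X.sp t) * H ≤
          Real.exp (-150 + X.progSum P.δ P.om P.fd s (t + 1)) := by
        calc _ ≤ Real.exp (-150 + X.progSum P.δ P.om P.fd s t) * Real.exp (P.fd * X.sp t) *
              Real.exp (X.prog P.δ P.om P.fd t - P.fd * X.sp t) :=
              mul_le_mul_of_nonneg_left h2 (by positivity)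
          _ = _ := by
            rw [← Real.exp_add, ← Real.exp_add, progSum_succ hinv.1]
            congr 1; ring
      have h4 := mul_le_mul_of_nonneg_right h3 (Real.exp_pos (-(2 * P.β * X.lag t))).le
      set Y := Real.exp (-150 + X.progSum P.δ P.om P.fd s (t + 1)) *
        Real.exp (-(2 * P.β * X.lag t))
      have hY : 0 ≤ Y := by positivity
      have h5 : Y ≤ W * Y := le_mul_of_one_le_left hY hexp
      linarith
  | pending s e =>
    rw [hM] at hinv
    simp only [markMode]
    -- On leaving the pending mode the exponent 1/20·(advSum − 56) is nonnegative, and the remaining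
    -- η·gainSum dominates the exponent of the idle mode. Having this bound at hand is the reason
    -- for carrying `gainSum` along.
    split_ifs with h1
    · simp only [corr, zero_mul, add_zero, sub_zero]
      refine mul_le_mul_of_nonneg_left ?_ (by positivity)
      rw [← Real.exp_add, ← Real.exp_add]
      refine Real.exp_le_exp.2 ?_
      have h2 := expo_idle_le_gainSum hP hinv.2.2.1 hinv.2.2.2.1 hinv.2.2.2.2.1 hinv.1.le
        (by have := hinv.2.2.2.2.2.1; omega) hinv.2.1 hX
      simp only [expo, Mode.rate]
      have h3 := mul_le_mul_of_nonneg_left h2 eta_pos.le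
      have h4 := mul_le_mul_of_nonneg_right (show eta ≤ 1 / 20 by have := eta_le; linarith)
        (mul_nonneg hβ.le hlag)
      nlinarith
    · simp only [corr]
      linarith

end Trace
end Potential
end Interlude

/-! ### The potential across a gap and at special indices. -/

namespace Interlude

section Potential

open scoped Classical

/-- The kernel whose mean over an exponential gap `g` is `exp (s * u)`. -/
noncomputable def kern (R s u g : ℝ) : ℝ :=
  Real.exp (s * max 0 (u - g)) * (1 + if g < u then s / R else 0)

namespace Trace

variable {P : Params} {Tx : Type*} {X : Trace P.n P.m P.k Tx}

theorem time_succ {t : ℕ} (h : 0 < t) : X.time t = X.time (t - 1) + X.gap t := by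
  unfold time
  rw [Nat.sub_add_cancel h, Finset.sum_range_succ]

theorem gap_nonneg (hm : Monotone X.time) {t : ℕ} (h : 0 < t) : 0 ≤ X.gap t := by
  have := hm (Nat.sub_le t 1)
  rw [time_succ h] at this
  linarith

theorem lag_of_special (hP : P.Admissible) {t : ℕ} (h : X.Special t) : X.lag t = P.δ := by
  unfold lag
  rw [h.lastSp_eq, add_sub_cancel_left, max_eq_right hP.δ_nonneg]

theorem lastSp_pred {t : ℕ} (h0 : 0 < t) (h : ¬ X.Special t) :
    X.lastSp t = X.lastSp (t - 1) := by
  obtain ⟨t, rfl⟩ := Nat.exists_eq_succ_of_ne_zero h0.ne'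
  exact lastSp_succ h

theorem lag_of_not_special (hm : Monotone X.time) {t : ℕ} (h0 : 0 < t) (h : ¬ X.Special t) :
    X.lag t = max 0 (X.lag (t - 1) - X.gap t) := by
  have h1 := gap_nonneg hm h0
  unfold lag
  rw [lastSp_pred h0 h, time_succ h0]
  rcases le_total (X.time (X.lastSp (t - 1)) + P.δ - X.time (t - 1)) 0 with h2 | h2
  · rw [max_eq_left h2, max_eq_left, max_eq_left] <;> linarith
  · rw [max_eq_right h2]
    congr 1
    ring

/-- The honest parties are synchronized at ring `t` exactly when the gap has used up the remaining
lag; this is the case distinction in `kern`. -/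
theorem prod_iff_of_not_special (hm : Monotone X.time) {t : ℕ} (h0 : 0 < t) (h : ¬ X.Special t) :
    X.Prod P.δ t ↔ ¬ X.gap t < X.lag (t - 1) := by
  have h1 := gap_nonneg hm h0
  have h2 : X.lastSp t < t := by
    rw [lastSp_pred h0 h]
    have := lastSp_le (X := X) (t - 1)
    omega
  unfold Prod lag
  rw [time_succ h0, lastSp_pred h0 h, lt_max_iff]
  rw [lastSp_pred h0 h] at h2
  simp only [h2, true_and]
  constructor
  · rintro h3 (h4 | h4) <;> linarith
  · intro h3
    push Not at h3
    linarith [h3.2]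

theorem advSum_self (z : ℕ) : X.advSum P.δ P.om P.d z z = 0 := by simp [advSum]

theorem progSum_nonneg (hP : P.Admissible) (s t : ℕ) : 0 ≤ X.progSum P.δ P.om P.fd s t :=
  Finset.sum_nonneg fun i _ => prog_nonneg hP i

theorem neg_two_le_expo (hP : P.Admissible) (hX : X.Follows P.δ) (hm : Monotone X.time)
    {t : ℕ} (h0 : 0 < t) : -2 ≤ X.advSum P.δ P.om P.d (X.lastZs (t - 1)) t +
      57 / 100 * (P.k * P.om) * X.sib (X.lastZs (t - 1)) := by
  have h1 := lastZs_le (X := X) (t - 1)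
  exact hX.le_advSum hm hP.weights (zeroStock_lastZs _) (by omega)
    fun i h2 h3 => not_zeroStock_of_lastZs_lt h2 (by omega)

/-- With 60 heights, at most 5 siblings and fd ≤ 1/5 the bound is 24 + 65 + 60 = 149, which is why
the correction starts at e^(−150). -/
theorem ModeInv.progSum_le (hP : P.Admissible) (hX : X.Follows P.δ) (hm : Monotone X.time)
    {s t : ℕ} (h : X.ModeInv P.δ P.om P.d t (.attempt s)) :
    X.progSum P.δ P.om P.fd s t ≤ 149 := by
  obtain ⟨h1, h2, h3, h4, h5⟩ := h
  have h6 := h4.progSum_le hX hm hP.weights hP.fd_nonneg h2 h1.le h5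
  have h7 : (X.sib s : ℝ) ≤ 5 := by exact_mod_cast h3
  have h8 := hP.fd_le
  push_cast at h6
  linarith

theorem exp_neg_one_le : Real.exp (-1) ≤ 1 / 2 := by
  have h1 : (2 : ℝ) ≤ Real.exp 1 := by have := Real.add_one_le_exp (1 : ℝ); linarith
  rw [Real.exp_neg, one_div]
  exact inv_anti₀ (by norm_num) h1

theorem ModeInv.corr_le (hP : P.Admissible) (hX : X.Follows P.δ) (hm : Monotone X.time)
    {t : ℕ} {M : Mode} (h : X.ModeInv P.δ P.om P.d t M) : X.corr t M ≤ 1 / 2 := by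
  cases M with
  | idle => simp only [corr]; norm_num
  | pending s e => simp only [corr]; norm_num
  | attempt s =>
    have h1 := h.progSum_le hP hX hm
    simp only [corr]
    exact (Real.exp_le_exp.2 (by linarith)).trans exp_neg_one_le

/-- The change of the potential at a special index. -/
theorem Follows.exp_expo_upd_le (hP : P.Admissible) (hX : X.Follows P.δ) (hm : Monotone X.time)
    {t : ℕ} (h0 : 0 < t) {M : Mode} (hM : X.ModeInv P.δ P.om P.d t M) :
    Real.exp (X.expo (X.lastZs t) t (X.updMode t M)) + X.corr t M ≤
      Real.exp (X.expo (X.lastZs (t - 1)) t M) + 53 / 50 * X.corr t (X.updMode t M) := by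
  have hη := eta_pos
  have hη' := eta_le
  have hη'' := mul_eta_le
  have hE := neg_two_le_expo hP hX hm h0
  have hx := hP.k_mul_om_le
  have hx0 : (0 : ℝ) ≤ P.k * P.om := mul_nonneg (Nat.cast_nonneg _) hP.om_pos.le
  have hlow : 1 - 2 * eta ≤ Real.exp (eta * (X.advSum P.δ P.om P.d (X.lastZs (t - 1)) t +
      57 / 100 * (P.k * P.om) * X.sib (X.lastZs (t - 1)))) := by
    have h1 := Real.add_one_le_exp (eta * (X.advSum P.δ P.om P.d (X.lastZs (t - 1)) t +
      57 / 100 * (P.k * P.om) * X.sib (X.lastZs (t - 1))))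
    have h2 := mul_le_mul_of_nonneg_left hE hη.le
    linarith
  cases M with
  | pending s e => simp [updMode, expo, corr]
  | idle =>
    by_cases hz : X.ZeroStock t
    · have h1 := lastZs_le (X := X) (t - 1)
      have h2 := hX.sib_le_advSum hm hP.weights (zeroStock_lastZs (t - 1)) (by omega) hz
        fun i h2 h3 => not_zeroStock_of_lastZs_lt h2 (by omega)
      have hsib0 : (0 : ℝ) ≤ X.sib t := Nat.cast_nonneg _
      have h3 := mul_le_mul_of_nonneg_right hx hsib0
      -- The old exponent is at least η(sib − 2), the new one at most 57/100·η·sib. From 6 siblings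
      -- on nothing is lost; with fewer, the loss of a few η is covered by the new correction term.
      by_cases hs : X.sib t ≤ 5
      · have hs' : (X.sib t : ℝ) ≤ 5 := by exact_mod_cast hs
        simp only [updMode, hz, hs, and_self, if_true, expo, corr, hz.lastZs_eq, advSum_self,
          zero_add, add_zero]
        set a := 57 / 100 * (P.k * P.om) * (X.sib t : ℝ)
        set b := X.advSum P.δ P.om P.d (X.lastZs (t - 1)) t +
          57 / 100 * (P.k * P.om) * X.sib (X.lastZs (t - 1))
        have h4 : Real.exp (-150) ≤
            53 / 50 * Real.exp (-150 + X.progSum P.δ P.om P.fd t t) := by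
          have : X.progSum P.δ P.om P.fd t t = 0 := by simp [progSum]
          rw [this, add_zero]
          have := Real.exp_pos (-150)
          linarith
        have h5 : a ≤ b + 2 := by simp only [a]; nlinarith
        have h6 : Real.exp (eta * a) ≤ 2 := by
          have h7 : eta * a ≤ 1 / 2 := by
            have : a ≤ 5 := by simp only [a]; nlinarith
            nlinarith
          have h8 := exp_sub_one_le (y := (1 / 2 : ℝ)) (by norm_num) (by norm_num)
          have h9 := Real.exp_le_exp.2 h7
          linarith
        have h7 : Real.exp (eta * a) * (1 - 2 * eta) ≤ Real.exp (eta * b) := by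
          have h8 := Real.add_one_le_exp (-(2 * eta))
          calc _ ≤ Real.exp (eta * a) * Real.exp (-(2 * eta)) :=
                mul_le_mul_of_nonneg_left (by linarith) (Real.exp_pos _).le
            _ = Real.exp (eta * a + -(2 * eta)) := (Real.exp_add _ _).symm
            _ ≤ _ := Real.exp_le_exp.2 (by nlinarith)
        nlinarith
      · have hs' : (6 : ℝ) ≤ X.sib t := by exact_mod_cast (by omega : 6 ≤ X.sib t)
        simp only [updMode, hs, and_false, if_false, expo, corr, hz.lastZs_eq, advSum_self,
          zero_add, add_zero, mul_zero]
        refine Real.exp_le_exp.2 (mul_le_mul_of_nonneg_left ?_ hη.le)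
        nlinarith
    · simp [updMode, hz, corr, lastZs_of_not h0 hz]
  | attempt s =>
    have hcp : 0 ≤ X.corr t (.attempt s) := corr_nonneg _ _
    by_cases hz : X.ZeroStock t
    · by_cases hs : X.ht s + 60 ≤ X.ht t
      -- On success the main term becomes e^(−56/20) ≤ 1/4. With the old correction, at most 1/2,
      -- this stays below 1 − 2η.
      · have h1 := hM.corr_le hP hX hm
        simp only [updMode, hz, hs, and_self, if_true]
        have h2 : X.corr t (.pending s t) = 0 := rfl
        have h3 : X.expo (X.lastZs t) t (.pending s t) = -(56 / 20) := by
          simp only [expo, advSum_self, gainSum, Finset.Ico_self, Finset.sum_empty]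
          norm_num
        have h4 : Real.exp (-(56 / 20)) ≤ 1 / 4 := by
          calc Real.exp (-(56 / 20)) ≤ Real.exp (-1 + -1) := Real.exp_le_exp.2 (by norm_num)
            _ = Real.exp (-1) * Real.exp (-1) := Real.exp_add _ _
            _ ≤ 1 / 2 * (1 / 2) :=
              mul_le_mul exp_neg_one_le exp_neg_one_le (Real.exp_pos _).le (by norm_num)
            _ = 1 / 4 := by norm_num
        rw [h2, h3]
        simp only [expo]
        linarith
      -- A reset during an attempt costs at most 2η, which the surplus 3/50 of a correction of at
      -- least e^(−150) pays for.
      · have h1 : X.sib t = 0 := by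
          refine hM.2.2.2.1.sib_eq_zero hM.2.1 hM.1.le ?_
          have h2 := hM.1
          rcases hz.1 with h3 | h3
          · omega
          · exact lt_of_le_of_lt (hX.ht_mono (by omega)) h3
        simp only [updMode, hs, and_false, if_false, expo, hz.lastZs_eq, advSum_self, h1]
        have h2 : Real.exp (-150) ≤ X.corr t (.attempt s) := by
          simp only [corr]
          refine Real.exp_le_exp.2 ?_
          have := progSum_nonneg (X := X) hP s t
          linarith
        simp only [Nat.cast_zero, mul_zero, add_zero, Real.exp_zero]
        linarith
    · simp only [updMode, hz, false_and, if_false, lastZs_of_not h0 hz]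
      linarith

theorem one_le_kern {R s u g : ℝ} (hR : 0 < R) (hs : 0 ≤ s) : 1 ≤ kern R s u g := by
  unfold kern
  have h1 : 1 ≤ Real.exp (s * max 0 (u - g)) :=
    Real.one_le_exp (mul_nonneg hs (le_max_left _ _))
  have h2 : 1 ≤ 1 + if g < u then s / R else 0 := by
    have := div_nonneg hs hR.le
    split_ifs <;> linarith
  exact one_le_mul_of_one_le_of_one_le h1 h2

theorem kern_nonneg {R s u g : ℝ} (hR : 0 < R) (hs : -R ≤ s) : 0 ≤ kern R s u g := by
  unfold kern
  have h1 : -1 ≤ s / R := by rw [le_div_iff₀ hR]; linarith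
  refine mul_nonneg (Real.exp_pos _).le ?_
  split_ifs <;> linarith

theorem kern_le_one {R s u g : ℝ} (hR : 0 < R) (hs : s ≤ 0) (hs' : -R ≤ s) :
    kern R s u g ≤ 1 := by
  unfold kern
  have h1 : Real.exp (s * max 0 (u - g)) ≤ 1 :=
    Real.exp_le_one_iff.2 (mul_nonpos_of_nonpos_of_nonneg hs (le_max_left _ _))
  have h2 : s / R ≤ 0 := div_nonpos_of_nonpos_of_nonneg hs hR.le
  have h3 : -1 ≤ s / R := by rw [le_div_iff₀ hR]; linarith
  refine mul_le_one₀ h1 ?_ ?_ <;> split_ifs <;> linarith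

/-- Needed for `kern` to be nonnegative at the exponent −2β. -/
theorem two_mul_le_rate (hP : P.Admissible) : 2 * P.β ≤ P.rate := by
  have h1 := hP.div_rate
  have h2 := hP.rinv_le
  rw [← h1, div_le_iff₀ hP.rate_pos] at h2
  have := hP.rate_pos
  linarith

/-- The main term of the potential after the rings before `t`, without the lag. -/
noncomputable def mainCoeff (X : Trace P.n P.m P.k Tx) (z t : ℕ) : ℝ :=
  X.disc z t * Real.exp (X.expo (X.lastZs (t - 1)) t (X.md z t))

/-- The correction term of the potential after the rings before `t`, without the lag. -/
noncomputable def corrCoeff (X : Trace P.n P.m P.k Tx) (z t : ℕ) : ℝ :=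
  X.disc z t * X.corr t (X.md z t)

theorem pot_eq (z t : ℕ) : X.pot z t =
    X.mainCoeff z t * Real.exp (8 / 5 * (X.md z t).rate * P.β * X.lag (t - 1)) -
      X.corrCoeff z t * Real.exp (-(2 * P.β) * X.lag (t - 1)) := by
  unfold pot mainCoeff corrCoeff
  rw [neg_mul]
  ring

/-- The comparison of the averages over the mark of ring `t` with the potential before. -/
theorem Follows.pre_le (hP : P.Admissible) (hX : X.Follows P.δ) (hm : Monotone X.time)
    {z t : ℕ} (h0 : 0 < t) :
    X.preMain z t *
        (1 + if decide (X.Prod P.δ t) then 0 else 8 / 5 * (X.mdPre z t).rate * P.rinv) +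
      X.corrCoeff z t * kern P.rate (-(2 * P.β)) (X.lag (t - 1)) (X.gap t) ≤
    X.mainCoeff z t * kern P.rate (8 / 5 * (X.md z t).rate * P.β) (X.lag (t - 1)) (X.gap t) +
      X.preCorr z t * (1 - if decide (X.Prod P.δ t) then 0 else 2 * P.rinv) := by
  have hinv := hX.modeInv (om := P.om) (d := P.d) z t
  have hdisc := disc_pos (X := X) z t
  have hR := hP.rate_pos
  have hβ := hP.β_pos
  have hr := hP.rinv_pos
  have hr' := hP.rinv_le
  have hdr := hP.div_rate
  unfold preMain preCorr mainCoeff corrCoeff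
  simp only [mul_assoc (X.disc z t), ← mul_add]
  refine mul_le_mul_of_nonneg_left ?_ hdisc.le
  by_cases hs : X.Special t
  · have hp : ¬ X.Prod P.δ t := fun h => h.not_special hs
    simp only [hp, decide_false, Bool.false_eq_true, if_false, lag_of_special hP hs, sp, hs, if_true,
      mul_one]
    have h1 := hX.exp_expo_upd_le hP hm h0 hinv
    set M := X.md z t
    set M' := X.updMode t M
    have h2 := one_le_kern (u := X.lag (t - 1)) (g := X.gap t) hR
      (show 0 ≤ 8 / 5 * M.rate * P.β by have := M.rate_pos; positivity)
    have h3 := kern_le_one (u := X.lag (t - 1)) (g := X.gap t) hR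
      (show -(2 * P.β) ≤ 0 by linarith) (by have := two_mul_le_rate hP; linarith)
    -- The charge `d` cancels the factor of the fresh lag δ and also covers the drift at the special
    -- ring itself, where the parties are not synchronized.
    have h4 : Real.exp (X.expo (X.lastZs t) t M' - M'.rate * P.d) *
        Real.exp (8 / 5 * M'.rate * P.β * P.δ) * (1 + 8 / 5 * M'.rate * P.rinv) ≤
        Real.exp (X.expo (X.lastZs t) t M') := by
      calc _ ≤ Real.exp (X.expo (X.lastZs t) t M' - M'.rate * P.d) *
            Real.exp (8 / 5 * M'.rate * P.β * P.δ) * Real.exp (8 / 5 * M'.rate * P.rinv) := by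
            refine mul_le_mul_of_nonneg_left ?_ (by positivity)
            have := Real.add_one_le_exp (8 / 5 * M'.rate * P.rinv)
            linarith
        _ = _ := by
            rw [← Real.exp_add, ← Real.exp_add]
            congr 1
            unfold Params.d
            ring
    -- `fd` plays the role of `d` for the correction term; its summand 3/50 provides the surplus
    -- used at resets.
    have h5 : 53 / 50 ≤ Real.exp P.fd * Real.exp (-(2 * P.β * P.δ)) * (1 - 2 * P.rinv) := by
      have h6 : Real.exp P.fd * Real.exp (-(2 * P.β * P.δ)) =
          Real.exp (3 / 50) * Real.exp (4 * P.rinv) := by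
        rw [← Real.exp_add, ← Real.exp_add]
        congr 1
        unfold Params.fd
        ring
      have h7 := Real.add_one_le_exp (3 / 50 : ℝ)
      have h8 := Real.add_one_le_exp (4 * P.rinv)
      have h9 : 1 ≤ Real.exp (4 * P.rinv) * (1 - 2 * P.rinv) := by nlinarith
      rw [h6, mul_assoc]
      nlinarith
    have h6 := mul_le_mul_of_nonneg_left h5 (corr_nonneg (X := X) t M')
    have h7 := mul_le_mul_of_nonneg_left h3 (corr_nonneg (X := X) t M)
    have h8 := mul_le_mul_of_nonneg_left h2 (Real.exp_pos (X.expo (X.lastZs (t - 1)) t M)).le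
    simp only [mul_assoc] at *
    linarith
  · have hz : ¬ X.ZeroStock t := fun h => hs (Or.inl h.1)
    have hM : X.mdPre z t = X.md z t := by
      unfold mdPre
      cases X.md z t <;> simp [updMode, hz]
    rw [hM, lastZs_of_not h0 hz, lag_of_not_special hm h0 hs]
    set M := X.md z t
    have h1 : 8 / 5 * M.rate * P.β / P.rate = 8 / 5 * M.rate * P.rinv := by
      rw [← hdr]; ring
    have h2 : -(2 * P.β) / P.rate = -(2 * P.rinv) := by rw [← hdr]; ring
    have h3 := prod_iff_of_not_special hm h0 hs
    -- Away from special indices nothing but the lag changes, and the factor `1 + s / R` in `kern`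
    -- is exactly the drift allowed by the mark while the lag lasts.
    refine le_of_eq ?_
    unfold kern
    rw [h1, h2]
    by_cases hg : X.gap t < X.lag (t - 1)
    · have hp : ¬ X.Prod P.δ t := fun h => h3.1 h hg
      simp only [hg, hp, decide_false, Bool.false_eq_true, if_false, if_true, sp, hs, mul_zero,
        sub_zero, Real.exp_zero]
      ring_nf
    · have hp : X.Prod P.δ t := h3.2 hg
      simp only [hg, hp, decide_true, if_false, if_true, sp, hs, mul_zero,
        sub_zero, Real.exp_zero]
      ring_nf

/-- Outside the pending mode the exponent is at least −2η by `le_advSum`, and the correction is at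
most 1/2. -/
theorem Follows.pot_lower (hP : P.Admissible) (hX : X.Follows P.δ) (hm : Monotone X.time)
    {z t : ℕ} (h0 : 0 < t) (hM : ¬ (X.md z t).IsPending) : X.disc z t / 4 ≤ X.pot z t := by
  have hinv := hX.modeInv (om := P.om) (d := P.d) z t
  have hdisc := disc_pos (X := X) z t
  have hE := neg_two_le_expo hP hX hm h0
  have hη := eta_pos
  have hη' := eta_le
  have hβ := hP.β_pos
  have hlag := lag_nonneg (X := X) (t - 1)
  have hlow : 1 - 2 * eta ≤ Real.exp (X.expo (X.lastZs (t - 1)) t (X.md z t)) := by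
    have h1 := Real.add_one_le_exp (X.expo (X.lastZs (t - 1)) t (X.md z t))
    have h2 := mul_le_mul_of_nonneg_left hE hη.le
    refine le_trans ?_ h1
    cases h3 : X.md z t with
    | idle => simp only [expo]; linarith
    | attempt s => simp only [expo]; linarith
    | pending s e => rw [h3] at hM; exact absurd trivial hM
  have hc := hinv.corr_le hP hX hm
  have hc0 := corr_nonneg (X := X) t (X.md z t)
  have h1 : 1 ≤ Real.exp (8 / 5 * (X.md z t).rate * P.β * X.lag (t - 1)) := by
    have := (X.md z t).rate_pos
    exact Real.one_le_exp (by positivity)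
  have h2 : Real.exp (-(2 * P.β * X.lag (t - 1))) ≤ 1 :=
    Real.exp_le_one_iff.2 (by have := mul_nonneg hβ.le hlag; linarith)
  have h3 := mul_le_mul hc h2 (Real.exp_pos _).le (by norm_num)
  have h4 : 1 - 2 * eta ≤ Real.exp (X.expo (X.lastZs (t - 1)) t (X.md z t)) *
      Real.exp (8 / 5 * (X.md z t).rate * P.β * X.lag (t - 1)) :=
    hlow.trans (le_mul_of_one_le_right (Real.exp_pos _).le h1)
  unfold pot
  rw [div_eq_mul_inv]
  exact mul_le_mul_of_nonneg_left (by linarith) hdisc.le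

theorem Follows.pot_nonneg (hP : P.Admissible) (hX : X.Follows P.δ) (hm : Monotone X.time)
    {z t : ℕ} (h0 : 0 < t) : 0 ≤ X.pot z t := by
  have hdisc := disc_pos (X := X) z t
  by_cases hM : (X.md z t).IsPending
  · unfold pot
    have h1 : X.corr t (X.md z t) = 0 := by
      cases h : X.md z t with
      | idle => rfl
      | attempt s => rw [h] at hM; exact hM.elim
      | pending s e => rfl
    rw [h1, zero_mul, sub_zero]
    positivity
  · exact le_trans (by positivity) (hX.pot_lower hP hm h0 hM)

theorem gain_le (hP : P.Admissible) (i : ℕ) : X.gain i ≤ 3 := by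
  have h1 := hP.om_le
  have h2 := hP.om_pos
  unfold gain
  split_ifs <;> linarith

/-- The potential is small at the start. -/
theorem Base.pot_succ_le [NeZero P.n] (hP : P.Admissible) (hX : X.Follows P.δ) {z : ℕ}
    (hz : X.Base z) : X.pot z (z + 1) ≤ 2 := by
  have hzs := hz.zeroStock hX
  have hsib := hz.sib_eq_zero hX
  have hη := eta_pos
  have hη' := eta_le
  -- A base is zero-stock without siblings, so an attempt starts at once. Even if ring `z` ends it,
  -- the exponent is that of a single ring.
  have hM : (X.md z (z + 1)).rate = eta ∧
      X.expo (X.lastZs z) (z + 1) (X.md z (z + 1)) = eta * X.adv P.δ P.om P.d z := by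
    unfold md
    rw [mode_succ le_rfl, mode_of_le le_rfl]
    simp only [updMode, hzs, hsib, Nat.zero_le, and_self, if_true, markMode]
    split_ifs <;> simp [Mode.rate, expo, hzs.lastZs_eq, hsib, advSum_succ, advSum_self]
  have h1 : X.pot z (z + 1) ≤ X.disc z (z + 1) *
      (Real.exp (eta * X.adv P.δ P.om P.d z) * Real.exp (8 / 5 * eta * P.β * P.δ)) := by
    unfold pot
    rw [Nat.add_sub_cancel, hM.1, hM.2, lag_of_special hP (Or.inl hzs.1)]
    refine mul_le_mul_of_nonneg_left ?_ (disc_pos _ _).le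
    have := mul_nonneg (corr_nonneg (X := X) (z + 1) (X.md z (z + 1)))
      (Real.exp_pos (-(2 * P.β * P.δ))).le
    linarith
  refine h1.trans ?_
  unfold disc
  rw [← Real.exp_add, ← Real.exp_add]
  have h2 : (cnt z (z + 1) X.Ser : ℝ) ≤ 1 := by
    have h3 := cnt_succ (le_refl z) X.Ser
    rw [h3, cnt_eq_zero fun i _ _ => by omega]
    split_ifs <;> norm_num
  have h3 := (adv_le_gain (X := X) hP z).trans (gain_le hP z)
  have h4 := mul_le_mul_of_nonneg_left h3 hη.le
  have h5 := mul_le_mul_of_nonneg_left h2 decay_pos.le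
  have h6 := mul_le_mul_of_nonneg_left hP.delay_le hη.le
  have h7 := exp_sub_one_le (y := (1 / 2 : ℝ)) (by norm_num) (by norm_num)
  have h8 : Real.exp (decay * cnt z (z + 1) X.Ser + (eta * X.adv P.δ P.om P.d z +
      8 / 5 * eta * P.β * P.δ)) ≤ Real.exp (1 / 2) := by
    refine Real.exp_le_exp.2 ?_
    unfold decay at *
    nlinarith
  linarith

end Trace
end Potential
end Interlude

/-! ### Measurability of the bookkeeping. -/

namespace Interlude

section Measurability

open scoped Classical

instance {k : ℕ} {Tx : Type*} [Countable Tx] : Countable (Umbrella k Tx) :=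
  Function.Injective.countable (f := fun u : Umbrella k Tx => (u.id, u.txs)) fun u v h => by
    cases u; cases v; simp_all

/-- The data added at each series block of a chain. -/
def Chain.toList {k : ℕ} {Tx : Type*} :
    Chain k Tx → List ((Fin k → Umbrella k Tx) × ℕ × Finset Tx)
  | .genesis => []
  | .extend prev kset id txs => (kset, id, txs) :: prev.toList

theorem Chain.toList_injective {k : ℕ} {Tx : Type*} :
    Function.Injective (Chain.toList : Chain k Tx → _) := by
  intro C
  induction C with
  | genesis => intro D h; cases D <;> simp_all [Chain.toList]
  | extend prev kset id txs ih =>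
    intro D h
    cases D with
    | genesis => simp [Chain.toList] at h
    | extend prev' kset' id' txs' =>
      simp only [Chain.toList, List.cons.injEq, Prod.mk.injEq] at h
      obtain ⟨⟨rfl, rfl, rfl⟩, h⟩ := h
      rw [ih h]

instance {k : ℕ} {Tx : Type*} [Countable Tx] : Countable (Chain k Tx) :=
  Chain.toList_injective.countable

instance {k : ℕ} {Tx : Type*} [Countable Tx] : Countable (Job k Tx) :=
  Function.Injective.countable (f := fun J : Job k Tx => match J with
    | .parallel top txs => Sum.inl (top, txs)
    | .series top kset txs => (Sum.inr (top, kset, txs) :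
        (Chain k Tx × (Fin k → Finset Tx)) ⊕ (Chain k Tx × (Fin k → Umbrella k Tx) × Finset Tx)))
    fun J J' h => by cases J <;> cases J' <;> simp_all

instance : Countable Mode :=
  Function.Injective.countable (f := fun M : Mode => match M with
    | .idle => (none : Option (ℕ × Option ℕ))
    | .attempt s => some (s, none)
    | .pending s e => some (s, some e))
    fun M M' h => by cases M <;> cases M' <;> simp_all

variable {Ω : Type*} {mG : MeasurableSpace Ω}

/-- Countable case distinction on the value of `ν`. Restricting to attained values allows bounds
such as `lastSp j ≤ j` to be used when the branch is known only up to a certain ring. -/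
theorem measurable_cases {ι β : Type*} [Countable ι] [MeasurableSpace β] {ν : Ω → ι}
    (hν : ∀ i, Measurable fun ω => ν ω = i) {f : ι → Ω → β}
    (hf : ∀ i, (∃ ω, ν ω = i) → Measurable (f i)) : Measurable fun ω => f (ν ω) ω := by
  intro S hS
  have : (fun ω => f (ν ω) ω) ⁻¹' S = ⋃ i : Set.range ν, {ω | ν ω = i} ∩ f i ⁻¹' S := by
    ext ω
    simp only [Set.mem_preimage, Set.mem_iUnion, Set.mem_inter_iff, Set.mem_ofPred_eq]
    constructor
    · exact fun h => ⟨⟨ν ω, ω, rfl⟩, rfl, h⟩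
    · rintro ⟨i, h1, h2⟩
      rwa [h1]
  rw [this]
  refine MeasurableSet.iUnion fun i => ?_
  exact (hν i).setOf.inter (hf i i.2 hS)

theorem measurable_ite_eq {β : Type*} {c : Ω → Prop} [DecidablePred c] (hc : Measurable c)
    (x y z : β) : Measurable fun ω => (if c ω then x else y) = z := by
  have : (fun ω => (if c ω then x else y) = z) = fun ω => (c ω ∧ x = z) ∨ (¬ c ω ∧ y = z) := by
    funext ω
    by_cases h : c ω <;> simp [h]
  rw [this]
  exact (hc.and measurable_const).or (hc.not.and measurable_const)

theorem measurable_ite_const {c : Ω → Prop} (hc : Measurable c) (x y : ℝ) :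
    Measurable fun ω => if c ω then x else y :=
  Measurable.ite hc.setOf measurable_const measurable_const

theorem measurable_exists_of {p : ℕ → Ω → Prop} {q : ℕ → Prop} (h : ∀ i, q i → Measurable (p i)) :
    Measurable fun ω => ∃ i, q i ∧ p i ω := by
  refine Measurable.exists fun i => ?_
  by_cases hi : q i
  · simpa [hi] using h i hi
  · simp [hi]

theorem measurable_forall_of {p : ℕ → Ω → Prop} {q : ℕ → Prop} (h : ∀ i, q i → Measurable (p i)) :
    Measurable fun ω => ∀ i, q i → p i ω := by
  refine Measurable.forall fun i => ?_
  by_cases hi : q i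
  · simpa [hi] using h i hi
  · simp [hi]

theorem measurable_cnt {z t : ℕ} {p : Ω → ℕ → Prop}
    (h : ∀ i < t, Measurable fun ω => p ω i) : Measurable fun ω => Trace.cnt z t (p ω) := by
  have : (fun ω => Trace.cnt z t (p ω)) =
      fun ω => ∑ i ∈ Finset.Ico z t, if p ω i then 1 else 0 := by
    funext ω
    rw [Trace.cnt, Finset.card_filter]
  rw [this]
  refine Finset.measurable_fun_sum _ fun i hi => ?_
  exact Measurable.ite (h i (Finset.mem_Ico.1 hi).2).setOf measurable_const measurable_const

theorem measurable_le_of {β : Type*} [MeasurableSpace β] [TopologicalSpace β] [BorelSpace β]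
    [LinearOrder β] [OrderClosedTopology β] [SecondCountableTopology β]
    {f g : Ω → β} (hf : Measurable f) (hg : Measurable g) : Measurable fun ω => f ω ≤ g ω :=
  measurableSet_setOfPred.1 (measurableSet_le hf hg)

theorem measurable_lt_of {β : Type*} [MeasurableSpace β] [TopologicalSpace β] [BorelSpace β]
    [LinearOrder β] [OrderClosedTopology β] [SecondCountableTopology β]
    {f g : Ω → β} (hf : Measurable f) (hg : Measurable g) : Measurable fun ω => f ω < g ω :=
  measurableSet_setOfPred.1 (measurableSet_lt hf hg)

theorem measurable_eq_of {f g : Ω → ℕ} (hf : Measurable f) (hg : Measurable g) :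
    Measurable fun ω => f ω = g ω :=
  measurableSet_setOfPred.1 (measurableSet_eq_fun hf hg)

theorem measurable_eq_nat {f : Ω → ℕ} (hf : Measurable f) (i : ℕ) : Measurable fun ω => f ω = i :=
  measurable_eq_of hf measurable_const

namespace Trace

variable {P : Params} {Tx : Type*} [Countable Tx]

variable [mG] in
/-- The jobs and times at the rings before `a` and the marks of the rings before `b` are known. -/
structure Known (X : Ω → Trace P.n P.m P.k Tx) (a b : ℕ) : Prop where
  job : ∀ i < a, ∀ v, Measurable fun ω => (X ω).job i = v
  gap : ∀ i < a, Measurable fun ω => (X ω).gap i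
  party : ∀ i < b, ∀ p, Measurable fun ω => (X ω).party i = p
  kind : ∀ i < b, ∀ c, Measurable fun ω => (X ω).kind i = c
  le : b ≤ a

namespace Known

variable {X : Ω → Trace P.n P.m P.k Tx} {a b : ℕ}

theorem ofJob (h : Known X a b) {i : ℕ} (hi : i < a) {β : Type*} [MeasurableSpace β]
    (F : (Party P.n P.m → Job P.k Tx) → β) : Measurable fun ω => F ((X ω).job i) :=
  measurable_cases (f := fun v _ => F v) (h.job i hi) fun _ _ => measurable_const

theorem ring (h : Known X a b) {i : ℕ} (hi : i < b) {β : Type*} [MeasurableSpace β]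
    (F : Party P.n P.m → Bool → (Party P.n P.m → Job P.k Tx) → β) :
    Measurable fun ω => F ((X ω).party i) ((X ω).kind i) ((X ω).job i) :=
  measurable_cases (f := fun p ω => F p ((X ω).kind i) ((X ω).job i)) (h.party i hi) fun p _ =>
    measurable_cases (f := fun c ω => F p c ((X ω).job i)) (h.kind i hi) fun c _ =>
      h.ofJob (lt_of_lt_of_le hi h.le) (F p c)

theorem ht (h : Known X a b) {j : ℕ} (hj : j < a) : Measurable fun ω => (X ω).ht j :=
  h.ofJob hj fun v => Finset.univ.sup fun i : Fin P.n => (v (Sum.inl i)).top.length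

theorem hon (h : Known X a b) {i : ℕ} (hi : i < b) : Measurable fun ω => (X ω).Hon i :=
  h.ring hi fun p _ _ => p.isLeft = true

theorem ser (h : Known X a b) {i : ℕ} (hi : i < b) : Measurable fun ω => (X ω).Ser i :=
  h.ring hi fun p c v => (v p).isSer = true ∧ c = true

theorem par (h : Known X a b) {i : ℕ} (hi : i < b) : Measurable fun ω => (X ω).Par i :=
  h.ring hi fun p c v => (v p).isSer = false ∧ c = false

theorem tip_eq (h : Known X a b) {i : ℕ} (hi : i < b) (C : Chain P.k Tx) :
    Measurable fun ω => (X ω).tip i = C :=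
  h.ring hi fun p _ v => (v p).top = C

theorem length_tip (h : Known X a b) {i : ℕ} (hi : i < b) :
    Measurable fun ω => ((X ω).tip i).length :=
  h.ring hi fun p _ v => (v p).top.length

theorem advSer (h : Known X a b) {i : ℕ} (hi : i < b) : Measurable fun ω => (X ω).AdvSer i :=
  (h.hon hi).not.and (h.ser hi)

theorem advPar (h : Known X a b) {i : ℕ} (hi : i < b) : Measurable fun ω => (X ω).AdvPar i :=
  (h.hon hi).not.and (h.par hi)

theorem honSer (h : Known X a b) {i : ℕ} (hi : i < b) : Measurable fun ω => (X ω).HonSer i :=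
  (h.hon hi).and (h.ser hi)

theorem complete (h : Known X a b) {j : ℕ} (hj : j < a) (hj' : j ≤ b) :
    Measurable fun ω => (X ω).Complete j := by
  unfold Complete
  refine Measurable.or ?_ (Measurable.exists fun C => Measurable.and ?_ ?_)
  · exact h.ofJob hj fun v => ∃ i : Fin P.n, (v (Sum.inl i)).isSer = true ∧
      (v (Sum.inl i)).top.length = Finset.univ.sup fun i : Fin P.n => (v (Sum.inl i)).top.length
  · exact measurable_eq_of measurable_const (h.ht hj)
  · simp only [Finset.range_eq_Ico, ← cnt_eq_card]
    exact measurable_le_of measurable_const (measurable_cnt (z := 0) (t := j)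
      (p := fun ω i => ((X ω).Hon i ∧ (X ω).Par i) ∧ (X ω).tip i = C) fun i hi =>
      ((h.hon (by omega)).and (h.par (by omega))).and (h.tip_eq (by omega) C))

theorem ready (h : Known X a b) {j : ℕ} (hj : j < a) (hj' : j ≤ b) :
    Measurable fun ω => (X ω).Ready j :=
  measurable_exists_of (q := fun j' => j' ≤ j) fun j' h' =>
    (measurable_eq_of (h.ht (by omega)) (h.ht hj)).and (h.complete (by omega) (by omega))

theorem switch (h : Known X a b) {j : ℕ} (hj : j < a) : Measurable fun ω => (X ω).Switch j :=
  Measurable.or measurable_const (measurable_lt_of (h.ht (by omega)) (h.ht hj))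

theorem special (h : Known X a b) {j : ℕ} (hj : j < a) (hj' : j ≤ b) :
    Measurable fun ω => (X ω).Special j :=
  (h.switch hj).or ((h.ready hj hj').and (h.ready (by omega) (by omega)).not)

theorem lastSp (h : Known X a b) {j : ℕ} (hj : j < a) (hj' : j ≤ b) :
    Measurable fun ω => (X ω).lastSp j :=
  measurable_findGreatest fun _ hk => (h.special (by omega) (by omega)).setOf

theorem time (h : Known X a b) {j : ℕ} (hj : j < a) : Measurable fun ω => (X ω).time j := by
  unfold Trace.time
  refine Finset.measurable_fun_sum _ fun i hi => h.gap i ?_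
  rw [Finset.mem_range] at hi
  omega

theorem time_lastSp (h : Known X a b) {j : ℕ} (hj : j < a) (hj' : j ≤ b) :
    Measurable fun ω => (X ω).time ((X ω).lastSp j) := by
  refine measurable_cases (ν := fun ω => (X ω).lastSp j) (f := fun i ω => (X ω).time i)
    (measurable_eq_nat (h.lastSp hj hj')) fun i hi => h.time ?_
  obtain ⟨ω, rfl⟩ := hi
  exact lt_of_le_of_lt (lastSp_le j) hj

theorem prod (h : Known X a b) {j : ℕ} (hj : j < a) (hj' : j ≤ b) (δ : ℝ) :
    Measurable fun ω => (X ω).Prod δ j :=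
  (measurable_lt_of (h.lastSp hj hj') measurable_const).and
    (measurable_le_of ((h.time_lastSp hj hj').add_const δ) (h.time hj))

theorem lag (h : Known X a b) {j : ℕ} (hj : j < a) (hj' : j ≤ b) :
    Measurable fun ω => (X ω).lag j :=
  measurable_const.max (((h.time_lastSp hj hj').add_const _).sub (h.time hj))

theorem prodPar (h : Known X a b) {i : ℕ} (hi : i < b) (δ : ℝ) :
    Measurable fun ω => (X ω).ProdPar δ i :=
  have := h.le
  ((h.hon hi).and (h.par hi)).and (h.prod (by omega) hi.le δ)

theorem prodSer (h : Known X a b) {i : ℕ} (hi : i < b) (δ : ℝ) :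
    Measurable fun ω => (X ω).ProdSer δ i :=
  have := h.le
  (h.honSer hi).and (h.prod (by omega) hi.le δ)

theorem extraSer (h : Known X a b) {i : ℕ} (hi : i < b) (δ : ℝ) :
    Measurable fun ω => (X ω).ExtraSer δ i :=
  have := h.le
  (h.honSer hi).and (h.prod (by omega) hi.le δ).not

theorem sib (h : Known X a b) {t : ℕ} (ht : t < a) (ht' : t ≤ b) :
    Measurable fun ω => (X ω).sib t :=
  measurable_cnt fun i hi => (h.advSer (by omega)).and
    (measurable_eq_of ((h.length_tip (by omega)).add_const 1) (h.ht ht))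

theorem zeroStock (h : Known X a b) {t : ℕ} (ht : t < a) (ht' : t ≤ b) :
    Measurable fun ω => (X ω).ZeroStock t :=
  (h.switch ht).and (measurable_forall_of (q := fun i => i < t) fun i hi =>
    (h.ser (by omega)).imp
      (measurable_le_of ((h.length_tip (by omega)).add_const 1) (h.ht ht)))

theorem lastZs (h : Known X a b) {t : ℕ} (ht : t < a) (ht' : t ≤ b) :
    Measurable fun ω => (X ω).lastZs t :=
  measurable_findGreatest fun _ hk => (h.zeroStock (by omega) (by omega)).setOf

theorem base (h : Known X a b) {z : ℕ} (hz : z ≤ b) : Measurable fun ω => (X ω).Base z := by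
  unfold Base
  by_cases h0 : z = 0
  · simp [h0]
  · exact Measurable.or measurable_const (measurable_const.and ((h.honSer (by omega)).and
      (measurable_forall_of (q := fun i => i < z - 1) fun i hi => (h.ser (by omega)).imp
        (measurable_lt_of (h.length_tip (by omega)) (h.length_tip (by omega))))))

theorem round (h : Known X a b) {z : ℕ} (hz : z ≤ b) : Measurable fun ω => (X ω).round z := by
  simp only [round_eq]
  exact measurable_cnt fun i hi => h.honSer (by omega)

theorem adv (h : Known X a b) {i : ℕ} (hi : i < b) (δ om d : ℝ) :
    Measurable fun ω => (X ω).adv δ om d i := by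
  have := h.le
  exact (((((measurable_ite_const (h.special (by omega) hi.le) _ _).add
    (measurable_ite_const (h.advSer hi) _ _)).add (measurable_ite_const (h.advPar hi) _ _)).sub
    (measurable_ite_const (h.prodPar hi δ) _ _)).sub
    (measurable_ite_const (h.prodSer hi δ) _ _)).add (measurable_ite_const (h.extraSer hi δ) _ _)

theorem advSum (h : Known X a b) {t : ℕ} (ht : t ≤ b) (δ om d : ℝ) (z : ℕ) :
    Measurable fun ω => (X ω).advSum δ om d z t :=
  Finset.measurable_fun_sum _ fun i hi => h.adv (by rw [Finset.mem_Ico] at hi; omega) δ om d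

theorem gainSum (h : Known X a b) {t : ℕ} (ht : t ≤ b) (z : ℕ) :
    Measurable fun ω => (X ω).gainSum z t :=
  Finset.measurable_fun_sum _ fun i hi => by
    rw [Finset.mem_Ico] at hi
    exact ((measurable_ite_const (h.advSer (by omega)) _ _).add
      (measurable_ite_const (h.advPar (by omega)) _ _)).add
      (measurable_ite_const (h.extraSer (by omega) _) _ _)

theorem progSum (h : Known X a b) {t : ℕ} (ht : t ≤ b) (δ om fd : ℝ) (z : ℕ) :
    Measurable fun ω => (X ω).progSum δ om fd z t :=
  Finset.measurable_fun_sum _ fun i hi => by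
    rw [Finset.mem_Ico] at hi
    have := h.le
    exact ((measurable_ite_const (h.special (by omega) (by omega)) _ _).add
      (measurable_ite_const (h.prodPar (by omega) δ) _ _)).add
      (measurable_ite_const (h.prodSer (by omega) δ) _ _)

theorem expo (h : Known X a b) {t z : ℕ} (ht : t ≤ b) (hz : z < a) (hz' : z ≤ b) (M : Mode) :
    Measurable fun ω => (X ω).expo z t M := by
  have h1 : Measurable fun ω => eta * ((X ω).advSum P.δ P.om P.d z t +
      57 / 100 * (P.k * P.om) * (X ω).sib z) :=
    ((h.advSum ht P.δ P.om P.d z).add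
      ((measurable_from_nat (f := fun i : ℕ => (i : ℝ))).comp (h.sib hz hz') |>.const_mul _)).const_mul _
  cases M with
  | idle => exact h1
  | attempt s => exact h1
  | pending s e =>
    exact (((h.advSum ht P.δ P.om P.d e).sub_const 56).const_mul _).add
      ((h.gainSum ht e).const_mul _)

theorem corr (h : Known X a b) {t : ℕ} (ht : t ≤ b) (M : Mode) :
    Measurable fun ω => (X ω).corr t M := by
  cases M with
  | idle => exact measurable_const
  | pending s e => exact measurable_const
  | attempt s => exact ((h.progSum ht P.δ P.om P.fd s).const_add _).exp

theorem disc (h : Known X a b) {t : ℕ} (ht : t ≤ b) (z : ℕ) :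
    Measurable fun ω => (X ω).disc z t := by
  refine (Measurable.const_mul ?_ _).exp
  exact (measurable_from_nat (f := fun i : ℕ => (i : ℝ))).comp
    (measurable_cnt fun i hi => h.ser (by omega))

theorem updMode (h : Known X a b) {t : ℕ} (ht : t < a) (ht' : t ≤ b) {M : Mode}
    (hM : ∀ s, M = .attempt s → s ≤ t) (M' : Mode) :
    Measurable fun ω => (X ω).updMode t M = M' := by
  cases M with
  | idle =>
    simp only [Trace.updMode]
    exact measurable_ite_eq ((h.zeroStock ht ht').and
      (measurable_le_of (h.sib ht ht') measurable_const)) _ _ _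
  | attempt s =>
    have := hM s rfl
    simp only [Trace.updMode]
    exact measurable_ite_eq ((h.zeroStock ht ht').and
      (measurable_le_of ((h.ht (lt_of_le_of_lt this ht)).add_const _) (h.ht ht))) _ _ _
  | pending s e => simp only [Trace.updMode]; exact measurable_const

theorem markMode (h : Known X a b) {t : ℕ} (ht : t < b) (M M' : Mode) :
    Measurable fun ω => (X ω).markMode P.δ P.om P.d t M = M' := by
  cases M with
  | idle => simp only [Trace.markMode]; exact measurable_const
  | attempt s =>
    simp only [Trace.markMode]
    exact measurable_ite_eq ((h.advSer ht).or (h.extraSer ht _)) _ _ _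
  | pending s e =>
    simp only [Trace.markMode]
    exact measurable_ite_eq (measurable_le_of measurable_const (h.advSum ht _ _ _ _)) _ _ _

/-- Measurability of the mode is an assumption here so that this can serve as the induction step in
`md`. -/
theorem mdPre_of (h : Known X a b) (hX : ∀ ω, (X ω).Follows P.δ) {z t : ℕ} (ht : t < a)
    (ht' : t ≤ b) (hmd : ∀ M, Measurable fun ω => (X ω).md z t = M) (M : Mode) :
    Measurable fun ω => (X ω).mdPre z t = M := by
  refine measurable_cases (ν := fun ω => (X ω).md z t)
    (f := fun M' ω => (X ω).updMode t M' = M) hmd fun M' hM' => h.updMode ht ht' ?_ M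
  rintro s rfl
  obtain ⟨ω, hω⟩ := hM'
  have h1 := (hX ω).modeInv (om := P.om) (d := P.d) z t
  rw [md] at hω
  rw [hω] at h1
  exact h1.1.le

theorem md (h : Known X a b) (hX : ∀ ω, (X ω).Follows P.δ) {z t : ℕ} (ht : t ≤ b) (M : Mode) :
    Measurable fun ω => (X ω).md z t = M := by
  induction t generalizing M with
  | zero =>
    have : ∀ ω, (X ω).md z 0 = .idle := fun ω => rfl
    simp [this]
  | succ t ih =>
    by_cases hz : t < z
    · have : ∀ ω, (X ω).md z (t + 1) = .idle := fun ω => mode_of_le (by omega)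
      simp [this]
    · have : ∀ ω, (X ω).md z (t + 1) = (X ω).markMode P.δ P.om P.d t ((X ω).mdPre z t) :=
        fun ω => mode_succ (by omega)
      simp only [this]
      have hle := h.le
      exact measurable_cases (ν := fun ω => (X ω).mdPre z t)
        (f := fun M' ω => (X ω).markMode P.δ P.om P.d t M' = M)
        (h.mdPre_of hX (by omega) (by omega) fun M => ih (by omega) M)
        fun M' _ => h.markMode (by omega) M' M

theorem mdPre (h : Known X a b) (hX : ∀ ω, (X ω).Follows P.δ) {z t : ℕ} (ht : t < a)
    (ht' : t ≤ b) (M : Mode) : Measurable fun ω => (X ω).mdPre z t = M :=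
  h.mdPre_of hX ht ht' (fun M => h.md hX ht' M) M

theorem expo_lastZs (h : Known X a b) {j t : ℕ} (ht : t ≤ b) (hj : j < a) (hj' : j ≤ b)
    {ν : Ω → Mode} (hν : ∀ M, Measurable fun ω => ν ω = M) :
    Measurable fun ω => (X ω).expo ((X ω).lastZs j) t (ν ω) := by
  refine measurable_cases (f := fun M ω => (X ω).expo ((X ω).lastZs j) t M) hν fun M _ => ?_
  refine measurable_cases (ν := fun ω => (X ω).lastZs j) (f := fun z ω => (X ω).expo z t M)
    (measurable_eq_nat (h.lastZs hj hj')) fun z hz => ?_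
  obtain ⟨ω, rfl⟩ := hz
  have := lastZs_le (X := X ω) j
  exact h.expo ht (by omega) (by omega) M

theorem mainCoeff (h : Known X a b) (hX : ∀ ω, (X ω).Follows P.δ) {z t : ℕ} (ht0 : 0 < t)
    (ht : t ≤ b) : Measurable fun ω => (X ω).mainCoeff z t := by
  have := h.le
  exact (h.disc ht z).mul
    (h.expo_lastZs ht (by omega) (by omega) fun M => h.md hX ht M).exp

theorem corrCoeff (h : Known X a b) (hX : ∀ ω, (X ω).Follows P.δ) {z t : ℕ}
    (ht : t ≤ b) : Measurable fun ω => (X ω).corrCoeff z t :=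
  (h.disc ht z).mul (measurable_cases (ν := fun ω => (X ω).md z t)
    (f := fun M ω => (X ω).corr t M) (fun M => h.md hX ht M) fun M _ => h.corr ht M)

theorem ofMd (h : Known X a b) (hX : ∀ ω, (X ω).Follows P.δ) {z t : ℕ} (ht : t ≤ b)
    {β : Type*} [MeasurableSpace β] (F : Mode → β) : Measurable fun ω => F ((X ω).md z t) :=
  measurable_cases (ν := fun ω => (X ω).md z t) (f := fun M _ => F M) (fun M => h.md hX ht M)
    fun _ _ => measurable_const

theorem ofMdPre (h : Known X a b) (hX : ∀ ω, (X ω).Follows P.δ) {z t : ℕ} (ht : t < a)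
    (ht' : t ≤ b) {β : Type*} [MeasurableSpace β] (F : Mode → β) :
    Measurable fun ω => F ((X ω).mdPre z t) :=
  measurable_cases (ν := fun ω => (X ω).mdPre z t) (f := fun M _ => F M)
    (fun M => h.mdPre hX ht ht' M) fun _ _ => measurable_const

theorem pot (h : Known X a b) (hX : ∀ ω, (X ω).Follows P.δ) {z t : ℕ} (ht0 : 0 < t)
    (ht : t ≤ b) : Measurable fun ω => (X ω).pot z t := by
  have := h.le
  have hl := h.lag (j := t - 1) (by omega) (by omega)
  simp only [pot_eq]
  exact ((h.mainCoeff hX ht0 ht).mul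
    ((((h.ofMd hX ht Mode.rate).const_mul _).mul_const _).mul hl).exp).sub
    ((h.corrCoeff hX ht).mul (hl.const_mul _).exp)

theorem sp (h : Known X a b) {t : ℕ} (ht : t < a) (ht' : t ≤ b) :
    Measurable fun ω => (X ω).sp t :=
  measurable_ite_const (h.special ht ht') _ _

theorem preMain (h : Known X a b) (hX : ∀ ω, (X ω).Follows P.δ) {z t : ℕ} (ht : t < a)
    (ht' : t ≤ b) : Measurable fun ω => (X ω).preMain z t := by
  have hr := h.ofMdPre hX (z := z) ht ht' Mode.rate
  exact (h.disc ht' z).mul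
    (((h.expo_lastZs ht' ht ht' fun M => h.mdPre hX ht ht' M).sub
      ((hr.mul_const _).mul (h.sp ht ht'))).exp.mul
      (((hr.const_mul _).mul_const _).mul (h.lag ht ht')).exp)

theorem preCorr (h : Known X a b) (hX : ∀ ω, (X ω).Follows P.δ) {z t : ℕ} (ht : t < a)
    (ht' : t ≤ b) : Measurable fun ω => (X ω).preCorr z t :=
  (h.disc ht' z).mul
    (((measurable_cases (ν := fun ω => (X ω).mdPre z t) (f := fun M ω => (X ω).corr t M)
      (fun M => h.mdPre hX ht ht' M) fun M _ => h.corr ht' M).mul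
      ((h.sp ht ht').const_mul _).exp).mul ((h.lag ht ht').const_mul _).neg.exp)

end Known
end Trace
end Measurability
end Interlude

/-! ### The exponential gap and the independence of the marks. -/

namespace Interlude

section Probability

open scoped Classical

/-! ### The exponential gap -/

theorem measurable_kern (R : ℝ) : Measurable fun x : ℝ × ℝ × ℝ => kern R x.1 x.2.1 x.2.2 := by
  unfold kern
  refine Measurable.mul ?_ (Measurable.const_add (Measurable.ite ?_ ?_ ?_) _)
  · exact (measurable_fst.mul (measurable_const.max
      (measurable_snd.fst.sub measurable_snd.snd))).exp
  · exact measurableSet_lt measurable_snd.snd measurable_snd.fst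
  · exact measurable_fst.div_const _
  · exact measurable_const

theorem expMeasure_eq (R : ℝ) : expMeasure R = volume.withDensity (exponentialPDF R) := rfl

theorem measurable_exponentialPDF (R : ℝ) : Measurable (exponentialPDF R) :=
  (measurable_exponentialPDFReal R).ennreal_ofReal

theorem expMeasure_Iio_zero (R : ℝ) : expMeasure R (Set.Iio 0) = 0 := by
  rw [expMeasure_eq, withDensity_apply _ measurableSet_Iio]
  exact lintegral_exponentialPDF_of_nonpos le_rfl

theorem expMeasure_Ici {R u : ℝ} (hR : 0 < R) (hu : 0 ≤ u) :
    expMeasure R (Set.Ici u) = ENNReal.ofReal (Real.exp (-(R * u))) := by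
  have hprob := isProbabilityMeasure_expMeasure hR
  have h1 : expMeasure R (Set.Iio u) = ENNReal.ofReal (1 - Real.exp (-(R * u))) := by
    rw [expMeasure_eq, withDensity_apply _ measurableSet_Iio,
      setLIntegral_congr Iio_ae_eq_Iic, lintegral_exponentialPDF_eq_antiDeriv hR, if_pos hu]
  rw [← Set.compl_Iio, prob_compl_eq_one_sub measurableSet_Iio, h1,
    ← ENNReal.ofReal_one, ← ENNReal.ofReal_sub]
  · congr 1; ring
  · rw [sub_nonneg, Real.exp_le_one_iff]
    have := mul_nonneg hR.le hu
    linarith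

/-- On [0, u) the density times the kernel is the derivative of −exp(su − (R + s)g). -/
theorem setLIntegral_kern {R s u : ℝ} (hR : 0 < R) (hs : -R ≤ s) (hu : 0 ≤ u) :
    ∫⁻ g in Set.Iio u, ENNReal.ofReal (kern R s u g) ∂(expMeasure R) =
      ENNReal.ofReal (Real.exp (s * u) - Real.exp (-(R * u))) := by
  have hm : Measurable fun g => ENNReal.ofReal (kern R s u g) :=
    ((measurable_kern R).comp (measurable_const.prodMk
      (measurable_const.prodMk measurable_id))).ennreal_ofReal
  rw [expMeasure_eq, setLIntegral_withDensity_eq_setLIntegral_mul _ (measurable_exponentialPDF R) hm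
    measurableSet_Iio]
  have h1 : ∀ g ∈ Set.Ico 0 u, exponentialPDF R g * ENNReal.ofReal (kern R s u g) =
      ENNReal.ofReal ((R + s) * Real.exp (s * u - (R + s) * g)) := by
    intro g hg
    rw [exponentialPDF_of_nonneg hg.1, ← ENNReal.ofReal_mul (by positivity)]
    congr 1
    unfold kern
    rw [if_pos hg.2, max_eq_right (by linarith [hg.2]),
      show s * u - (R + s) * g = -(R * g) + s * (u - g) by ring, Real.exp_add]
    field_simp
  have h2 : ∫⁻ g in Set.Iio u, (exponentialPDF R * fun g => ENNReal.ofReal (kern R s u g)) g =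
      ∫⁻ g in Set.Ico 0 u, ENNReal.ofReal ((R + s) * Real.exp (s * u - (R + s) * g)) := by
    rw [← setLIntegral_congr_fun measurableSet_Ico h1, ← Set.Iio_union_Ico_eq_Iio hu,
      lintegral_union measurableSet_Ico]
    · have h3 : ∫⁻ g in Set.Iio 0, (exponentialPDF R * fun g => ENNReal.ofReal (kern R s u g)) g
          = 0 := by
        rw [setLIntegral_congr_fun (g := fun _ => 0) measurableSet_Iio, lintegral_zero]
        intro g hg
        simp [exponentialPDF_of_neg hg]
      rw [h3, zero_add]
      rfl
    · rw [Set.disjoint_left]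
      intro g h3 h4
      exact absurd h4.1 (not_le.2 h3)
  have hcont : Continuous fun g : ℝ => (R + s) * Real.exp (s * u - (R + s) * g) := by fun_prop
  rw [h2, setLIntegral_congr Ico_ae_eq_Ioc, ← ofReal_integral_eq_lintegral_ofReal]
  · rw [← intervalIntegral.integral_of_le hu,
      intervalIntegral.integral_eq_sub_of_hasDerivAt
        (f := fun g => -Real.exp (s * u - (R + s) * g))]
    · congr 1
      rw [show s * u - (R + s) * u = -(R * u) by ring]
      simp
      ring
    · intro g _
      have h3 : HasDerivAt (fun g : ℝ => s * u - (R + s) * g) (-((R + s) * 1)) g :=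
        ((hasDerivAt_id g).const_mul (R + s)).const_sub (s * u)
      have h4 : HasDerivAt (fun g : ℝ => -Real.exp (s * u - (R + s) * g))
        (-(Real.exp (s * u - (R + s) * g) * -((R + s) * 1))) g := h3.exp.neg
      rwa [show -(Real.exp (s * u - (R + s) * g) * -((R + s) * 1)) =
        (R + s) * Real.exp (s * u - (R + s) * g) by ring] at h4
    · exact hcont.intervalIntegrable _ _
  · exact (hcont.integrableOn_Icc (a := 0) (b := u)).mono_set Set.Ioc_subset_Icc_self
  · exact Filter.Eventually.of_forall fun g => mul_nonneg (by linarith) (Real.exp_pos _).le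

/-- Gaps beyond `u` contribute exp(−Ru), the part missing in `setLIntegral_kern`. Thus the drift
during the lag is compensated exactly by the shrinking of the lag. -/
theorem lintegral_kern {R s u : ℝ} (hR : 0 < R) (hs : -R ≤ s) (hu : 0 ≤ u) :
    ∫⁻ g, ENNReal.ofReal (kern R s u g) ∂(expMeasure R) = ENNReal.ofReal (Real.exp (s * u)) := by
  have h1 : ∫⁻ g in Set.Ici u, ENNReal.ofReal (kern R s u g) ∂(expMeasure R) =
      ENNReal.ofReal (Real.exp (-(R * u))) := by
    rw [setLIntegral_congr_fun (g := fun _ => 1) measurableSet_Ici, setLIntegral_one,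
      expMeasure_Ici hR hu]
    intro g hg
    have : ¬ g < u := not_lt.2 hg
    simp only [kern, this, if_false]
    rw [max_eq_left (by linarith [show u ≤ g from hg])]
    simp
  rw [← lintegral_add_compl _ (measurableSet_Iio (a := u)), Set.compl_Iio, h1,
    setLIntegral_kern hR hs hu, ← ENNReal.ofReal_add _ (Real.exp_pos _).le]
  · congr 1; ring
  · rw [sub_nonneg, Real.exp_le_exp]
    nlinarith

/-! ### Consequences of the law of the rings -/

instance (n m : ℕ) : MeasurableSingletonClass (Party n m) where
  measurableSet_singleton p := by
    rw [measurableSet_sum_iff]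
    exact ⟨MeasurableSet.of_discrete, MeasurableSet.of_discrete⟩

variable {P : Params} {Tx : Type*} {Ω : Type*} {mΩ : MeasurableSpace Ω}
  {μ : Measure Ω} {ℱ : Filtration ℕ mΩ} {X : Ω → Trace P.n P.m P.k Tx}

theorem measurable_of_measurableSet {Ω : Type*} {m : MeasurableSpace Ω} {p : Ω → Prop}
    (h : MeasurableSet[m] {ω | p ω}) : Measurable[m] p := measurableSet_setOfPred.1 h

theorem measurable_eq_of_forall {Ω ι β : Type*} [Countable ι] {m : MeasurableSpace Ω}
    {f : Ω → ι → β} (h : ∀ i x, MeasurableSet[m] {ω | f ω i = x}) (v : ι → β) :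
    Measurable[m] fun ω => f ω = v := by
  simp only [funext_iff]
  exact Measurable.forall fun i => measurable_of_measurableSet (h i (v i))

/-- The data of ring `j`. -/
def Trace.ringData (X : Ω → Trace P.n P.m P.k Tx) (j : ℕ) (ω : Ω) : Ring P.n P.m :=
  ((X ω).gap j, (X ω).party j, (X ω).kind j, (X ω).hash j)

/-- The information just before the mark of ring `t`. -/
@[reducible]
def preInfo (ℱ : Filtration ℕ mΩ) (X : Ω → Trace P.n P.m P.k Tx) (t : ℕ) : MeasurableSpace Ω :=
  ℱ t ⊔ MeasurableSpace.comap (fun ω => (X ω).gap t) inferInstance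

namespace IsExecution

theorem measurable_ringData (h : IsExecution P μ ℱ X) (j : ℕ) :
    Measurable[ℱ (j + 1)] (Trace.ringData X j) := h.ring_meas j

theorem measurable_gap (h : IsExecution P μ ℱ X) (j : ℕ) :
    Measurable[ℱ (j + 1)] fun ω => (X ω).gap j :=
  measurable_fst.comp (h.measurable_ringData j)

theorem measurable_party (h : IsExecution P μ ℱ X) (j : ℕ) :
    Measurable[ℱ (j + 1)] fun ω => (X ω).party j :=
  measurable_snd.fst.comp (h.measurable_ringData j)

theorem measurable_kind (h : IsExecution P μ ℱ X) (j : ℕ) :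
    Measurable[ℱ (j + 1)] fun ω => (X ω).kind j :=
  measurable_snd.snd.fst.comp (h.measurable_ringData j)

theorem preInfo_le (h : IsExecution P μ ℱ X) (t : ℕ) : preInfo ℱ X t ≤ ℱ (t + 1) :=
  sup_le (ℱ.mono (Nat.le_succ t)) (h.measurable_gap t).comap_le

theorem le_preInfo (t : ℕ) : ℱ t ≤ preInfo ℱ X t := le_sup_left

theorem measurable_job (h : IsExecution P μ ℱ X) (t : ℕ) (v : Party P.n P.m → Job P.k Tx) :
    Measurable[preInfo ℱ X t] fun ω => (X ω).job t = v :=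
  measurable_eq_of_forall (h.job_meas t) v

/-- Just before its mark, the job and the time of ring `t` are determined, hence `t + 1` against
`t`. -/
theorem known_pre (h : IsExecution P μ ℱ X) (t : ℕ) :
    @Trace.Known Ω (preInfo ℱ X t) P Tx X (t + 1) t := by
  refine @Trace.Known.mk Ω (preInfo ℱ X t) P Tx X (t + 1) t (fun i hi v => ?_) (fun i hi => ?_)
    (fun i hi p => ?_) (fun i hi c => ?_) (Nat.le_succ t)
  · rcases Nat.lt_or_eq_of_le (Nat.lt_succ_iff.1 hi) with h1 | rfl
    · exact (h.measurable_job i v).mono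
        (((h.preInfo_le i).trans (ℱ.mono h1)).trans (le_preInfo t)) le_rfl
    · exact h.measurable_job i v
  · rcases Nat.lt_or_eq_of_le (Nat.lt_succ_iff.1 hi) with h1 | rfl
    · exact (h.measurable_gap i).mono ((ℱ.mono h1).trans (le_preInfo t)) le_rfl
    · exact (comap_measurable _).mono le_sup_right le_rfl
  · refine measurable_of_measurableSet ?_
    exact ((ℱ.mono hi).trans (le_preInfo t)) _
      (h.measurable_party i (measurableSet_singleton p))
  · refine measurable_of_measurableSet ?_
    exact ((ℱ.mono hi).trans (le_preInfo t)) _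
      (h.measurable_kind i (measurableSet_singleton c))

theorem known (h : IsExecution P μ ℱ X) (t : ℕ) :
    @Trace.Known Ω (ℱ t) P Tx X t t :=
  @Trace.Known.mk Ω (ℱ t) P Tx X t t
    (fun i hi v => (h.measurable_job i v).mono ((h.preInfo_le i).trans (ℱ.mono hi)) le_rfl)
    (fun i hi => (h.measurable_gap i).mono (ℱ.mono hi) le_rfl)
    (fun i hi p => measurable_of_measurableSet
      ((ℱ.mono hi) _ (h.measurable_party i (measurableSet_singleton p))))
    (fun i hi c => measurable_of_measurableSet
      ((ℱ.mono hi) _ (h.measurable_kind i (measurableSet_singleton c)))) le_rfl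

theorem ringLaw_apply (hP : P.Admissible) {S : Set ℝ} (p : Party P.n P.m) (b : Bool) :
    ringLaw P (S ×ˢ ({p} ×ˢ ({b} ×ˢ Set.univ))) =
      expMeasure P.rate S * ENNReal.ofReal (P.markProb b) := by
  have hn := hP.n_pos_real
  have : IsProbabilityMeasure (expMeasure P.rate) := isProbabilityMeasure_expMeasure hP.rate_pos
  have hne : Nonempty (Party P.n P.m) := ⟨Sum.inl ⟨0, hP.n_pos⟩⟩
  have : IsProbabilityMeasure (uniformOn (Set.univ : Set (Party P.n P.m))) :=
    isProbabilityMeasure_uniformOn Set.finite_univ Set.univ_nonempty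
  unfold ringLaw
  rw [← Params.rate, Measure.prod_prod, Measure.prod_prod, Measure.prod_prod]
  congr 1
  have h1 : uniformOn (Set.univ : Set (Party P.n P.m)) {p} =
      ENNReal.ofReal (1 / ((P.n : ℝ) + P.m)) := by
    rw [uniformOn_univ, Measure.count_singleton, ENNReal.ofReal_div_of_pos (by positivity)]
    simp only [Fintype.card_sum, Fintype.card_fin, ENNReal.ofReal_one]
    rw [← Nat.cast_add, ENNReal.ofReal_natCast]
  have h2 : (ENNReal.ofReal (P.lam / (P.lam + P.β)) • Measure.dirac false +
      ENNReal.ofReal (P.β / (P.lam + P.β)) • Measure.dirac true : Measure Bool) {b} =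
      ENNReal.ofReal (P.kindProb b) := by
    cases b <;> simp [Params.kindProb]
  rw [h1, h2, Params.markProb, ENNReal.ofReal_mul (by positivity)]
  simp

theorem measure_ring (h : IsExecution P μ ℱ X) (hP : P.Admissible) (t : ℕ) {A : Set Ω}
    (hA : MeasurableSet[ℱ t] A) {S : Set ℝ} (hS : MeasurableSet S) (p : Party P.n P.m) (b : Bool) :
    μ (A ∩ (fun ω => (X ω).gap t) ⁻¹' S ∩ {ω | (X ω).party t = p ∧ (X ω).kind t = b}) =
      μ A * (expMeasure P.rate S * ENNReal.ofReal (P.markProb b)) := by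
  have hR : MeasurableSet (S ×ˢ ({p} ×ˢ ({b} ×ˢ Set.univ)) : Set (Ring P.n P.m)) :=
    hS.prod ((measurableSet_singleton p).prod ((measurableSet_singleton b).prod MeasurableSet.univ))
  have hset : A ∩ (fun ω => (X ω).gap t) ⁻¹' S ∩ {ω | (X ω).party t = p ∧ (X ω).kind t = b} =
      (Trace.ringData X t ⁻¹' (S ×ˢ ({p} ×ˢ ({b} ×ˢ Set.univ)))) ∩ A := by
    ext ω
    simp only [Trace.ringData, Set.mem_inter_iff, Set.mem_preimage, Set.mem_prod,
      Set.mem_singleton_iff, Set.mem_univ, Set.mem_ofPred_eq]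
    tauto
  have h1 := (Indep_iff _ _ μ).1 (h.ring_indep t) _ _ ⟨_, hR, rfl⟩ hA
  have h2 : μ (Trace.ringData X t ⁻¹' (S ×ˢ ({p} ×ˢ ({b} ×ˢ Set.univ)))) =
      ringLaw P (S ×ˢ ({p} ×ˢ ({b} ×ˢ Set.univ))) := by
    rw [← h.ring_law t, Measure.map_apply _ hR]
    · rfl
    · exact (h.measurable_ringData t).mono (ℱ.le _) le_rfl
  rw [hset, mul_comm (μ A), ← ringLaw_apply hP p b, ← h2]
  exact h1

theorem measure_gap (h : IsExecution P μ ℱ X) (hP : P.Admissible) (t : ℕ) {S : Set ℝ}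
    (hS : MeasurableSet S) : μ ((fun ω => (X ω).gap t) ⁻¹' S) = expMeasure P.rate S := by
  have hn := hP.n_pos_real
  have : IsProbabilityMeasure (expMeasure P.rate) := isProbabilityMeasure_expMeasure hP.rate_pos
  have hne : Nonempty (Party P.n P.m) := ⟨Sum.inl ⟨0, hP.n_pos⟩⟩
  have : IsProbabilityMeasure (uniformOn (Set.univ : Set (Party P.n P.m))) :=
    isProbabilityMeasure_uniformOn Set.finite_univ Set.univ_nonempty
  have h1 : (fun ω => (X ω).gap t) ⁻¹' S =
      Trace.ringData X t ⁻¹' (S ×ˢ (Set.univ ×ˢ (Set.univ ×ˢ Set.univ))) := by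
    ext ω
    simp [Trace.ringData]
  have hR : MeasurableSet (S ×ˢ (Set.univ ×ˢ (Set.univ ×ˢ Set.univ)) : Set (Ring P.n P.m)) :=
    hS.prod (MeasurableSet.univ.prod (MeasurableSet.univ.prod MeasurableSet.univ))
  have h2 : μ (Trace.ringData X t ⁻¹' (S ×ˢ (Set.univ ×ˢ (Set.univ ×ˢ Set.univ)))) =
      ringLaw P (S ×ˢ (Set.univ ×ˢ (Set.univ ×ˢ Set.univ))) := by
    rw [← h.ring_law t, Measure.map_apply _ hR]
    · rfl
    · exact (h.measurable_ringData t).mono (ℱ.le _) le_rfl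
  rw [h1, h2]
  unfold ringLaw
  rw [← Params.rate, Measure.prod_prod, Measure.prod_prod, Measure.prod_prod]
  have h3 : (ENNReal.ofReal (P.lam / (P.lam + P.β)) • Measure.dirac false +
      ENNReal.ofReal (P.β / (P.lam + P.β)) • Measure.dirac true : Measure Bool) Set.univ = 1 := by
    have h4 := hP.kindProb_add
    simp only [Params.kindProb, if_true, Bool.false_eq_true, if_false] at h4
    have := hP.lam_pos
    have := hP.β_pos
    simp only [Measure.coe_add, Measure.coe_smul, Pi.add_apply, Pi.smul_apply, smul_eq_mul,
      measure_univ, mul_one]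
    rw [← ENNReal.ofReal_add (by positivity) (by positivity), h4, ENNReal.ofReal_one]
  rw [h3]
  simp

theorem map_gap (h : IsExecution P μ ℱ X) (hP : P.Admissible) (t : ℕ) :
    μ.map (fun ω => (X ω).gap t) = expMeasure P.rate := by
  ext S hS
  rw [Measure.map_apply ((h.measurable_gap t).mono (ℱ.le _) le_rfl) hS, h.measure_gap hP t hS]

theorem ae_monotone (h : IsExecution P μ ℱ X) (hP : P.Admissible) :
    ∀ᵐ ω ∂μ, Monotone (X ω).time := by
  have h1 : ∀ᵐ ω ∂μ, ∀ t, 0 ≤ (X ω).gap t := by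
    rw [ae_all_iff]
    intro t
    have h2 := h.measure_gap hP t measurableSet_Iio (S := Set.Iio 0)
    rw [expMeasure_Iio_zero] at h2
    filter_upwards [compl_mem_ae_iff.2 h2] with ω hω
    exact not_lt.1 hω
  filter_upwards [h1] with ω hω
  refine monotone_nat_of_le_succ fun t => ?_
  unfold Trace.time
  rw [Finset.sum_range_succ _ (t + 1)]
  linarith [hω (t + 1)]

/-- The mark of a ring is independent of everything that is known just before. -/
theorem indepSets_mark [IsProbabilityMeasure μ] (h : IsExecution P μ ℱ X) (hP : P.Admissible) (t : ℕ)
    (p : Party P.n P.m) (b : Bool) {A : Set Ω} (hA : MeasurableSet[preInfo ℱ X t] A) :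
    μ (A ∩ {ω | (X ω).party t = p ∧ (X ω).kind t = b}) = μ A * ENNReal.ofReal (P.markProb b) := by
  set E : Set Ω := {ω | (X ω).party t = p ∧ (X ω).kind t = b} with hE
  have : IsProbabilityMeasure (expMeasure P.rate) := isProbabilityMeasure_expMeasure hP.rate_pos
  -- Events of the past intersected with events of the gap form a π-system generating `preInfo`. On
  -- it the product formula follows from the product form of `ringLaw`; a π-λ induction extends it.
  let S : Set (Set Ω) := {B | ∃ A S, MeasurableSet[ℱ t] A ∧ MeasurableSet S ∧
    B = A ∩ (fun ω => (X ω).gap t) ⁻¹' S}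
  have hgen : preInfo ℱ X t = MeasurableSpace.generateFrom S := by
    refine le_antisymm (sup_le ?_ ?_) (MeasurableSpace.generateFrom_le ?_)
    · intro B hB
      exact MeasurableSpace.measurableSet_generateFrom ⟨B, Set.univ, hB, MeasurableSet.univ, by simp⟩
    · rintro B ⟨S', hS', rfl⟩
      exact MeasurableSpace.measurableSet_generateFrom
        ⟨Set.univ, S', @MeasurableSet.univ _ (ℱ t), hS', by simp⟩
    · rintro B ⟨A, S', hA, hS', rfl⟩
      exact @MeasurableSet.inter _ (preInfo ℱ X t) _ _ (le_preInfo t _ hA)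
        ((le_sup_right : _ ≤ preInfo ℱ X t) _ ⟨S', hS', rfl⟩)
  have hpi : IsPiSystem S := by
    rintro B ⟨A, S', hA, hS', rfl⟩ B' ⟨A', S'', hA', hS'', rfl⟩ -
    refine ⟨A ∩ A', S' ∩ S'', @MeasurableSet.inter _ (ℱ t) _ _ hA hA', hS'.inter hS'', ?_⟩
    ext ω
    simp only [Set.mem_inter_iff, Set.mem_preimage]
    tauto
  have hle : preInfo ℱ X t ≤ mΩ := (h.preInfo_le t).trans (ℱ.le _)
  have hEm : MeasurableSet E := by
    have h1 := ((h.measurable_party t).mono (ℱ.le _) le_rfl) (measurableSet_singleton p)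
    have h2 := ((h.measurable_kind t).mono (ℱ.le _) le_rfl) (measurableSet_singleton b)
    exact h1.inter h2
  have hbasic : ∀ B ∈ S, μ (B ∩ E) = μ B * ENNReal.ofReal (P.markProb b) := by
    rintro B ⟨A, S', hA, hS', rfl⟩
    rw [h.measure_ring hP t hA hS' p b, ← mul_assoc]
    congr 1
    have h1 := (Indep_iff _ _ μ).1 (h.ring_indep t)
      (Trace.ringData X t ⁻¹' (Prod.fst ⁻¹' S')) _ ⟨_, measurable_fst hS', rfl⟩ hA
    have h2 : Trace.ringData X t ⁻¹' (Prod.fst ⁻¹' S') = (fun ω => (X ω).gap t) ⁻¹' S' := rfl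
    rw [h2, h.measure_gap hP t hS', Set.inter_comm] at h1
    rw [h1, mul_comm]
  have htop : μ (Set.univ ∩ E) = μ Set.univ * ENNReal.ofReal (P.markProb b) :=
    hbasic _ ⟨Set.univ, Set.univ, @MeasurableSet.univ _ (ℱ t), MeasurableSet.univ, by simp⟩
  have hfin : ENNReal.ofReal (P.markProb b) ≠ ⊤ := ENNReal.ofReal_ne_top
  induction A, hA using MeasurableSpace.induction_on_inter (m := preInfo ℱ X t) hgen hpi with
  | empty => simp
  | basic B hB => exact hbasic B hB
  | compl B hB ih =>
    have hB' := hle _ hB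
    have h1 : μ (Bᶜ ∩ E) = μ E - μ (B ∩ E) := by
      rw [← measure_sdiff Set.inter_subset_right (hB'.inter hEm).nullMeasurableSet
        (measure_ne_top _ _)]
      congr 1
      ext ω
      simp only [Set.mem_inter_iff, Set.mem_compl_iff, Set.mem_sdiff]
      tauto
    rw [Set.univ_inter] at htop
    rw [h1, ih, htop, measure_compl hB' (measure_ne_top _ _), ENNReal.sub_mul]
    intro _ _
    exact hfin
  | iUnion f hd hf ih =>
    rw [Set.iUnion_inter, measure_iUnion, measure_iUnion hd fun i => hle _ (hf i),
      ← ENNReal.tsum_mul_right]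
    · exact tsum_congr ih
    · exact fun i j hij => (hd hij).mono Set.inter_subset_left Set.inter_subset_left
    · exact fun i => (hle _ (hf i)).inter hEm

end IsExecution
end Probability
end Interlude

/-! ### The supermartingale property. -/

namespace Interlude

section Probability

open scoped Classical ENNReal

variable {P : Params} {Tx : Type*} {Ω : Type*} {mΩ : MeasurableSpace Ω}
  {μ : Measure Ω} {ℱ : Filtration ℕ mΩ} {X : Ω → Trace P.n P.m P.k Tx}

namespace IsExecution

/-- The integrand is split over the finitely many marks, each of which is independent of `preInfo`.
-/
theorem lintegral_mark [IsProbabilityMeasure μ] (h : IsExecution P μ ℱ X) (hP : P.Admissible)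
    (t : ℕ) {Y : Party P.n P.m → Bool → Ω → ℝ≥0∞}
    (hY : ∀ p b, Measurable[preInfo ℱ X t] (Y p b)) :
    ∫⁻ ω, Y ((X ω).party t) ((X ω).kind t) ω ∂μ =
      ∫⁻ ω, ∑ p, ∑ b, ENNReal.ofReal (P.markProb b) * Y p b ω ∂μ := by
  have hle : preInfo ℱ X t ≤ mΩ := (h.preInfo_le t).trans (ℱ.le _)
  have hYm : ∀ p b, Measurable (Y p b) := fun p b => (hY p b).mono hle le_rfl
  let E : Party P.n P.m → Bool → Set Ω := fun p b => {ω | (X ω).party t = p ∧ (X ω).kind t = b}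
  have hEm : ∀ p b, MeasurableSet (E p b) := by
    intro p b
    have h1 := ((h.measurable_party t).mono (ℱ.le _) le_rfl) (measurableSet_singleton p)
    have h2 := ((h.measurable_kind t).mono (ℱ.le _) le_rfl) (measurableSet_singleton b)
    exact h1.inter h2
  have h1 : ∀ ω, Y ((X ω).party t) ((X ω).kind t) ω =
      ∑ p, ∑ b, Y p b ω * (E p b).indicator (fun _ => 1) ω := by
    intro ω
    rw [Finset.sum_eq_single ((X ω).party t), Finset.sum_eq_single ((X ω).kind t)]
    · simp [E]
    · intro b _ hb
      simp [E, Ne.symm hb]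
    · simp
    · intro p _ hp
      refine Finset.sum_eq_zero fun b _ => ?_
      simp [E, Ne.symm hp]
    · simp
  have hm1 : ∀ p b, Measurable fun ω => Y p b ω * (E p b).indicator (fun _ => (1 : ℝ≥0∞)) ω :=
    fun p b => (hYm p b).mul (measurable_const.indicator (hEm p b))
  have hm2 : ∀ p b, Measurable fun ω => ENNReal.ofReal (P.markProb b) * Y p b ω :=
    fun p b => (hYm p b).const_mul _
  simp_rw [h1]
  rw [lintegral_finsetSum _ fun p _ => Finset.measurable_fun_sum _ fun b _ => hm1 p b,
    lintegral_finsetSum _ fun p _ => Finset.measurable_fun_sum _ fun b _ => hm2 p b]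
  refine Finset.sum_congr rfl fun p _ => ?_
  rw [lintegral_finsetSum _ fun b _ => hm1 p b, lintegral_finsetSum _ fun b _ => hm2 p b]
  refine Finset.sum_congr rfl fun b _ => ?_
  have h2 : μ (E p b) = ENNReal.ofReal (P.markProb b) := by
    have := h.indepSets_mark hP t p b (A := Set.univ) (@MeasurableSet.univ _ (preInfo ℱ X t))
    simpa [E] using this
  rw [lintegral_mul_indicator_eq_lintegral_mul_lintegral_indicator hle 1 (hEm p b) _ (hY p b),
    lintegral_indicator_const (hEm p b), h2, one_mul, lintegral_const_mul _ (hYm p b), mul_comm]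
  rw [IndepSets_iff]
  rintro A B hA hB
  rw [Set.mem_singleton_iff.1 hB, h2]
  exact h.indepSets_mark hP t p b hA

/-- The gap is independent of the past, so it may be integrated out for fixed `Z`, `s` and `u`. -/
theorem lintegral_gap [IsProbabilityMeasure μ] (h : IsExecution P μ ℱ X) (hP : P.Admissible)
    (t : ℕ) {Z : Ω → ℝ≥0∞} {s u : Ω → ℝ} (hZ : Measurable[ℱ t] Z) (hs : Measurable[ℱ t] s)
    (hu : Measurable[ℱ t] u) (hs0 : ∀ ω, -P.rate ≤ s ω) (hu0 : ∀ ω, 0 ≤ u ω) :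
    ∫⁻ ω, Z ω * ENNReal.ofReal (kern P.rate (s ω) (u ω) ((X ω).gap t)) ∂μ =
      ∫⁻ ω, Z ω * ENNReal.ofReal (Real.exp (s ω * u ω)) ∂μ := by
  let f : Ω → ℝ≥0∞ × ℝ × ℝ := fun ω => (Z ω, s ω, u ω)
  let g : Ω → ℝ := fun ω => (X ω).gap t
  have : IsProbabilityMeasure (expMeasure P.rate) := isProbabilityMeasure_expMeasure hP.rate_pos
  have hft : Measurable[ℱ t] f := hZ.prodMk (hs.prodMk hu)
  have hf : Measurable f := hft.mono (ℱ.le t) le_rfl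
  have hg : Measurable g := (h.measurable_gap t).mono (ℱ.le _) le_rfl
  have hind : IndepFun f g μ := by
    refine indep_of_indep_of_le_left (indep_of_indep_of_le_right (h.ring_indep t).symm ?_)
      hft.comap_le
    rintro _ ⟨S, hS, rfl⟩
    exact ⟨Prod.fst ⁻¹' S, measurable_fst hS, rfl⟩
  have hmap := (indepFun_iff_map_prod_eq_prod_map_map hf.aemeasurable hg.aemeasurable).1 hind
  let F : (ℝ≥0∞ × ℝ × ℝ) × ℝ → ℝ≥0∞ := fun x =>
    x.1.1 * ENNReal.ofReal (kern P.rate x.1.2.1 x.1.2.2 x.2)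
  have hF : Measurable F :=
    measurable_fst.fst.mul ((measurable_kern P.rate).comp (measurable_fst.snd.fst.prodMk
      (measurable_fst.snd.snd.prodMk measurable_snd))).ennreal_ofReal
  calc _ = ∫⁻ ω, F (f ω, g ω) ∂μ := rfl
    _ = ∫⁻ x, F x ∂(μ.map fun ω => (f ω, g ω)) := (lintegral_map hF (hf.prodMk hg)).symm
    _ = ∫⁻ x, ∫⁻ y, F (x, y) ∂(expMeasure P.rate) ∂(μ.map f) := by
      rw [hmap, h.map_gap hP t, lintegral_prod _ hF.aemeasurable]
    _ = ∫⁻ ω, ∫⁻ y, F (f ω, y) ∂(expMeasure P.rate) ∂μ :=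
      lintegral_map hF.lintegral_prod_right' hf
    _ = _ := by
      refine lintegral_congr fun ω => ?_
      have hk : Measurable fun y => ENNReal.ofReal (kern P.rate (s ω) (u ω) y) :=
        ((measurable_kern P.rate).comp (measurable_const.prodMk
          (measurable_const.prodMk measurable_id))).ennreal_ofReal
      simp only [F, f]
      rw [lintegral_const_mul _ hk, lintegral_kern hP.rate_pos (hs0 ω) (hu0 ω)]

end IsExecution

namespace Trace

theorem cnt_le_sub (z t : ℕ) (p : ℕ → Prop) : cnt z t p ≤ t := by
  unfold cnt
  refine (Finset.card_filter_le _ _).trans ?_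
  rw [Nat.card_Ico]
  omega

theorem disc_le (Y : Trace P.n P.m P.k Tx) (z t : ℕ) : Y.disc z t ≤ Real.exp (decay * t) := by
  refine Real.exp_le_exp.2 (mul_le_mul_of_nonneg_left ?_ decay_pos.le)
  exact_mod_cast cnt_le_sub z t _

/-- Deterministic bounds on the correction terms make their integrals finite, so that they can be
cancelled. -/
theorem Follows.corrCoeff_le {Y : Trace P.n P.m P.k Tx} (hP : P.Admissible) (hY : Y.Follows P.δ)
    (hm : Monotone Y.time) (z t : ℕ) : Y.corrCoeff z t ≤ Real.exp (decay * t) := by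
  have h1 := (hY.modeInv (om := P.om) (d := P.d) z t).corr_le hP hY hm
  calc Y.corrCoeff z t ≤ Y.disc z t * 1 :=
        mul_le_mul_of_nonneg_left (by linarith) (disc_pos z t).le
    _ ≤ _ := by rw [mul_one]; exact disc_le Y z t

theorem Follows.preCorr_le {Y : Trace P.n P.m P.k Tx} (hP : P.Admissible) (hY : Y.Follows P.δ)
    (hm : Monotone Y.time) (z t : ℕ) :
    Y.preCorr z t ≤ Real.exp (decay * t) * Real.exp P.fd := by
  have h1 := (hY.modeInv (om := P.om) (d := P.d) z t).corr_le hP hY hm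
  have h2 : Y.corr t (Y.mdPre z t) ≤ 1 := by
    unfold mdPre md
    cases hM : Y.mode P.δ P.om P.d z t with
    | idle =>
      simp only [updMode]
      split_ifs
      · simp only [corr, progSum, Finset.Ico_self, Finset.sum_empty, add_zero]
        exact Real.exp_le_one_iff.2 (by norm_num)
      · simp [corr]
    | attempt s =>
      rw [hM] at h1
      simp only [updMode]
      split_ifs
      · simp [corr]
      · linarith
    | pending s e => simp [updMode, corr]
  have h3 : Real.exp (P.fd * Y.sp t) ≤ Real.exp P.fd := by
    refine Real.exp_le_exp.2 ?_
    have := hP.fd_nonneg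
    unfold sp
    split_ifs <;> linarith
  have h4 : Real.exp (-(2 * P.β * Y.lag t)) ≤ 1 :=
    Real.exp_le_one_iff.2 (by have := mul_nonneg hP.β_pos.le (lag_nonneg (X := Y) t); linarith)
  have h5 := corr_nonneg (X := Y) t (Y.mdPre z t)
  unfold preCorr
  refine mul_le_mul (disc_le Y z t) ?_ (by positivity) (by positivity)
  calc _ ≤ 1 * Real.exp P.fd * 1 := by gcongr
    _ = _ := by ring

theorem corrCoeff_nonneg {Y : Trace P.n P.m P.k Tx} (z t : ℕ) : 0 ≤ Y.corrCoeff z t :=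
  mul_nonneg (disc_pos z t).le (corr_nonneg t _)

theorem mainCoeff_nonneg {Y : Trace P.n P.m P.k Tx} (z t : ℕ) : 0 ≤ Y.mainCoeff z t :=
  mul_nonneg (disc_pos z t).le (Real.exp_pos _).le

theorem preCorr_nonneg {Y : Trace P.n P.m P.k Tx} (z t : ℕ) : 0 ≤ Y.preCorr z t := by
  have := corr_nonneg (X := Y) t (Y.mdPre z t)
  have := disc_pos (X := Y) z t
  unfold preCorr
  positivity

theorem preMain_nonneg {Y : Trace P.n P.m P.k Tx} (z t : ℕ) : 0 ≤ Y.preMain z t := by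
  have := disc_pos (X := Y) z t
  unfold preMain
  positivity

end Trace

namespace IsExecution

/-- A product of a measurable function of the past and a function of finitely many discrete data. -/
theorem measurable_fac {m : MeasurableSpace Ω} {A : Set Ω} (hA : MeasurableSet[m] A) {f g : Ω → ℝ}
    (hf : Measurable[m] f) (hg : Measurable[m] g) :
    Measurable[m] fun ω => A.indicator (fun _ => (1 : ℝ≥0∞)) ω * ENNReal.ofReal (f ω * g ω) :=
  (Measurable.indicator measurable_const hA).mul (hf.mul hg).ennreal_ofReal

theorem lintegral_mark_fac [IsProbabilityMeasure μ] (h : IsExecution P μ ℱ X) (hP : P.Admissible)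
    (t : ℕ) {A : Set Ω} (hA : MeasurableSet[ℱ t] A) {f : Ω → ℝ} (hf0 : ∀ ω, 0 ≤ f ω)
    (hf : Measurable[preInfo ℱ X t] f) {g : Party P.n P.m → Bool → Ω → ℝ}
    (hg0 : ∀ p b ω, 0 ≤ g p b ω) (hg : ∀ p b, Measurable[preInfo ℱ X t] (g p b)) :
    ∫⁻ ω, A.indicator (fun _ => (1 : ℝ≥0∞)) ω *
      ENNReal.ofReal (f ω * g ((X ω).party t) ((X ω).kind t) ω) ∂μ =
    ∫⁻ ω, A.indicator (fun _ => (1 : ℝ≥0∞)) ω *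
      ENNReal.ofReal (f ω * ∑ p, ∑ b, P.markProb b * g p b ω) ∂μ := by
  have hmp : ∀ b, 0 ≤ P.markProb b := fun b =>
    mul_nonneg (by positivity) (hP.kindProb_pos b).le
  rw [h.lintegral_mark hP t (Y := fun p b ω => A.indicator (fun _ => (1 : ℝ≥0∞)) ω *
    ENNReal.ofReal (f ω * g p b ω)) fun p b =>
      measurable_fac (le_preInfo t _ hA) hf (hg p b)]
  refine lintegral_congr fun ω => ?_
  have h1 : ENNReal.ofReal (f ω * ∑ p, ∑ b, P.markProb b * g p b ω) =
      ∑ p, ∑ b, ENNReal.ofReal (P.markProb b) * ENNReal.ofReal (f ω * g p b ω) := by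
    rw [Finset.mul_sum, ENNReal.ofReal_sum_of_nonneg]
    · refine Finset.sum_congr rfl fun p _ => ?_
      rw [Finset.mul_sum, ENNReal.ofReal_sum_of_nonneg]
      · refine Finset.sum_congr rfl fun b _ => ?_
        rw [← ENNReal.ofReal_mul (hmp b)]
        congr 1
        ring
      · exact fun b _ => mul_nonneg (hf0 ω) (mul_nonneg (hmp b) (hg0 p b ω))
    · exact fun p _ => mul_nonneg (hf0 ω)
        (Finset.sum_nonneg fun b _ => mul_nonneg (hmp b) (hg0 p b ω))
  rw [h1, Finset.mul_sum]
  refine Finset.sum_congr rfl fun p _ => ?_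
  rw [Finset.mul_sum]
  refine Finset.sum_congr rfl fun b _ => ?_
  ring

theorem measurable_decide {m : MeasurableSpace Ω} {p : Ω → Prop} (hp : Measurable[m] p)
    {β : Type*} [MeasurableSpace β] (F : Bool → β) :
    Measurable[m] fun ω => F (decide (p ω)) := by
  refine measurable_cases (ν := p) (f := fun q _ => F (decide q)) (fun q => ?_)
    fun _ _ => measurable_const
  by_cases hq : q
  · simpa [hq] using hp
  · simpa [hq] using hp.not

theorem measurable_gainFac [Countable Tx] {m : MeasurableSpace Ω} {a b t : ℕ}
    (hk : @Trace.Known Ω m P Tx X a b) (hX : ∀ ω, (X ω).Follows P.δ) (ht : t < a) (ht' : t ≤ b)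
    (z : ℕ) (p : Party P.n P.m) (c : Bool) :
    Measurable[m] fun ω => gainFac P.om ((X ω).mdPre z t).rate ((X ω).mdPre z t).gainRate
      (decide ((X ω).Prod P.δ t)) p ((X ω).job t p).isSer c := by
  refine measurable_cases (ν := fun ω => (X ω).mdPre z t)
    (f := fun M ω => gainFac P.om M.rate M.gainRate (decide ((X ω).Prod P.δ t)) p
      ((X ω).job t p).isSer c) (fun M => hk.mdPre hX ht ht' M) fun M _ => ?_
  refine measurable_cases (ν := fun ω => (X ω).job t)
    (f := fun v ω => gainFac P.om M.rate M.gainRate (decide ((X ω).Prod P.δ t)) p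
      (v p).isSer c) (hk.job t ht) fun v _ => ?_
  exact measurable_decide (hk.prod ht ht' P.δ)
    fun d => gainFac P.om M.rate M.gainRate d p (v p).isSer c

theorem measurable_progFac [Countable Tx] {m : MeasurableSpace Ω} {a b t : ℕ}
    (hk : @Trace.Known Ω m P Tx X a b) (ht : t < a) (ht' : t ≤ b)
    (p : Party P.n P.m) (c : Bool) :
    Measurable[m] fun ω => progFac P.om (decide ((X ω).Prod P.δ t)) p
      ((X ω).job t p).isSer c := by
  refine measurable_cases (ν := fun ω => (X ω).job t)
    (f := fun v ω => progFac P.om (decide ((X ω).Prod P.δ t)) p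
      (v p).isSer c) (hk.job t ht) fun v _ => ?_
  exact measurable_decide (hk.prod ht ht' P.δ) fun d => progFac P.om d p (v p).isSer c

/-- The potential is a supermartingale. -/
theorem lintegral_pot_succ_le [Countable Tx] [IsProbabilityMeasure μ] (h : IsExecution P μ ℱ X)
    (hP : P.Admissible) {z t : ℕ} (hzt : z ≤ t) (h0 : 0 < t) {A : Set Ω}
    (hA : MeasurableSet[ℱ t] A) :
    ∫⁻ ω, A.indicator (fun _ => (1 : ℝ≥0∞)) ω * ENNReal.ofReal ((X ω).pot z (t + 1)) ∂μ ≤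
      ∫⁻ ω, A.indicator (fun _ => (1 : ℝ≥0∞)) ω * ENNReal.ofReal ((X ω).pot z t) ∂μ := by
  have hX := h.follows
  have hpre := h.known_pre t
  have hle : preInfo ℱ X t ≤ mΩ := (h.preInfo_le t).trans (ℱ.le _)
  set I : Ω → ℝ≥0∞ := A.indicator fun _ => 1 with hI
  have hI1 : ∀ ω, I ω ≤ 1 := fun ω => Set.indicator_le_self' (fun _ _ => zero_le) ω
  have hIm : Measurable[ℱ t] I := Measurable.indicator measurable_const hA
  have hIm' : Measurable I := hIm.mono (ℱ.le t) le_rfl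
  have hmono := h.ae_monotone hP
  let G : Party P.n P.m → Bool → Ω → ℝ := fun p b ω =>
    gainFac P.om ((X ω).mdPre z t).rate ((X ω).mdPre z t).gainRate
      (decide ((X ω).Prod P.δ t)) p ((X ω).job t p).isSer b
  let H : Party P.n P.m → Bool → Ω → ℝ := fun p b ω =>
    progFac P.om (decide ((X ω).Prod P.δ t)) p ((X ω).job t p).isSer b
  let u : Ω → ℝ := fun ω => (X ω).lag (t - 1)
  let rt : Ω → ℝ := fun ω => 8 / 5 * ((X ω).md z t).rate * P.β
  let x : Ω → ℝ := fun ω =>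
    1 + if decide ((X ω).Prod P.δ t) then 0 else 8 / 5 * ((X ω).mdPre z t).rate * P.rinv
  let y : Ω → ℝ := fun ω => 1 - if decide ((X ω).Prod P.δ t) then 0 else 2 * P.rinv
  have hr := hP.rinv_pos
  have hr' := hP.rinv_le
  have hy0 : ∀ ω, 0 ≤ y ω := fun ω => by simp only [y]; split_ifs <;> linarith
  have hy1 : ∀ ω, y ω ≤ 1 := fun ω => by simp only [y]; split_ifs <;> linarith
  have hx0 : ∀ ω, 0 ≤ x ω := fun ω => by
    have := mul_pos ((X ω).mdPre z t).rate_pos hr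
    simp only [x]; split_ifs <;> linarith
  -- measurability
  have mPC : Measurable fun ω => (X ω).preCorr z t :=
    (hpre.preCorr hX (Nat.lt_succ_self t) le_rfl).mono hle le_rfl
  have my : Measurable y :=
    (measurable_decide (hpre.prod (Nat.lt_succ_self t) le_rfl P.δ)
      fun d => 1 - if d then 0 else 2 * P.rinv).mono hle le_rfl
  have hk := h.known t
  have mCC : Measurable[ℱ t] fun ω => (X ω).corrCoeff z t := hk.corrCoeff hX le_rfl
  have mMC : Measurable[ℱ t] fun ω => (X ω).mainCoeff z t := hk.mainCoeff hX h0 le_rfl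
  have mu : Measurable[ℱ t] u := hk.lag (by omega) (by omega)
  have mrt : Measurable[ℱ t] rt := hk.ofMd hX le_rfl fun M => 8 / 5 * M.rate * P.β
  have mpot : Measurable[ℱ t] fun ω => (X ω).pot z t := hk.pot hX h0 le_rfl
  have mgap : Measurable fun ω => (X ω).gap t := (h.measurable_gap t).mono (ℱ.le _) le_rfl
  have hrt0 : ∀ ω, 0 ≤ rt ω := fun ω => by
    have := ((X ω).md z t).rate_pos
    have := hP.β_pos
    simp only [rt]; positivity
  have hR := hP.rate_pos
  have h2β := Trace.two_mul_le_rate hP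
  -- the change at the mark
  have e1 : ∫⁻ ω, I ω * ENNReal.ofReal ((X ω).pot z (t + 1)) ∂μ +
      ∫⁻ ω, I ω * ENNReal.ofReal ((X ω).preCorr z t * H ((X ω).party t) ((X ω).kind t) ω) ∂μ ≤
      ∫⁻ ω, I ω * ENNReal.ofReal ((X ω).preMain z t * G ((X ω).party t) ((X ω).kind t) ω) ∂μ := by
    have hm1 : Measurable fun ω => I ω * ENNReal.ofReal ((X ω).pot z (t + 1)) :=
      hIm'.mul ((((h.known (t + 1)).pot hX (Nat.succ_pos t) le_rfl).mono
        (ℱ.le _) le_rfl).ennreal_ofReal)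
    rw [← lintegral_add_left hm1]
    refine lintegral_mono_ae ?_
    filter_upwards [hmono] with ω hω
    rw [← mul_add]
    refine mul_le_mul_right ?_ _
    rw [← ENNReal.ofReal_add ((hX ω).pot_nonneg hP hω (Nat.succ_pos t))
      (mul_nonneg (Trace.preCorr_nonneg _ _) (progFac_nonneg _ _ _ _ _))]
    exact ENNReal.ofReal_le_ofReal ((hX ω).pot_succ_le hP hzt)
  have e2 : ∫⁻ ω, I ω * ENNReal.ofReal ((X ω).preMain z t * G ((X ω).party t) ((X ω).kind t) ω) ∂μ ≤
      ∫⁻ ω, I ω * ENNReal.ofReal ((X ω).preMain z t * x ω) ∂μ := by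
    rw [h.lintegral_mark_fac hP t hA (fun ω => Trace.preMain_nonneg _ _)
      (hpre.preMain hX (Nat.lt_succ_self t) le_rfl) (fun p b ω => (gainFac_pos _ _ _ _ _ _ _).le)
      fun p b => measurable_gainFac hpre hX (Nat.lt_succ_self t) le_rfl z p b]
    refine lintegral_mono fun ω => mul_le_mul_right (ENNReal.ofReal_le_ofReal ?_) _
    refine mul_le_mul_of_nonneg_left ?_ (Trace.preMain_nonneg _ _)
    have hd : decay ≤ ((X ω).mdPre z t).rate / 100 := by
      have := ((X ω).mdPre z t).eta_le_rate
      unfold decay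
      linarith
    exact mark_gain hP (Mode.rate_pos _) (Mode.rate_le _) (Mode.gainRate_nonneg _)
      (Mode.gainRate_add_le _) hd _ fun p => ((X ω).job t p).isSer
  have e3 : ∫⁻ ω, I ω * ENNReal.ofReal ((X ω).preCorr z t * y ω) ∂μ ≤
      ∫⁻ ω, I ω * ENNReal.ofReal ((X ω).preCorr z t * H ((X ω).party t) ((X ω).kind t) ω) ∂μ := by
    rw [h.lintegral_mark_fac hP t hA (fun ω => Trace.preCorr_nonneg _ _)
      (hpre.preCorr hX (Nat.lt_succ_self t) le_rfl) (fun p b ω => progFac_nonneg _ _ _ _ _)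
      fun p b => measurable_progFac hpre (Nat.lt_succ_self t) le_rfl p b]
    refine lintegral_mono fun ω => mul_le_mul_right (ENNReal.ofReal_le_ofReal ?_) _
    refine mul_le_mul_of_nonneg_left ?_ (Trace.preCorr_nonneg _ _)
    exact mark_prog hP _ fun p => ((X ω).job t p).isSer
  -- comparison with the potential before the gap
  have mkern : ∀ {s : Ω → ℝ}, Measurable[ℱ t] s →
      Measurable fun ω => ENNReal.ofReal (kern P.rate (s ω) (u ω) ((X ω).gap t)) := fun hs =>
    ((measurable_kern P.rate).comp ((hs.mono (ℱ.le t) le_rfl).prodMk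
      ((mu.mono (ℱ.le t) le_rfl).prodMk mgap))).ennreal_ofReal
  have mIC : Measurable[ℱ t] fun ω => I ω * ENNReal.ofReal ((X ω).corrCoeff z t) :=
    hIm.mul mCC.ennreal_ofReal
  have mIM : Measurable[ℱ t] fun ω => I ω * ENNReal.ofReal ((X ω).mainCoeff z t) :=
    hIm.mul mMC.ennreal_ofReal
  have mIy : Measurable fun ω => I ω * ENNReal.ofReal ((X ω).preCorr z t * y ω) :=
    hIm'.mul (mPC.mul my).ennreal_ofReal
  have e4 : ∫⁻ ω, I ω * ENNReal.ofReal ((X ω).preMain z t * x ω) ∂μ +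
      ∫⁻ ω, I ω * ENNReal.ofReal ((X ω).corrCoeff z t) *
        ENNReal.ofReal (kern P.rate (-(2 * P.β)) (u ω) ((X ω).gap t)) ∂μ ≤
      ∫⁻ ω, I ω * ENNReal.ofReal ((X ω).mainCoeff z t) *
        ENNReal.ofReal (kern P.rate (rt ω) (u ω) ((X ω).gap t)) ∂μ +
      ∫⁻ ω, I ω * ENNReal.ofReal ((X ω).preCorr z t * y ω) ∂μ := by
    have m1 : Measurable fun ω => I ω * ENNReal.ofReal ((X ω).corrCoeff z t) *
        ENNReal.ofReal (kern P.rate (-(2 * P.β)) (u ω) ((X ω).gap t)) :=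
      (mIC.mono (ℱ.le t) le_rfl).mul (mkern (s := fun _ => -(2 * P.β))
        (@measurable_const _ _ _ (ℱ t) _))
    rw [← lintegral_add_right _ m1, ← lintegral_add_right _ mIy]
    refine lintegral_mono_ae ?_
    filter_upwards [hmono] with ω hω
    rw [mul_assoc, mul_assoc, ← mul_add, ← mul_add,
      ← ENNReal.ofReal_mul (Trace.corrCoeff_nonneg _ _),
      ← ENNReal.ofReal_mul (Trace.mainCoeff_nonneg _ _),
      ← ENNReal.ofReal_add (mul_nonneg (Trace.preMain_nonneg _ _) (hx0 ω))
        (mul_nonneg (Trace.corrCoeff_nonneg _ _) (Trace.kern_nonneg hR (by linarith))),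
      ← ENNReal.ofReal_add (mul_nonneg (Trace.mainCoeff_nonneg _ _)
        (Trace.kern_nonneg hR (by linarith [hrt0 ω])))
        (mul_nonneg (Trace.preCorr_nonneg _ _) (hy0 ω))]
    exact mul_le_mul_right (ENNReal.ofReal_le_ofReal ((hX ω).pre_le hP hω h0)) _
  rw [h.lintegral_gap hP t mIC (s := fun _ => -(2 * P.β)) (@measurable_const _ _ _ (ℱ t) _) mu
      (fun ω => by linarith) (fun ω => Trace.lag_nonneg _),
    h.lintegral_gap hP t mIM mrt mu (fun ω => by linarith [hrt0 ω])
      (fun ω => Trace.lag_nonneg _)] at e4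
  have e5 : ∫⁻ ω, I ω * ENNReal.ofReal ((X ω).mainCoeff z t) *
        ENNReal.ofReal (Real.exp (rt ω * u ω)) ∂μ =
      ∫⁻ ω, I ω * ENNReal.ofReal ((X ω).pot z t) ∂μ +
      ∫⁻ ω, I ω * ENNReal.ofReal ((X ω).corrCoeff z t) *
        ENNReal.ofReal (Real.exp (-(2 * P.β) * u ω)) ∂μ := by
    have m2 : Measurable fun ω => I ω * ENNReal.ofReal ((X ω).pot z t) :=
      hIm'.mul (mpot.mono (ℱ.le t) le_rfl).ennreal_ofReal
    rw [← lintegral_add_left m2]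
    refine lintegral_congr_ae ?_
    filter_upwards [hmono] with ω hω
    rw [mul_assoc (I ω), mul_assoc (I ω), ← mul_add,
      ← ENNReal.ofReal_mul (Trace.corrCoeff_nonneg _ _),
      ← ENNReal.ofReal_mul (Trace.mainCoeff_nonneg _ _),
      ← ENNReal.ofReal_add ((hX ω).pot_nonneg hP hω h0)
        (mul_nonneg (Trace.corrCoeff_nonneg _ _) (Real.exp_pos _).le), Trace.pot_eq]
    congr 2
    ring
  -- the correction terms are finite
  have f1 : ∫⁻ ω, I ω * ENNReal.ofReal ((X ω).preCorr z t * y ω) ∂μ ≠ ⊤ := by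
    refine ne_top_of_le_ne_top (b := ENNReal.ofReal (Real.exp (decay * t) * Real.exp P.fd))
      ENNReal.ofReal_ne_top ?_
    refine (lintegral_mono_ae (g := fun _ =>
      ENNReal.ofReal (Real.exp (decay * t) * Real.exp P.fd)) ?_).trans (by simp)
    filter_upwards [hmono] with ω hω
    refine (mul_le_of_le_one_left' (hI1 ω)).trans (ENNReal.ofReal_le_ofReal ?_)
    exact (mul_le_of_le_one_right (Trace.preCorr_nonneg _ _) (hy1 ω)).trans
      ((hX ω).preCorr_le hP hω z t)
  have f2 : ∫⁻ ω, I ω * ENNReal.ofReal ((X ω).corrCoeff z t) *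
        ENNReal.ofReal (Real.exp (-(2 * P.β) * u ω)) ∂μ ≠ ⊤ := by
    refine ne_top_of_le_ne_top (b := ENNReal.ofReal (Real.exp (decay * t)))
      ENNReal.ofReal_ne_top ?_
    refine (lintegral_mono_ae (g := fun _ =>
      ENNReal.ofReal (Real.exp (decay * t))) ?_).trans (by simp)
    filter_upwards [hmono] with ω hω
    rw [mul_assoc, ← ENNReal.ofReal_mul (Trace.corrCoeff_nonneg _ _)]
    refine (mul_le_of_le_one_left' (hI1 ω)).trans (ENNReal.ofReal_le_ofReal ?_)
    refine (mul_le_of_le_one_right (Trace.corrCoeff_nonneg _ _) ?_).trans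
      ((hX ω).corrCoeff_le hP hω z t)
    refine Real.exp_le_one_iff.2 ?_
    have h3 : 0 ≤ P.β * u ω := mul_nonneg hP.β_pos.le (Trace.lag_nonneg _)
    linarith
  rw [e5] at e4
  -- The potential is a difference, so all estimates are kept as sums in `ℝ≥0∞`; the two finite
  -- correction integrals are cancelled only here.
  refine (ENNReal.add_le_add_iff_right (ENNReal.add_ne_top.2 ⟨f1, f2⟩)).1 ?_
  calc _ = (∫⁻ ω, I ω * ENNReal.ofReal ((X ω).pot z (t + 1)) ∂μ +
        ∫⁻ ω, I ω * ENNReal.ofReal ((X ω).preCorr z t * y ω) ∂μ) +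
        ∫⁻ ω, I ω * ENNReal.ofReal ((X ω).corrCoeff z t) *
          ENNReal.ofReal (Real.exp (-(2 * P.β) * u ω)) ∂μ := by rw [add_assoc]
    _ ≤ ∫⁻ ω, I ω * ENNReal.ofReal ((X ω).preMain z t * x ω) ∂μ +
        ∫⁻ ω, I ω * ENNReal.ofReal ((X ω).corrCoeff z t) *
          ENNReal.ofReal (Real.exp (-(2 * P.β) * u ω)) ∂μ :=
      add_le_add_left (((add_le_add_right e3 _).trans e1).trans e2) _
    _ ≤ _ := e4
    _ = _ := by rw [add_assoc, add_comm (∫⁻ ω, I ω * ENNReal.ofReal ((X ω).corrCoeff z t) *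
          ENNReal.ofReal (Real.exp (-(2 * P.β) * u ω)) ∂μ)]

end IsExecution
end Probability
end Interlude

/-! ### From the supermartingale to the safety bound. -/

namespace Interlude

section Safety

open scoped Classical ENNReal

/-- A maximal inequality for nonnegative supermartingales that start at time `z + 1` on an event
of the past of `z`. -/
theorem mul_measure_exists_le {Ω : Type*} {mΩ : MeasurableSpace Ω} {μ : Measure Ω}
    {ℱ : Filtration ℕ mΩ} {z : ℕ} {B : Set Ω} (hB : MeasurableSet[ℱ z] B) {V : ℕ → Ω → ℝ≥0∞}
    {E : ℕ → Set Ω} (hE : ∀ t, MeasurableSet[ℱ t] (E t))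
    (hV : ∀ t, z < t → ∀ A, MeasurableSet[ℱ t] A →
      ∫⁻ ω in A, V (t + 1) ω ∂μ ≤ ∫⁻ ω in A, V t ω ∂μ)
    {c b : ℝ≥0∞} (hc : ∀ t, z < t → ∀ᵐ ω ∂μ, ω ∈ E t → c ≤ V t ω)
    (hb : ∀ ω ∈ B, V (z + 1) ω ≤ b) :
    c * μ (B ∩ {ω | ∃ t, z < t ∧ ω ∈ E t}) ≤ b * μ B := by
  let F : ℕ → Set Ω := fun s => {ω | ∃ i < s, ω ∈ E (z + 1 + i)}
  have hFm : ∀ s, MeasurableSet[ℱ (z + 1 + s)] (F s) := by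
    intro s
    have : F s = ⋃ i : Fin s, E (z + 1 + i) := by
      ext ω
      simp only [F, Set.mem_ofPred_eq, Set.mem_iUnion, Fin.exists_iff, exists_prop]
    rw [this]
    exact @MeasurableSet.iUnion _ _ (ℱ (z + 1 + s)) _ _ fun i =>
      ℱ.mono (by have := i.2; omega) _ (hE _)
  have hstep : ∀ s, F (s + 1) = F s ∪ E (z + 1 + s) := by
    intro s
    ext ω
    simp only [F, Set.mem_ofPred_eq, Set.mem_union, Nat.lt_succ_iff_lt_or_eq]
    constructor
    · rintro ⟨i, hi | rfl, h⟩
      · exact Or.inl ⟨i, hi, h⟩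
      · exact Or.inr h
    · rintro (⟨i, hi, h⟩ | h)
      · exact ⟨i, Or.inl hi, h⟩
      · exact ⟨s, Or.inr rfl, h⟩
  -- The process is stopped at its first visit to `E`, where its value is at least `c`; on the
  -- unvisited part it continues as a supermartingale.
  have key : ∀ s, ∫⁻ ω in B \ F s, V (z + 1 + s) ω ∂μ + c * μ (B ∩ F s) ≤ b * μ B := by
    intro s
    induction s with
    | zero =>
      have h0 : F 0 = ∅ := by simp [F]
      rw [h0]
      simp only [Set.sdiff_empty, Set.inter_empty, measure_empty, mul_zero, add_zero]
      calc ∫⁻ ω in B, V (z + 1) ω ∂μ ≤ ∫⁻ _ in B, b ∂μ :=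
            setLIntegral_mono' (ℱ.le z _ hB) hb
        _ = b * μ B := by rw [setLIntegral_const]
    | succ s ih =>
      have hBs : MeasurableSet[ℱ (z + 1 + s)] (B \ F s) :=
        @MeasurableSet.diff _ (ℱ (z + 1 + s)) _ _ (ℱ.mono (by omega) _ hB) (hFm s)
      have hEs := ℱ.le _ _ (hE (z + 1 + s))
      have hsplit := lintegral_inter_add_sdiff (μ := μ) (V (z + 1 + s)) (B \ F s) hEs
      have hd : (B \ F s) \ E (z + 1 + s) = B \ F (s + 1) := by
        rw [hstep, Set.sdiff_sdiff]
      have hlow : c * μ ((B \ F s) ∩ E (z + 1 + s)) ≤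
          ∫⁻ ω in (B \ F s) ∩ E (z + 1 + s), V (z + 1 + s) ω ∂μ := by
        rw [← setLIntegral_const]
        refine setLIntegral_mono_ae' ((ℱ.le _ _ hBs).inter hEs) ?_
        filter_upwards [hc (z + 1 + s) (by omega)] with ω hω hm
        exact hω hm.2
      have hμ : μ (B ∩ F (s + 1)) ≤ μ (B ∩ F s) + μ ((B \ F s) ∩ E (z + 1 + s)) := by
        refine (measure_mono ?_).trans (measure_union_le _ _)
        rintro ω ⟨h1, h2⟩
        rw [hstep] at h2
        by_cases h3 : ω ∈ F s
        · exact Or.inl ⟨h1, h3⟩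
        · exact Or.inr ⟨⟨h1, h3⟩, h2.resolve_left h3⟩
      have hV' := hV (z + 1 + s) (by omega) (B \ F (s + 1))
        (hd ▸ @MeasurableSet.diff _ (ℱ (z + 1 + s)) _ _ hBs (hE _))
      rw [hd] at hsplit
      calc ∫⁻ ω in B \ F (s + 1), V (z + 1 + (s + 1)) ω ∂μ + c * μ (B ∩ F (s + 1))
          ≤ ∫⁻ ω in B \ F (s + 1), V (z + 1 + s) ω ∂μ +
            c * (μ (B ∩ F s) + μ ((B \ F s) ∩ E (z + 1 + s))) := by exact add_le_add hV' (mul_le_mul_right hμ c)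
        _ = (c * μ ((B \ F s) ∩ E (z + 1 + s)) + ∫⁻ ω in B \ F (s + 1), V (z + 1 + s) ω ∂μ) +
            c * μ (B ∩ F s) := by ring
        _ ≤ ∫⁻ ω in B \ F s, V (z + 1 + s) ω ∂μ + c * μ (B ∩ F s) := by
          rw [← hsplit]; gcongr
        _ ≤ _ := ih
  have hU : B ∩ {ω | ∃ t, z < t ∧ ω ∈ E t} = ⋃ s, B ∩ F s := by
    ext ω
    simp only [F, Set.mem_inter_iff, Set.mem_ofPred_eq, Set.mem_iUnion]
    constructor
    · rintro ⟨h1, t, h2, h3⟩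
      exact ⟨t - z, h1, t - z - 1, by omega, by rwa [show z + 1 + (t - z - 1) = t by omega]⟩
    · rintro ⟨s, h1, i, h2, h3⟩
      exact ⟨h1, _, by omega, h3⟩
  have hmono : Monotone fun s => B ∩ F s := fun s s' h =>
    Set.inter_subset_inter_right B fun ω ⟨i, hi, h3⟩ => ⟨i, hi.trans_le h, h3⟩
  rw [hU, hmono.measure_iUnion, ENNReal.mul_iSup]
  exact iSup_le fun s => le_add_self.trans (key s)

/-- The ring before a base mines an honest series block. Hence a run has at most one base in each
round. -/
theorem Trace.Base.round_lt {n m k : ℕ} {Tx : Type*} {X : Trace n m k Tx} {z z' : ℕ}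
    (hz : X.Base z') (h : z < z') : X.round z < X.round z' := by
  rcases hz with rfl | ⟨h0, h1, -⟩
  · omega
  · rw [round_eq, round_eq, cnt_eq_card, cnt_eq_card]
    refine Finset.card_lt_card (Finset.ssubset_iff_of_subset ?_ |>.2 ⟨z' - 1, ?_, ?_⟩)
    · exact Finset.filter_subset_filter _ (Finset.Ico_subset_Ico_right h.le)
    · simp only [Finset.mem_filter, Finset.mem_Ico]
      exact ⟨⟨Nat.zero_le _, by omega⟩, h1⟩
    · simp only [Finset.mem_filter, Finset.mem_Ico]
      omega

theorem Trace.Known.measurableSet_base {P : Params} {Tx : Type*} [Countable Tx] {Ω : Type*}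
    {mG : MeasurableSpace Ω} {X : Ω → Trace P.n P.m P.k Tx} {a b z : ℕ} (h : @Trace.Known Ω mG P Tx X a b)
    (hz : z ≤ b) (r : ℕ) : MeasurableSet {ω | (X ω).Base z ∧ (X ω).round z = r} :=
  ((h.base hz).and (measurable_eq_nat (h.round hz) r)).setOf

theorem Trace.Known.measurableSet_not_pending {P : Params} {Tx : Type*} [Countable Tx]
    {Ω : Type*} {mG : MeasurableSpace Ω} {X : Ω → Trace P.n P.m P.k Tx} {a b t : ℕ}
    (h : @Trace.Known Ω mG P Tx X a b) (hX : ∀ ω, (X ω).Follows P.δ) (ht : t ≤ b) (z x : ℕ) :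
    MeasurableSet {ω | ¬ ((X ω).md z t).IsPending ∧ x ≤ Trace.cnt z t (X ω).Ser} :=
  ((h.ofMd hX ht fun M => ¬ M.IsPending).and (measurable_le_of measurable_const
    (measurable_cnt fun _ hi => h.ser (hi.trans_le ht)))).setOf

variable {P : Params} {Tx : Type*} {Ω : Type*} {mΩ : MeasurableSpace Ω}
  {μ : Measure Ω} {ℱ : Filtration ℕ mΩ} {X : Ω → Trace P.n P.m P.k Tx}

namespace IsExecution

theorem measure_base_le [Countable Tx] [IsProbabilityMeasure μ] (h : IsExecution P μ ℱ X)
    (hP : P.Admissible) (z r x : ℕ) :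
    μ ({ω | (X ω).Base z ∧ (X ω).round z = r} ∩
      {ω | ∃ t, z < t ∧ ω ∈ {ω | ¬ ((X ω).md z t).IsPending ∧ x ≤ Trace.cnt z t (X ω).Ser}}) ≤
    ENNReal.ofReal (8 * Real.exp (-(decay * x))) *
      μ {ω | (X ω).Base z ∧ (X ω).round z = r} := by
  have : NeZero P.n := ⟨hP.n_pos.ne'⟩
  have hB : MeasurableSet[ℱ z] {ω | (X ω).Base z ∧ (X ω).round z = r} :=
    (h.known z).measurableSet_base le_rfl r
  have hE : ∀ t, MeasurableSet[ℱ t]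
      {ω | ¬ ((X ω).md z t).IsPending ∧ x ≤ Trace.cnt z t (X ω).Ser} := fun t =>
    (h.known t).measurableSet_not_pending h.follows le_rfl z x
  have hmain := mul_measure_exists_le (μ := μ) (ℱ := ℱ) (z := z) hB
    (V := fun t ω => ENNReal.ofReal ((X ω).pot z t)) hE (c := ENNReal.ofReal
      (Real.exp (decay * x) / 4)) (b := 2) ?_ ?_ ?_
  · have hc : 0 < Real.exp (decay * x) / 4 := by positivity
    have h2 := mul_le_mul_right hmain (ENNReal.ofReal (4 * Real.exp (-(decay * x))))
    rw [← mul_assoc, ← mul_assoc, ← ENNReal.ofReal_mul (by positivity)] at h2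
    have e1 : 4 * Real.exp (-(decay * x)) * (Real.exp (decay * x) / 4) = 1 := by
      rw [Real.exp_neg]
      field_simp
    have e2 : ENNReal.ofReal (4 * Real.exp (-(decay * x))) * 2 =
        ENNReal.ofReal (8 * Real.exp (-(decay * x))) := by
      rw [← ENNReal.ofReal_ofNat 2, ← ENNReal.ofReal_mul (by positivity)]
      congr 1
      ring
    rwa [e1, e2, ENNReal.ofReal_one, one_mul] at h2
  · intro t ht A hA
    have h1 := h.lintegral_pot_succ_le hP ht.le (by omega) hA
    have h2 : ∀ s, ∫⁻ ω, A.indicator (fun _ => (1 : ℝ≥0∞)) ω *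
        ENNReal.ofReal ((X ω).pot z s) ∂μ = ∫⁻ ω in A, ENNReal.ofReal ((X ω).pot z s) ∂μ := by
      intro s
      rw [← lintegral_indicator (ℱ.le t _ hA)]
      refine lintegral_congr fun ω => ?_
      by_cases hω : ω ∈ A <;> simp [hω]
    rwa [h2, h2] at h1
  · intro t ht
    filter_upwards [h.ae_monotone hP] with ω hω hm
    refine ENNReal.ofReal_le_ofReal (le_trans ?_ ((h.follows ω).pot_lower hP hω (by omega) hm.1))
    have h1 : (x : ℝ) ≤ Trace.cnt z t (X ω).Ser := by exact_mod_cast hm.2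
    have h2 : Real.exp (decay * x) ≤ (X ω).disc z t :=
      Real.exp_le_exp.2 (mul_le_mul_of_nonneg_left h1 decay_pos.le)
    linarith
  · intro ω hω
    rw [← ENNReal.ofReal_ofNat 2]
    exact ENNReal.ofReal_le_ofReal (hω.1.pot_succ_le hP (h.follows ω))

/-- Bases with a common round are disjoint events, so summing over all rings `z` costs nothing. The
sum over rounds converges because an old base leaves many series blocks. -/
theorem measure_reverted_le [Countable Tx] [IsProbabilityMeasure μ] (h : IsExecution P μ ℱ X)
    (hP : P.Admissible) (T : Tx) (r₀ κ : ℕ) :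
    μ {ω | (X ω).Reverted T κ r₀} ≤
      ∑ j ∈ Finset.range (r₀ + 1), ENNReal.ofReal (8 * Real.exp (-(decay * (max κ j : ℕ)))) := by
  have : NeZero P.n := ⟨hP.n_pos.ne'⟩
  let B : ℕ → ℕ → Set Ω := fun r z => {ω | (X ω).Base z ∧ (X ω).round z = r}
  let D : ℕ → ℕ → Set Ω := fun r z => B r z ∩ {ω | ∃ t, z < t ∧
    ω ∈ {ω | ¬ ((X ω).md z t).IsPending ∧ max κ (r₀ - r) ≤ Trace.cnt z t (X ω).Ser}}
  have hBm : ∀ r z, MeasurableSet (B r z) := fun r z => ℱ.le z _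
    ((h.known z).measurableSet_base le_rfl r)
  have hdisj : ∀ r, Pairwise (Function.onFun Disjoint (B r)) := by
    intro r z z' hne
    refine Set.disjoint_left.2 fun ω h1 h2 => ?_
    rcases lt_or_gt_of_ne hne with hlt | hlt
    · have := h2.1.round_lt hlt
      have e1 := h1.2; have e2 := h2.2
      omega
    · have := h1.1.round_lt hlt
      have e1 := h1.2; have e2 := h2.2
      omega
  have hr : ∀ r, μ (⋃ z, D r z) ≤
      ENNReal.ofReal (8 * Real.exp (-(decay * (max κ (r₀ - r) : ℕ)))) := by
    intro r
    calc μ (⋃ z, D r z) ≤ ∑' z, μ (D r z) := measure_iUnion_le _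
      _ ≤ ∑' z, ENNReal.ofReal (8 * Real.exp (-(decay * (max κ (r₀ - r) : ℕ)))) * μ (B r z) :=
        ENNReal.tsum_le_tsum fun z => h.measure_base_le hP z r _
      _ = ENNReal.ofReal (8 * Real.exp (-(decay * (max κ (r₀ - r) : ℕ)))) * μ (⋃ z, B r z) := by
        rw [ENNReal.tsum_mul_left, measure_iUnion (hdisj r) (hBm r)]
      _ ≤ _ := mul_le_of_le_one_right' prob_le_one
  have hsub : {ω | (X ω).Reverted T κ r₀} ≤ᵐ[μ] ⋃ r ∈ Finset.range (r₀ + 1), ⋃ z, D r z := by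
    filter_upwards [h.ae_monotone hP] with ω hω hrev
    obtain ⟨z, t, h1, h2, h3, h4, h5, h6⟩ :=
      (h.follows ω).exists_base_of_reverted hω hP.weights hrev
    refine Set.mem_iUnion₂.2 ⟨(X ω).round z, Finset.mem_range.2 (by omega),
      Set.mem_iUnion.2 ⟨z, ⟨h1, rfl⟩, t, h3, h4, max_le h5 h6⟩⟩
  calc μ {ω | (X ω).Reverted T κ r₀} ≤ μ (⋃ r ∈ Finset.range (r₀ + 1), ⋃ z, D r z) :=
        measure_mono_ae hsub
    _ ≤ ∑ r ∈ Finset.range (r₀ + 1), μ (⋃ z, D r z) := measure_biUnion_finset_le _ _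
    _ ≤ ∑ r ∈ Finset.range (r₀ + 1),
        ENNReal.ofReal (8 * Real.exp (-(decay * (max κ (r₀ - r) : ℕ)))) :=
      Finset.sum_le_sum fun r _ => hr r
    _ = _ := Finset.sum_range_reflect (fun j =>
      ENNReal.ofReal (8 * Real.exp (-(decay * (max κ j : ℕ))))) (r₀ + 1)

end IsExecution

/-- The maximum of κ and j is at least their mean, which splits off a factor depending on κ from a
geometric series in j. -/
theorem sum_exp_max_le (κ N : ℕ) :
    ∑ j ∈ Finset.range N, 8 * Real.exp (-(decay * (max κ j : ℕ))) ≤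
      8 / (1 - Real.exp (-(decay / 2))) * Real.exp (-(decay / 2 * κ)) := by
  have hd := decay_pos
  set q := Real.exp (-(decay / 2)) with hq
  have hq1 : q < 1 := by rw [← Real.exp_zero]; exact Real.exp_lt_exp.2 (by linarith)
  have hq0 : 0 < q := Real.exp_pos _
  have h1 : ∀ j : ℕ, 8 * Real.exp (-(decay * (max κ j : ℕ))) ≤
      8 * Real.exp (-(decay / 2 * κ)) * q ^ j := by
    intro j
    rw [hq, ← Real.exp_nat_mul, mul_assoc, ← Real.exp_add]
    refine mul_le_mul_of_nonneg_left (Real.exp_le_exp.2 ?_) (by norm_num)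
    have e1 : (κ : ℝ) ≤ (max κ j : ℕ) := by exact_mod_cast le_max_left κ j
    have e2 : (j : ℝ) ≤ (max κ j : ℕ) := by exact_mod_cast le_max_right κ j
    nlinarith
  calc _ ≤ ∑ j ∈ Finset.range N, 8 * Real.exp (-(decay / 2 * κ)) * q ^ j :=
        Finset.sum_le_sum fun j _ => h1 j
    _ = 8 * Real.exp (-(decay / 2 * κ)) * ∑ j ∈ Finset.range N, q ^ j := by
      rw [Finset.mul_sum]
    _ ≤ 8 * Real.exp (-(decay / 2 * κ)) * (1 - q)⁻¹ := by
      refine mul_le_mul_of_nonneg_left ?_ (by positivity)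
      rw [← tsum_geometric_of_lt_one hq0.le hq1]
      exact (summable_geometric_of_lt_one hq0.le hq1).sum_le_tsum _ fun j _ => by positivity
    _ = _ := by rw [div_eq_mul_inv]; ring

theorem exists_measure_reverted_le : ∃ κ₀ : ℕ, ∀ P : Params, P.Admissible →
    ∀ (Tx : Type*) [Countable Tx] (Ω : Type*) [mΩ : MeasurableSpace Ω]
      (μ : Measure Ω) [IsProbabilityMeasure μ] (ℱ : Filtration ℕ mΩ)
      (X : Ω → Trace P.n P.m P.k Tx), IsExecution P μ ℱ X →
    ∀ (T : Tx) (r₀ κ : ℕ), κ₀ ≤ κ →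
      μ {ω | (X ω).Reverted T κ r₀} ≤ ENNReal.ofReal (Real.exp (-(decay / 4 * (κ : ℝ)))) := by
  have hd := decay_pos
  have hq1 : Real.exp (-(decay / 2)) < 1 := by rw [← Real.exp_zero]; exact Real.exp_lt_exp.2 (by linarith)
  -- Half of the rate `decay / 2` is spent on the constant factor, using y ≤ e^y.
  obtain ⟨κ₀, hκ₀⟩ := exists_nat_gt (8 / (1 - Real.exp (-(decay / 2))) / (decay / 4))
  rw [div_lt_iff₀ (by linarith)] at hκ₀
  refine ⟨κ₀, fun P hP Tx _ Ω mΩ μ _ ℱ X h T r₀ κ hκ => ?_⟩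
  refine (h.measure_reverted_le hP T r₀ κ).trans ?_
  rw [← ENNReal.ofReal_sum_of_nonneg fun j _ => by positivity]
  refine ENNReal.ofReal_le_ofReal ((sum_exp_max_le κ (r₀ + 1)).trans ?_)
  have h1 : (κ₀ : ℝ) ≤ κ := by exact_mod_cast hκ
  have h2 : 8 / (1 - Real.exp (-(decay / 2))) ≤ Real.exp (decay / 4 * κ) := by
    have := Real.add_one_le_exp (decay / 4 * κ)
    nlinarith
  calc _ ≤ Real.exp (decay / 4 * κ) * Real.exp (-(decay / 2 * κ)) := by gcongr
    _ = _ := by rw [← Real.exp_add]; congr 1; ring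

end Safety
end Interlude

/-! ### The ruin probability of the biased walk. -/

namespace Interlude

section Walk

open scoped Classical ENNReal

theorem Params.Admissible.ε_nonneg {P : Params} (hP : P.Admissible) : 0 ≤ P.ε := by
  have h1 : Real.exp (-(P.β * P.δ)) ≤ 1 :=
    Real.exp_le_one_iff.2 (by have := mul_nonneg hP.β_pos.le hP.δ_nonneg; linarith)
  exact div_nonneg (by linarith) (Real.exp_pos _).le

theorem Params.Admissible.ε_lt {P : Params} (hP : P.Admissible) : P.ε < 1 / 8 := by
  have hβ := hP.β_pos
  have h1 : P.β * P.δ < 1 / 20 := by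
    have := mul_lt_mul_of_pos_left hP.delay_small hβ
    rw [mul_one_div_cancel hβ.ne'] at this
    linarith
  have h2 := Real.add_one_le_exp (-(P.β * P.δ))
  unfold ε
  rw [div_lt_iff₀ (Real.exp_pos _)]
  linarith

theorem Params.p_eq {P : Params} (h : 0 ≤ P.ε) : P.p = (1 / 2 - P.ε) / (1 / 4 + P.ε) := by
  unfold p
  rw [div_eq_div_iff (by positivity) (by positivity)]
  ring

theorem Params.Admissible.one_lt_p {P : Params} (hP : P.Admissible) : 1 < P.p := by
  have h0 := hP.ε_nonneg
  have h1 := hP.ε_lt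
  unfold p
  rw [lt_div_iff₀ (by positivity)]
  linarith

/-- The generating function of a step of the walk. -/
noncomputable def stepGen (ε x : ℝ) : ℝ := (1 / 2 - ε) * x⁻¹ + 1 / 4 + (1 / 4 + ε) * x

theorem stepGen_p {P : Params} (hP : P.Admissible) : stepGen P.ε P.p = 1 := by
  have h0 := hP.ε_nonneg
  have h1 := hP.ε_lt
  have h2 : (1 / 2 - P.ε) ≠ 0 := by linarith
  have h3 : (1 / 4 + P.ε) ≠ 0 := by linarith
  rw [stepGen, Params.p_eq h0, inv_div, mul_div_cancel₀ _ h2, mul_div_cancel₀ _ h3]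
  ring

/-- With b = 1/4 + ε the values at √p and p are 1/4 + 2b√p and 1/4 + b(1 + p) = 1, and 2√p < 1 + p
since p ≠ 1. -/
theorem stepGen_sqrt_lt {P : Params} (hP : P.Admissible) : stepGen P.ε (√P.p) < 1 := by
  have h0 := hP.ε_nonneg
  have h1 := hP.ε_lt
  have hp := hP.one_lt_p
  have hs : √P.p * √P.p = P.p := Real.mul_self_sqrt (by linarith)
  have hs1 : 1 < √P.p := by rw [Real.lt_sqrt] <;> linarith
  have hs0 : 0 < √P.p := by linarith
  have h4 : (1 / 2 - P.ε) = (1 / 4 + P.ε) * (√P.p * √P.p) := by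
    rw [hs, Params.p_eq h0, mul_div_cancel₀ _ (by linarith)]
  have h5 : stepGen P.ε (√P.p) = 1 / 4 + 2 * ((1 / 4 + P.ε) * √P.p) := by
    rw [stepGen, h4]
    field_simp
    ring
  have h6 : stepGen P.ε P.p = 1 := stepGen_p hP
  rw [h5]
  nlinarith

variable {Ω : Type*} {mΩ : MeasurableSpace Ω} {μ : Measure Ω} {ε : ℝ}
  {step : ℕ → Ω → ℤ}

namespace IsBiasedWalk

theorem ae_step [IsProbabilityMeasure μ] (h : IsBiasedWalk ε μ step) (h0 : 0 ≤ ε) (h1 : ε < 1 / 8) (t : ℕ) :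
    ∀ᵐ ω ∂μ, step t ω = -1 ∨ step t ω = 0 ∨ step t ω = 1 := by
  have hm : ∀ i, MeasurableSet {ω | step t ω = i} := fun i => h.meas t (measurableSet_singleton i)
  have h2 : μ ({ω | step t ω = -1} ∪ ({ω | step t ω = 0} ∪ {ω | step t ω = 1})) = 1 := by
    rw [measure_union _ ((hm 0).union (hm 1)), measure_union _ (hm 1), h.down, h.stay, h.up,
      ← ENNReal.ofReal_add (by norm_num) (by linarith),
      ← ENNReal.ofReal_add (by linarith) (by linarith), ENNReal.ofReal_eq_one]
    · ring
    · refine Set.disjoint_left.2 fun ω h3 h4 => ?_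
      rw [Set.mem_ofPred_eq] at h3 h4
      omega
    · refine Set.disjoint_left.2 fun ω h3 h4 => ?_
      rw [Set.mem_union, Set.mem_ofPred_eq, Set.mem_ofPred_eq] at h4
      rw [Set.mem_ofPred_eq] at h3
      omega
  exact (mem_ae_iff_prob_eq_one ((hm (-1)).union ((hm 0).union (hm 1)))).2 h2

theorem lintegral_zpow [IsProbabilityMeasure μ] (h : IsBiasedWalk ε μ step) (h0 : 0 ≤ ε) (h1 : ε < 1 / 8) (t : ℕ) {x : ℝ}
    (hx : 0 < x) :
    ∫⁻ ω, ENNReal.ofReal (x ^ step t ω) ∂μ = ENNReal.ofReal (stepGen ε x) := by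
  have hm : ∀ i, MeasurableSet {ω | step t ω = i} := fun i => h.meas t (measurableSet_singleton i)
  have hi : ∀ (i : ℤ) (c : ℝ≥0∞), Measurable
      fun ω => {ω | step t ω = i}.indicator (fun _ => c) ω := fun i c =>
    measurable_const.indicator (hm i)
  have h2 : ∫⁻ ω, ENNReal.ofReal (x ^ step t ω) ∂μ =
      ∫⁻ ω, ({ω | step t ω = -1}.indicator (fun _ => ENNReal.ofReal x⁻¹) ω +
        {ω | step t ω = 0}.indicator (fun _ => 1) ω) +
        {ω | step t ω = 1}.indicator (fun _ => ENNReal.ofReal x) ω ∂μ := by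
    refine lintegral_congr_ae ?_
    filter_upwards [h.ae_step h0 h1 t] with ω hω
    rcases hω with hω | hω | hω <;> simp [hω]
  rw [h2, lintegral_add_right _ (hi 1 _), lintegral_add_right _ (hi 0 _),
    lintegral_indicator_const (hm _), lintegral_indicator_const (hm _),
    lintegral_indicator_const (hm _), h.down, h.stay, h.up, one_mul,
    ← ENNReal.ofReal_mul (by positivity), ← ENNReal.ofReal_mul hx.le,
    ← ENNReal.ofReal_add (mul_nonneg (by positivity) (by linarith)) (by norm_num),
    ← ENNReal.ofReal_add (add_nonneg (mul_nonneg (by positivity) (by linarith)) (by norm_num))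
      (mul_nonneg hx.le (by linarith)), stepGen]
  congr 1
  ring

theorem lintegral_mul_zpow [IsProbabilityMeasure μ] (h : IsBiasedWalk ε μ step) (h0 : 0 ≤ ε) (h1 : ε < 1 / 8) (t : ℕ)
    {x : ℝ} (hx : 0 < x) {G : (ℕ → ℤ) → ℝ≥0∞}
    (hG : ∀ v w : ℕ → ℤ, (∀ i < t, v i = w i) → G v = G w) :
    ∫⁻ ω, G (fun i => step i ω) * ENNReal.ofReal (x ^ step t ω) ∂μ =
      ENNReal.ofReal (stepGen ε x) * ∫⁻ ω, G (fun i => step i ω) ∂μ := by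
  -- Coordinates from `t` on do not affect `G` and are filled with 0. `G` then factors through a
  -- countable space, where measurability is automatic.
  let ext : (Finset.range t → ℤ) → ℕ → ℤ := fun v i =>
    if hi : i ∈ Finset.range t then v ⟨i, hi⟩ else 0
  let G' : (Finset.range t → ℤ) → ℝ≥0∞ := fun v => G (ext v)
  have hG' : ∀ ω, G (fun i => step i ω) = G' fun i => step i ω := by
    intro ω
    refine hG _ _ fun i hi => ?_
    simp [ext, hi]
  have hind := h.indep.indepFun_finset (Finset.range t) {t} (by simp) h.meas
  let H : (({t} : Finset ℕ) → ℤ) → ℝ≥0∞ := fun v =>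
    ENNReal.ofReal (x ^ v ⟨t, Finset.mem_singleton_self t⟩)
  have hmG : Measurable G' := measurable_of_countable _
  have hmH : Measurable H := measurable_of_countable _
  have hind' := hind.comp hmG hmH
  have hmv : ∀ s : Finset ℕ, Measurable fun ω (i : s) => step i ω := fun s =>
    measurable_pi_lambda _ fun i => h.meas i
  have := lintegral_mul_eq_lintegral_mul_lintegral_of_indepFun (hmG.comp (hmv _))
    (hmH.comp (hmv _)) hind'
  rw [← h.lintegral_zpow h0 h1 t hx, mul_comm]
  simp_rw [hG']
  exact this

theorem lintegral_sum_zpow [IsProbabilityMeasure μ] (h : IsBiasedWalk ε μ step) (h0 : 0 ≤ ε) (h1 : ε < 1 / 8) {x : ℝ}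
    (hx : 0 < x) (t : ℕ) :
    ∫⁻ ω, ENNReal.ofReal (x ^ ∑ s ∈ Finset.range t, step s ω) ∂μ =
      ENNReal.ofReal (stepGen ε x) ^ t := by
  induction t with
  | zero => simp
  | succ t ih =>
    have h2 := h.lintegral_mul_zpow h0 h1 t hx
      (G := fun v => ENNReal.ofReal (x ^ ∑ s ∈ Finset.range t, v s)) fun v w hvw => by
        rw [Finset.sum_congr rfl fun i hi => hvw i (Finset.mem_range.1 hi)]
    rw [ih] at h2
    rw [pow_succ', ← h2]
    refine lintegral_congr fun ω => ?_
    rw [Finset.sum_range_succ, zpow_add₀ hx.ne', ENNReal.ofReal_mul (by positivity)]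

/-- The walk stays below `κ` up to time `N`. -/
def below (step : ℕ → Ω → ℤ) (κ N : ℕ) : Set Ω :=
  {ω | ∀ t ≤ N, ∑ s ∈ Finset.range t, step s ω < κ}

theorem measurable_sum (h : IsBiasedWalk ε μ step) (t : ℕ) :
    Measurable fun ω => ∑ s ∈ Finset.range t, step s ω :=
  Finset.measurable_fun_sum _ fun s _ => h.meas s

theorem measurableSet_below (h : IsBiasedWalk ε μ step) (κ N : ℕ) :
    MeasurableSet (below step κ N) := by
  have : below step κ N = ⋂ t : ℕ, ⋂ _ : t ≤ N, {ω | ∑ s ∈ Finset.range t, step s ω < κ} := by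
    ext ω
    simp [below]
  rw [this]
  exact MeasurableSet.iInter fun t => MeasurableSet.iInter fun _ =>
    measurableSet_lt (h.measurable_sum t) measurable_const

theorem below_succ (κ N : ℕ) : below step κ (N + 1) =
    below step κ N \ {ω | (κ : ℤ) ≤ ∑ s ∈ Finset.range (N + 1), step s ω} := by
  ext ω
  simp only [below, Set.mem_ofPred_eq, Set.mem_sdiff, not_le]
  constructor
  · exact fun h => ⟨fun t ht => h t (by omega), h _ le_rfl⟩
  · rintro ⟨h1, h2⟩ t ht
    rcases Nat.lt_or_eq_of_le ht with h3 | rfl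
    · exact h1 t (by omega)
    · exact h2

/-- Optional stopping at the time when the walk reaches `κ`. -/
theorem stopped_eq_one [IsProbabilityMeasure μ] {P : Params} (hP : P.Admissible) (h : IsBiasedWalk P.ε μ step) {κ : ℕ}
    (hκ : 0 < κ) (N : ℕ) :
    ENNReal.ofReal (P.p ^ κ) * μ (below step κ N)ᶜ +
      ∫⁻ ω in below step κ N, ENNReal.ofReal (P.p ^ ∑ s ∈ Finset.range N, step s ω) ∂μ = 1 := by
  have hp0 : 0 < P.p := by linarith [hP.one_lt_p]
  induction N with
  | zero =>
    have : below step κ 0 = Set.univ := by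
      ext ω
      simp [below, hκ]
    simp [this]
  | succ N ih =>
    set U : Set Ω := {ω | (κ : ℤ) ≤ ∑ s ∈ Finset.range (N + 1), step s ω} with hU
    have hUm : MeasurableSet U := measurableSet_le measurable_const (h.measurable_sum _)
    have hBm := h.measurableSet_below κ N
    -- The martingale step: staying below κ up to time `N` depends only on the steps before `N`, and
    -- `stepGen` at `p` is 1.
    have e1 : ∫⁻ ω in below step κ N, ENNReal.ofReal (P.p ^ ∑ s ∈ Finset.range N, step s ω) ∂μ =
        ∫⁻ ω in below step κ N,
          ENNReal.ofReal (P.p ^ ∑ s ∈ Finset.range (N + 1), step s ω) ∂μ := by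
      have h2 := h.lintegral_mul_zpow hP.ε_nonneg hP.ε_lt N hp0
        (G := fun v => if ∀ t ≤ N, ∑ s ∈ Finset.range t, v s < κ then
          ENNReal.ofReal (P.p ^ ∑ s ∈ Finset.range N, v s) else 0) fun v w hvw => by
        have h3 : ∀ t ≤ N, ∑ s ∈ Finset.range t, v s = ∑ s ∈ Finset.range t, w s := fun t ht =>
          Finset.sum_congr rfl fun i hi => hvw i ((Finset.mem_range.1 hi).trans_le ht)
        have h4 : (∀ t ≤ N, ∑ s ∈ Finset.range t, v s < κ) ↔
            ∀ t ≤ N, ∑ s ∈ Finset.range t, w s < κ :=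
          forall₂_congr fun t ht => by rw [h3 t ht]
        simp only [h4, h3 N le_rfl]
      rw [stepGen_p hP, ENNReal.ofReal_one, one_mul] at h2
      rw [← lintegral_indicator hBm, ← lintegral_indicator hBm]
      refine Eq.trans (lintegral_congr fun ω => ?_) (h2.symm.trans (lintegral_congr fun ω => ?_))
      · by_cases hω : ω ∈ below step κ N
        · rw [Set.indicator_of_mem hω]
          exact (if_pos hω).symm
        · rw [Set.indicator_of_notMem hω]
          exact (if_neg hω).symm
      · by_cases hω : ω ∈ below step κ N
        · rw [Set.indicator_of_mem hω, Finset.sum_range_succ, zpow_add₀ hp0.ne',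
            ENNReal.ofReal_mul (by positivity)]
          exact congrArg (· * _) (if_pos hω)
        · rw [Set.indicator_of_notMem hω]
          exact (congrArg (· * _) (if_neg hω)).trans (zero_mul _)
    -- A step is at most 1, so the walk enters [κ, ∞) exactly at κ. This gives equality rather than
    -- a bound.
    have e2 : ∫⁻ ω in below step κ N ∩ U,
        ENNReal.ofReal (P.p ^ ∑ s ∈ Finset.range (N + 1), step s ω) ∂μ =
        ENNReal.ofReal (P.p ^ κ) * μ (below step κ N ∩ U) := by
      rw [← setLIntegral_const]
      refine setLIntegral_congr_fun_ae (hBm.inter hUm) ?_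
      filter_upwards [h.ae_step hP.ε_nonneg hP.ε_lt N] with ω hω hm
      have h5 : ∑ s ∈ Finset.range N, step s ω < κ := hm.1 N le_rfl
      have h6 : (κ : ℤ) ≤ ∑ s ∈ Finset.range (N + 1), step s ω := hm.2
      rw [Finset.sum_range_succ] at h6 ⊢
      rw [show ∑ s ∈ Finset.range N, step s ω + step N ω = (κ : ℤ) by omega, zpow_natCast]
    have e3 : (below step κ (N + 1))ᶜ = (below step κ N)ᶜ ∪ (below step κ N ∩ U) := by
      rw [below_succ]
      ext ω
      simp only [Set.mem_compl_iff, Set.mem_sdiff, Set.mem_union, Set.mem_inter_iff]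
      tauto
    have e4 : μ (below step κ (N + 1))ᶜ = μ (below step κ N)ᶜ + μ (below step κ N ∩ U) := by
      rw [e3, measure_union _ (hBm.inter hUm)]
      exact Set.disjoint_left.2 fun ω h7 h8 => h7 h8.1
    rw [e4, mul_add, add_assoc, ← e2, below_succ, lintegral_inter_add_sdiff _ _ hUm, ← e1]
    exact ih

/-- Below κ one factor (√p)^S of p^S is at most (√p)^κ; the other has mean `stepGen` at √p to the
power `N`, which tends to 0. -/
theorem lintegral_below_le [IsProbabilityMeasure μ] {P : Params} (hP : P.Admissible) (h : IsBiasedWalk P.ε μ step)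
    (κ N : ℕ) :
    ∫⁻ ω in below step κ N, ENNReal.ofReal (P.p ^ ∑ s ∈ Finset.range N, step s ω) ∂μ ≤
      ENNReal.ofReal (√P.p ^ κ) * ENNReal.ofReal (stepGen P.ε (√P.p)) ^ N := by
  have hp := hP.one_lt_p
  have hs : √P.p * √P.p = P.p := Real.mul_self_sqrt (by linarith)
  have hs1 : 1 < √P.p := by rw [Real.lt_sqrt] <;> linarith
  have hs0 : 0 < √P.p := by linarith
  rw [← h.lintegral_sum_zpow hP.ε_nonneg hP.ε_lt hs0, ← lintegral_const_mul']
  · refine (setLIntegral_mono' (h.measurableSet_below κ N) fun ω hω => ?_).trans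
      (setLIntegral_le_lintegral _ _)
    rw [← ENNReal.ofReal_mul (by positivity)]
    refine ENNReal.ofReal_le_ofReal ?_
    have h1 : ∑ s ∈ Finset.range N, step s ω < κ := hω N le_rfl
    nth_rewrite 1 [← hs]
    rw [mul_zpow]
    refine mul_le_mul_of_nonneg_right ?_ (by positivity)
    rw [← zpow_natCast]
    exact zpow_le_zpow_right₀ hs1.le h1.le
  · exact ENNReal.ofReal_ne_top

/-- The ruin probability. -/
theorem measure_exists_le [IsProbabilityMeasure μ] {P : Params} (hP : P.Admissible) (h : IsBiasedWalk P.ε μ step) (κ : ℕ) :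
    μ {ω | ∃ t : ℕ, (κ : ℤ) ≤ ∑ s ∈ Finset.range t, step s ω} =
      ENNReal.ofReal ((P.p ^ κ)⁻¹) := by
  have hp0 : 0 < P.p := by linarith [hP.one_lt_p]
  rcases Nat.eq_zero_or_pos κ with rfl | hκ
  · have : {ω | ∃ t : ℕ, ((0 : ℕ) : ℤ) ≤ ∑ s ∈ Finset.range t, step s ω} = Set.univ := by
      ext ω
      simp only [Set.mem_ofPred_eq, Set.mem_univ, iff_true]
      exact ⟨0, by simp⟩
    rw [this]
    simp
  have hU : {ω | ∃ t : ℕ, (κ : ℤ) ≤ ∑ s ∈ Finset.range t, step s ω} =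
      ⋃ N, (below step κ N)ᶜ := by
    ext ω
    simp only [below, Set.mem_ofPred_eq, Set.mem_iUnion, Set.mem_compl_iff, not_forall, not_lt]
    exact ⟨fun ⟨t, ht⟩ => ⟨t, t, le_rfl, ht⟩, fun ⟨_, t, _, ht⟩ => ⟨t, ht⟩⟩
  have hmono : Monotone fun N => (below step κ N)ᶜ := fun N N' hN =>
    Set.compl_subset_compl.2 fun ω hω t ht => hω t (ht.trans hN)
  have hpκ : 0 < P.p ^ κ := by positivity
  have hlim1 := (tendsto_measure_iUnion_atTop (μ := μ) hmono)
  have hlim2 : Filter.Tendsto (fun N => ∫⁻ ω in below step κ N,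
      ENNReal.ofReal (P.p ^ ∑ s ∈ Finset.range N, step s ω) ∂μ) Filter.atTop (nhds 0) := by
    refine tendsto_of_tendsto_of_tendsto_of_le_of_le tendsto_const_nhds ?_ (fun _ => zero_le)
      (lintegral_below_le hP h κ)
    rw [← mul_zero (ENNReal.ofReal (√P.p ^ κ))]
    refine ENNReal.Tendsto.const_mul (ENNReal.tendsto_pow_atTop_nhds_zero_of_lt_one ?_)
      (Or.inr ENNReal.ofReal_ne_top)
    rw [ENNReal.ofReal_lt_one]
    exact stepGen_sqrt_lt hP
  have hlim3 := (ENNReal.Tendsto.const_mul hlim1 (Or.inr (ENNReal.ofReal_ne_top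
    (r := P.p ^ κ)))).add hlim2
  simp only [Function.comp_def, stopped_eq_one hP h hκ, add_zero] at hlim3
  have hone := tendsto_nhds_unique tendsto_const_nhds hlim3
  rw [hU, ENNReal.ofReal_inv_of_pos hpκ]
  exact ENNReal.eq_inv_of_mul_eq_one_left (by rw [mul_comm]; exact hone.symm)

end IsBiasedWalk
end Walk
end Interlude

theorem mainTheorem2 :
    (∃ c : ℝ, 0 < c ∧ ∃ κ₀ : ℕ,
      ∀ P : Interlude.Params, P.Admissible →
      ∀ (Tx : Type*) [Countable Tx] (Ω : Type*) [mΩ : MeasurableSpace Ω]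
        (μ : MeasureTheory.Measure Ω) [MeasureTheory.IsProbabilityMeasure μ]
        (ℱ : MeasureTheory.Filtration ℕ mΩ)
        (X : Ω → Interlude.Trace P.n P.m P.k Tx), Interlude.IsExecution P μ ℱ X →
      ∀ (T : Tx) (r₀ κ : ℕ), κ₀ ≤ κ →
        μ {ω | (X ω).Reverted T κ r₀} ≤ ENNReal.ofReal (Real.exp (-(c * (κ : ℝ))))) ∧
    (∀ P : Interlude.Params, P.Admissible → 1 < P.p ∧
      ∀ (Ω : Type*) [MeasurableSpace Ω] (μ : MeasureTheory.Measure Ω)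
        [MeasureTheory.IsProbabilityMeasure μ] (step : ℕ → Ω → ℤ),
        Interlude.IsBiasedWalk P.ε μ step →
      ∀ κ : ℕ, μ {ω | ∃ t : ℕ, (κ : ℤ) ≤ ∑ s ∈ Finset.range t, step s ω} =
        ENNReal.ofReal ((P.p ^ κ)⁻¹)) := by
  refine ⟨⟨Interlude.decay / 4, by have := Interlude.decay_pos; positivity,
    Interlude.exists_measure_reverted_le⟩, fun P hP => ⟨hP.one_lt_p, ?_⟩⟩
  intro Ω _ μ _ step h κ
  exact h.measure_exists_le hP κ
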